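/- **Setting.** Let $\mathit{Proc}$ and $\mathit{Act}$ be finite sets and let $\mathrm{dom}$ assign to each action a nonempty set of processes. A *(deterministic) negotiation* $\mathcal N$ consists of a finite set of nodes, each node $n$ with a nonempty domain $\mathrm{dnode}(n)\subseteq \mathit{Proc}$, an initial node $n_{init}$ and a final node $n_{fin}$, both with domain $\mathit{Proc}$, and a partial transition function $\delta(n,a,p)$ with values in the nodes, such that, if $n'=\delta(n,a,p)$ is defined, then $\mathrm{dnode}(n)=\mathrm{dom}(a)$, $p\in\mathrm{dom}(a)\cap\mathrm{dnode}(n')$, and $\delta(n,a,q)$ is defined for all $q\in\mathrm{dom}(a)$; the final node has no outgoing actions. Write $n\xrightarrow{(a,p)}n'$ for $\delta(n,a,p)=n'$, and $a\in out(n)$ if $\delta(n,a,p)$ is defined for some $p$. The size of $\mathcal N$ is its number of nodes plus its number of transitions. A configuration maps each process to a node; if all $p\in\mathrm{dnode}(n)$ are at $n$ and $a\in out(n)$, then $a$ can be executed, which moves each $p\in\mathrm{dom}(a)$ to $\delta(n,a,p)$ and leaves the other processes where they are. Executions start with all processes at $n_{init}$ and are successful if they end with all processes at $n_{fin}$; $L(\mathcal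 N)\subseteq \mathit{Act}^*$ is the set of successful executions. $\mathcal N$ is *sound* if every execution can be extended to a successful one. Let $\approx$ be the (Mazurkiewicz trace) equivalence on $\mathit{Act}^*$ generated by exchanging adjacent actions with disjoint domains. A word $t$ is *co-prime* if for some action $b=:\min(t)$ every $v\approx t$ starts with $b$; then $\mathrm{dmin}(t)=\mathrm{dom}(b)$. A *$(b,p)$-step* is a co-prime word $bs'$ with $p\in\mathrm{dom}(b)$ such that $p$ takes part in no action of $s'$. Let $\mathcal N$ be a sound negotiation of size $s$ and $L=L(\mathcal N)$. Learner does not know $\mathcal N$, but may ask membership queries "$w\in L$?". She keeps a finite set $Q\subseteq \mathit{Act}^*$ with $\varepsilon\in Q$ and exactly one element in $L$, a finite set $T\subseteq\mathit{Act}^*$ consisting of $\varepsilon$ and of co-prime words, and a partial function $S:Q\times \mathit{Act}\times \mathit{Proc}\to \mathit{Act}^*$ whose value $S(u,b,p)$, where defined, is a $(b,p)$-step. With $x\equiv_T y$ meaning that $xt\in L\iff yt\in L$ for all $t\in T$, the following invariants hold: * Uniqueness: if $u,v\in Q$ and $u\equiv_T v$ then $u=v$. * Pref: for every $u\in Q$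 there is $t\in T$ with $ut\in L$. * Domain: if $S(u,b,p)$ is defined then $S(u,b,q)$ is defined for all $q\in\mathrm{dom}(b)$. * Pref$'$: if $S(u,b,p)$ is defined then there is $t\in T$ with $u\,S(u,b,p)\,t\in L$, and with $p\in\mathrm{dmin}(t)$ if $t\neq\varepsilon$. * Closure: if $S(u,b,p)$ is defined then $u\,S(u,b,p)\equiv_T v$ for some $v\in Q$. The *hypothesis negotiation* $\widetilde{\mathcal N}$ has the set of nodes $Q$; $\mathrm{dnode}(u)=\mathrm{dmin}(t)$ if $ut\in L$ for a co-prime $t\in T$, and $\mathrm{dnode}(u)=\mathit{Proc}$ if $u\in L$; it has the transition $u\xrightarrow{(b,p)}v$ if $S(u,b,p)$ is defined and $u\,S(u,b,p)\equiv_T v$; its initial node is $\varepsilon$ and its final node is the element of $Q\cap L$. Let $m$ be a number such that for every $u\in Q$ there is $t\in T$ of length at most $m$ with $ut\in L$. An instance of * *Absent-trans* is a pair $(u,r)$ with $u\in Q$, $r$ co-prime, $ur\in L$ and $\min(r)\notin out(u)$ in $\widetilde{\mathcal N}$; * *Target* is a transition $u'\xrightarrow{(b,p)}u$ of $\widetilde{\mathcal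 N}$ together with a co-prime $r$ such that exactly one of $u'\,S(u',b,p)\,r$ and $ur$ is in $L$. **Proposition.** (1) There is an algorithm that, given $\widetilde{\mathcal N}$ (with its alphabet), decides without membership queries, in time polynomial in the size of its input, whether $\widetilde{\mathcal N}$ is sound. (2) There is an algorithm that, given $Q,T,S$ and $\widetilde{\mathcal N}$ with $\widetilde{\mathcal N}$ not sound, finds an instance of Absent-trans or an instance of Target, using $O(s|T|+\log m)$ membership queries; if it finds Absent-trans $(u,r)$, then $r$ has length at most $m$. The algorithms and the constant in $O(\cdot)$ do not depend on the alphabet, $\mathcal N$, $Q,T,S$ or $m$. -/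

import Mathlib

/-! ## Distributed alphabets, traces, negotiations -/

/-- A finite distributed alphabet: processes `Fin procs`, actions `Fin acts`, and the nonempty set
of processes taking part in each action. -/
structure DistAlphabet where
  procs : ℕ
  acts : ℕ
  dom : Fin acts → Finset (Fin procs)
  dom_nonempty : ∀ a, (dom a).Nonempty

namespace DistAlphabet

variable (Γ : DistAlphabet)

abbrev Proc : Type := Fin Γ.procs

abbrev Act : Type := Fin Γ.acts

/-- Sequences of actions. -/
abbrev Word : Type := List (Fin Γ.acts)

/-- Exchange of two adjacent independent actions. -/
def Swap (w₁ w₂ : Γ.Word) : Prop :=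
  ∃ (u v : Γ.Word) (a b : Γ.Act), Disjoint (Γ.dom a) (Γ.dom b) ∧
    w₁ = u ++ a :: b :: v ∧ w₂ = u ++ b :: a :: v

/-- `w₁` and `w₂` represent the same Mazurkiewicz trace. -/
def TraceEq : Γ.Word → Γ.Word → Prop :=
  Relation.ReflTransGen Γ.Swap

/-- `b` is the unique minimal action of the trace `t`: every representative starts with `b`. -/
def IsMin (t : Γ.Word) (b : Γ.Act) : Prop :=
  ∀ v, Γ.TraceEq t v → ∃ v₁, v = b :: v₁

/-- Co-prime traces. -/
def CoPrime (t : Γ.Word) : Prop :=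
  ∃ b, Γ.IsMin t b

/-- `s` is a `(b, p)`-step. -/
def IsStep (b : Γ.Act) (p : Γ.Proc) (s : Γ.Word) : Prop :=
  p ∈ Γ.dom b ∧ Γ.CoPrime s ∧ ∃ s₁, s = b :: s₁ ∧ ∀ c ∈ s₁, p ∉ Γ.dom c

/-- `x` and `y` cannot be told apart, relative to `L`, by the tests in `T`. -/
def EquivT (L : Set Γ.Word) (T : List Γ.Word) (x y : Γ.Word) : Prop :=
  ∀ t ∈ T, (x ++ t ∈ L ↔ y ++ t ∈ L)

end DistAlphabet

/-- The data of a (deterministic) negotiation diagram with nodes `Fin nodes`; the conditions on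
these data are in `Diagram.IsNegotiation`. -/
structure Diagram (Γ : DistAlphabet) where
  nodes : ℕ
  dnode : Fin nodes → Finset Γ.Proc
  δ : Fin nodes → Γ.Act → Γ.Proc → Option (Fin nodes)
  init : Fin nodes
  final : Fin nodes

namespace Diagram

variable {Γ : DistAlphabet} (M : Diagram Γ)

/-- The outgoing actions of a node. -/
def out (n : Fin M.nodes) : Set Γ.Act :=
  {a | ∃ p, (M.δ n a p).isSome}

structure IsNegotiation : Prop where
  dnode_nonempty : ∀ n, (M.dnode n).Nonempty
  dnode_init : M.dnode M.init = Finset.univ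
  dnode_final : M.dnode M.final = Finset.univ
  dom_match : ∀ n a p n₁, M.δ n a p = some n₁ →
    M.dnode n = Γ.dom a ∧ p ∈ Γ.dom a ∧ p ∈ M.dnode n₁ ∧ ∀ q ∈ Γ.dom a, (M.δ n a q).isSome
  out_final : M.out M.final = ∅

/-- Number of nodes plus number of transitions. -/
def size : ℕ :=
  M.nodes +
    (Finset.univ.filter fun x : Fin M.nodes × Γ.Act × Γ.Proc =>
      (M.δ x.1 x.2.1 x.2.2).isSome).card

abbrev Config : Type := Γ.Proc → Fin M.nodes

def Enabled (C : M.Config) (n : Fin M.nodes) : Prop :=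
  ∀ p ∈ M.dnode n, C p = n

def Step (C : M.Config) (a : Γ.Act) (C₁ : M.Config) : Prop :=
  ∃ n, M.Enabled C n ∧ a ∈ M.out n ∧
    (∀ p ∈ Γ.dom a, M.δ n a p = some (C₁ p)) ∧ ∀ p ∉ Γ.dom a, C₁ p = C p

/-- `M.Exec C w C₁`: the sequence `w` of actions leads from `C` to `C₁`. -/
inductive Exec : M.Config → Γ.Word → M.Config → Prop
  | nil (C : M.Config) : Exec C [] C
  | cons {C C₁ C₂ : M.Config} {a : Γ.Act} {w : Γ.Word} :
      M.Step C a C₁ → Exec C₁ w C₂ → Exec C (a :: w) C₂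

def initConfig : M.Config := fun _ => M.init

def finalConfig : M.Config := fun _ => M.final

/-- The language: the successful executions. -/
def language : Set Γ.Word :=
  {w | M.Exec M.initConfig w M.finalConfig}

def Sound : Prop :=
  ∀ w C, M.Exec M.initConfig w C → ∃ v, M.Exec C v M.finalConfig

end Diagram

/-! ## The data kept by Learner and the hypothesis negotiation -/

/-- Learner's data: the set `Q` of nodes (enumerated by `Fin numQ`), the set `T` of tests
(given as a list) and the supports `S` of the transitions. -/
structure Table (Γ : DistAlphabet) where
  numQ : ℕ
  Q : Fin numQ → Γ.Word
  T : List Γ.Word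
  S : Fin numQ → Γ.Act → Γ.Proc → Option Γ.Word

namespace Table

variable {Γ : DistAlphabet}

/-- The invariants of Learner's data, relative to the language `L` to be learned. -/
structure Invariants (H : Table Γ) (L : Set Γ.Word) : Prop where
  exists_init : ∃ u, H.Q u = []
  existsUnique_final : ∃! u, H.Q u ∈ L
  nodup_T : H.T.Nodup
  nil_mem_T : [] ∈ H.T
  coPrime_T : ∀ t ∈ H.T, t ≠ [] → Γ.CoPrime t
  isStep_S : ∀ u b p s, H.S u b p = some s → Γ.IsStep b p s
  uniqueness : ∀ u v, Γ.EquivT L H.T (H.Q u) (H.Q v) → u = v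
  pref : ∀ u, ∃ t ∈ H.T, H.Q u ++ t ∈ L
  domain : ∀ u b p, (H.S u b p).isSome → ∀ q ∈ Γ.dom b, (H.S u b q).isSome
  pref_support : ∀ u b p s, H.S u b p = some s →
    ∃ t ∈ H.T, H.Q u ++ s ++ t ∈ L ∧ (t ≠ [] → ∃ a, Γ.IsMin t a ∧ p ∈ Γ.dom a)
  closure : ∀ u b p s, H.S u b p = some s → ∃ v, Γ.EquivT L H.T (H.Q u ++ s) (H.Q v)

open Classical in
/-- The hypothesis negotiation. By the invariants, the domain below is the domain of `min t` for
every co-prime test `t` with `Q u ++ t ∈ L`, respectively the set of all processes if `Q u ∈ L`,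
and there is exactly one `v` to be found as the target of a transition. -/
noncomputable def hyp (H : Table Γ) (L : Set Γ.Word) (hH : H.Invariants L) : Diagram Γ where
  nodes := H.numQ
  dnode u := Finset.univ.filter fun p =>
    H.Q u ∈ L ∨ ∃ t ∈ H.T, H.Q u ++ t ∈ L ∧ ∃ a, Γ.IsMin t a ∧ p ∈ Γ.dom a
  δ u b p := (H.S u b p).bind fun s =>
    (List.finRange H.numQ).find? fun v => decide (Γ.EquivT L H.T (H.Q u ++ s) (H.Q v))
  init := hH.exists_init.choose
  final := hH.existsUnique_final.choose

end Table

/-- What Learner looks for: Absent-trans `(u, r)`, or Target for a transition from `u₁` to `u`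
labelled `(b, p)` and a trace `r`. -/
inductive Finding (Γ : DistAlphabet) (n : ℕ)
  | absent (u : Fin n) (r : Γ.Word)
  | target (u₁ : Fin n) (b : Γ.Act) (p : Γ.Proc) (u : Fin n) (r : Γ.Word)

/-- The finding is an instance of Absent-trans, respectively of Target. -/
def Finding.Holds {Γ : DistAlphabet} (H : Table Γ) (L : Set Γ.Word) (hH : H.Invariants L) :
    Finding Γ H.numQ → Prop
  | .absent u r => H.Q u ++ r ∈ L ∧ ∃ a, Γ.IsMin r a ∧ a ∉ (H.hyp L hH).out u
  | .target u₁ b p u r =>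
      (H.hyp L hH).δ u₁ b p = some u ∧ Γ.CoPrime r ∧
        ∃ s, H.S u₁ b p = some s ∧ ¬ (H.Q u₁ ++ s ++ r ∈ L ↔ H.Q u ++ r ∈ L)

/-! ## Programs with membership queries -/

/-- Data of programs: binary trees. -/
inductive DTree
  | nil
  | cons (x y : DTree)

namespace DTree

def fst : DTree → DTree
  | nil => nil
  | cons x _ => x

def snd : DTree → DTree
  | nil => nil
  | cons _ y => y

def size : DTree → ℕ
  | nil => 1
  | cons x y => x.size + y.size + 1

def ofBool : Bool → DTree
  | false => nil
  | true => cons nil nil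

end DTree

/-- Programs over binary trees. Such programs, with unit cost for each elementary operation and
each test (trees being pointer structures), have the same polynomial-time decision problems as
Turing machines. `query` asks whether the word encoded by its argument is in the language. -/
inductive Prog
  | id
  | nil
  | fst
  | snd
  | pair (f g : Prog)
  | comp (g f : Prog)
  | ite (c f g : Prog)
  | while (c f : Prog)
  | query

/-- `Runs ans e x y t q`: with membership queries answered by `ans`, the program `e` started on `x`
halts with output `y` after `t` steps and `q` queries. Tests succeed on trees other than `nil`. -/
inductive Runs (ans : DTree → Bool) : Prog → DTree → DTree → ℕ → ℕ → Prop
  | id (x : DTree) : Runs ans .id x x 1 0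
  | nil (x : DTree) : Runs ans .nil x .nil 1 0
  | fst (x : DTree) : Runs ans .fst x x.fst 1 0
  | snd (x : DTree) : Runs ans .snd x x.snd 1 0
  | pair {f g : Prog} {x y z : DTree} {t₁ q₁ t₂ q₂ : ℕ} :
      Runs ans f x y t₁ q₁ → Runs ans g x z t₂ q₂ →
      Runs ans (.pair f g) x (.cons y z) (t₁ + t₂ + 1) (q₁ + q₂)
  | comp {f g : Prog} {x y z : DTree} {t₁ q₁ t₂ q₂ : ℕ} :
      Runs ans f x y t₁ q₁ → Runs ans g y z t₂ q₂ →
      Runs ans (.comp g f) x z (t₁ + t₂ + 1) (q₁ + q₂)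
  | ite_true {c f g : Prog} {x y z : DTree} {t₁ q₁ t₂ q₂ : ℕ} :
      Runs ans c x y t₁ q₁ → y ≠ .nil → Runs ans f x z t₂ q₂ →
      Runs ans (.ite c f g) x z (t₁ + t₂ + 1) (q₁ + q₂)
  | ite_false {c f g : Prog} {x z : DTree} {t₁ q₁ t₂ q₂ : ℕ} :
      Runs ans c x .nil t₁ q₁ → Runs ans g x z t₂ q₂ →
      Runs ans (.ite c f g) x z (t₁ + t₂ + 1) (q₁ + q₂)
  | while_done {c f : Prog} {x : DTree} {t q : ℕ} :
      Runs ans c x .nil t q → Runs ans (.while c f) x x (t + 1) q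
  | while_step {c f : Prog} {x y x₁ z : DTree} {t₁ q₁ t₂ q₂ t₃ q₃ : ℕ} :
      Runs ans c x y t₁ q₁ → y ≠ .nil → Runs ans f x x₁ t₂ q₂ →
      Runs ans (.while c f) x₁ z t₃ q₃ →
      Runs ans (.while c f) x z (t₁ + t₂ + t₃ + 1) (q₁ + q₂ + q₃)
  | query (x : DTree) : Runs ans .query x (DTree.ofBool (ans x)) 1 1

/-! ## Encodings of the inputs and outputs of programs -/

/-- Numbers in unary. -/
def encNat : ℕ → DTree
  | 0 => .nil
  | n + 1 => .cons .nil (encNat n)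

def encList {α : Type} (f : α → DTree) : List α → DTree
  | [] => .nil
  | a :: l => .cons (f a) (encList f l)

def encFin {n : ℕ} (i : Fin n) : DTree :=
  encNat i.val

def encFinset {n : ℕ} (s : Finset (Fin n)) : DTree :=
  encList encFin ((List.finRange n).filter fun i => decide (i ∈ s))

def encWord {Γ : DistAlphabet} (w : Γ.Word) : DTree :=
  encList encFin w

/-- The graph of a partial function on nodes, actions and processes, as a list. -/
def encPartial {Γ : DistAlphabet} {n : ℕ} {β : Type} (f : β → DTree)
    (F : Fin n → Γ.Act → Γ.Proc → Option β) : DTree :=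
  encList (fun e : DTree => e)
    ((List.finRange n).flatMap fun u =>
      (List.finRange Γ.acts).flatMap fun a =>
        (List.finRange Γ.procs).filterMap fun p =>
          (F u a p).map fun y => .cons (encFin u) (.cons (encFin a) (.cons (encFin p) (f y))))

def encAlphabet (Γ : DistAlphabet) : DTree :=
  .cons (encNat Γ.procs) (encList (fun a => encFinset (Γ.dom a)) (List.finRange Γ.acts))

/-- A negotiation diagram, together with its alphabet. -/
def encDiagram {Γ : DistAlphabet} (M : Diagram Γ) : DTree :=
  .cons (encAlphabet Γ)
    (.cons (encList (fun n => encFinset (M.dnode n)) (List.finRange M.nodes))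
      (.cons (encPartial encFin M.δ) (.cons (encFin M.init) (encFin M.final))))

def encTable {Γ : DistAlphabet} (H : Table Γ) : DTree :=
  .cons (encList (fun u => encWord (H.Q u)) (List.finRange H.numQ))
    (.cons (encList encWord H.T) (encPartial encWord H.S))

def encFinding {Γ : DistAlphabet} {n : ℕ} : Finding Γ n → DTree
  | .absent u r => .cons .nil (.cons (encFin u) (encWord r))
  | .target u₁ b p u r =>
      .cons (.cons .nil .nil)
        (.cons (encFin u₁) (.cons (encFin b) (.cons (encFin p) (.cons (encFin u) (encWord r)))))

open Classical in
/-- Teacher's answers to membership queries; a tree that encodes no word is answered negatively. -/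
noncomputable def membership {Γ : DistAlphabet} (L : Set Γ.Word) (x : DTree) : Bool :=
  decide (∃ w ∈ L, x = encWord w)

/-! ## Typed encodings and program combinators -/

/-! Soundness test. There are exponentially many configurations, so soundness has to be tested on
few of them. For every node from which the final node is locally reachable, fix one action that
takes some process closer to the final node (`IsStrategy`; `grow` computes such a choice). If the
action chosen at `u` takes that process to `v`, then `v` must be executed between any two executions
of `u`. Hence a node of rank k is executed at most k times, and runs that follow the strategy are
short (`SRun.length_le`). Such runs are also confluent (`SRun.diamond`), so whether the strategy
leads to success (`Good`) is decided by simply playing it.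

What remains is that an arbitrary action at a node `n` preserves `Good`. It commutes with all
strategy moves that avoid `n`. After as many of these moves as possible, `n` is the only enabled
node of the strategy, and then the configuration is determined by `n` alone (`SRun.isCanonical`):
each process is at its first node among those that the strategy visits from `n`, or at the final
node if there is none. So one play per transition suffices, from a configuration that is computed
directly (`sound_of_good`, `soundTest_iff`).

Structure of the unknown negotiation. The same uniqueness, applied to the sound `N`, shows that a
reachable configuration with a single active node is determined by that node (`Sound.only_unique`).
A co-prime word that leads to success forces such a configuration (`Exec.only_of_isMin`). Therefore
the hypothesis is a negotiation (`Invariants.isNegotiation`), and two steps of the same process with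
the same first action are interchangeable in front of tests that start with this process
(`Sound.step_congr`).

Counterexample, first case: some node `u` of the hypothesis cannot reach the final node. Take a
shortest test `t` that succeeds after `u`, and move a process `p` of its least action through the
hypothesis, replacing `t` by its residual after each step of `p` (`exists_step_fut`). The path
cannot end at the final node. If membership still holds where it ends, the next action is absent
there; otherwise membership is lost at some transition of the path, which is an instance of Target,
and binary search finds it with about log m queries (`lostItems_spec`).

Counterexample, second case: every node can reach the final node. Then unsoundness yields a
reachable deadlock `C` (`exists_deadlock`). For each process `q` the supports along its path form a
word `x`. If `x` and the word of the node `C q` agreed on all tests that start with `q`, for all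
`q`, then these local paths could be executed together in `N` (`Hist.exists_reachable`). By
soundness, `N` has finished or can continue there. If it has finished, all processes of `C` are at
the final node; if it continues at a node `n`, the processes of `n` have equivalent words, so by
Uniqueness they are at one node of the hypothesis, which is enabled. Both contradict the deadlock
(`exists_differ`). So some process and test disagree, and binary search along the path of this
process gives Target. The path is no longer than the number of configurations, at most 2 ^ (|T| ·
procs), because tests separate the nodes (`nodes_le`); moreover the number of processes is at most s
(`Sound.procs_le`).

Only queries are counted in the search, so the deadlock is found exhaustively, and `Comp` and `QFun`
carry no time bound. Polynomial time (`PolyFun`) is needed for the soundness test alone. -/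

/-- Types whose elements are encoded as binary trees. -/
class TreeEnc (α : Type) where
  enc : α → DTree

open TreeEnc (enc)

instance : TreeEnc DTree := ⟨fun x => x⟩
instance : TreeEnc Unit := ⟨fun _ => .nil⟩
instance : TreeEnc Bool := ⟨DTree.ofBool⟩
instance : TreeEnc ℕ := ⟨encNat⟩
instance {α β : Type} [TreeEnc α] [TreeEnc β] : TreeEnc (α × β) :=
  ⟨fun x => .cons (enc x.1) (enc x.2)⟩
instance {α : Type} [TreeEnc α] : TreeEnc (List α) := ⟨encList enc⟩

section Library

variable {α β γ σ : Type} [TreeEnc α] [TreeEnc β] [TreeEnc γ] [TreeEnc σ]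

/-- The size of the encoding. -/
def esize (a : α) : ℕ := (enc a).size

theorem enc_pair (a : α) (b : β) : enc (a, b) = .cons (enc a) (enc b) := rfl

theorem enc_cons (a : α) (l : List α) : enc (a :: l) = .cons (enc a) (enc l) := rfl

theorem esize_pair (a : α) (b : β) : esize (a, b) = esize a + esize b + 1 := rfl

theorem esize_nil : esize ([] : List α) = 1 := rfl

theorem esize_cons (a : α) (l : List α) : esize (a :: l) = esize a + esize l + 1 := rfl

theorem esize_succ (n : ℕ) : esize (n + 1) = esize n + 2 := by
  change 1 + (encNat n).size + 1 = (encNat n).size + 2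
  omega

theorem esize_bool_le (b : Bool) : esize b ≤ 3 := by
  cases b <;> simp [esize, enc, DTree.ofBool, DTree.size]

theorem length_lt_esize (l : List α) : l.length < esize l := by
  induction l with
  | nil => simp [esize_nil]
  | cons a l ih => simp only [List.length_cons, esize_cons]; omega

theorem esize_le_of_mem {l : List α} {a : α} (h : a ∈ l) : esize a < esize l := by
  induction l with
  | nil => simp at h
  | cons b l ih =>
    rw [esize_cons]
    rcases List.mem_cons.1 h with rfl | h
    · omega
    · have := ih h; omega

theorem esize_append (l₁ l₂ : List α) : esize (l₁ ++ l₂) + 1 = esize l₁ + esize l₂ := by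
  induction l₁ with
  | nil => simp [esize_nil]; omega
  | cons a l ih => simp only [List.cons_append, esize_cons]; omega

theorem esize_filter_le (p : α → Bool) (l : List α) : esize (l.filter p) ≤ esize l := by
  induction l with
  | nil => simp
  | cons a l ih => rw [List.filter_cons]; split <;> simp only [esize_cons] <;> omega

theorem polynomial_eval_mono (P : Polynomial ℕ) {m n : ℕ} (h : m ≤ n) :
    P.eval m ≤ P.eval n := by
  rw [Polynomial.eval_eq_sum, Polynomial.eval_eq_sum]
  exact Finset.sum_le_sum fun i _ => Nat.mul_le_mul_left _ (Nat.pow_le_pow_left h i)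

/-- `g` is bounded by a polynomial in the size of its argument. -/
def PolyBdd (g : α → ℕ) : Prop := ∃ P : Polynomial ℕ, ∀ a, g a ≤ P.eval (esize a)

namespace PolyBdd

theorem mono {g h : α → ℕ} (hh : PolyBdd h) (hle : ∀ a, g a ≤ h a) : PolyBdd g :=
  hh.imp fun _ hP a => (hle a).trans (hP a)

theorem const (n : ℕ) : PolyBdd fun _ : α => n := ⟨Polynomial.C n, fun a => by simp⟩

theorem size : PolyBdd fun a : α => esize a := ⟨Polynomial.X, fun a => by simp⟩

theorem add {g h : α → ℕ} (hg : PolyBdd g) (hh : PolyBdd h) : PolyBdd fun a => g a + h a := by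
  obtain ⟨P, hP⟩ := hg
  obtain ⟨R, hR⟩ := hh
  exact ⟨P + R, fun a => by rw [Polynomial.eval_add]; exact Nat.add_le_add (hP a) (hR a)⟩

theorem mul {g h : α → ℕ} (hg : PolyBdd g) (hh : PolyBdd h) : PolyBdd fun a => g a * h a := by
  obtain ⟨P, hP⟩ := hg
  obtain ⟨R, hR⟩ := hh
  exact ⟨P * R, fun a => by rw [Polynomial.eval_mul]; exact Nat.mul_le_mul (hP a) (hR a)⟩

theorem comp {g : β → ℕ} {f : α → β} (hg : PolyBdd g) (hf : PolyBdd fun a => esize (f a)) :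
    PolyBdd fun a => g (f a) := by
  obtain ⟨P, hP⟩ := hg
  obtain ⟨R, hR⟩ := hf
  refine ⟨P.comp R, fun a => ?_⟩
  rw [Polynomial.eval_comp]
  exact (hP _).trans (polynomial_eval_mono P (hR a))

end PolyBdd

/-- The program computes `f` without queries, in time at most `τ`. -/
def Prog.Computes (e : Prog) (f : α → β) (τ : α → ℕ) : Prop :=
  ∀ ans a, ∃ t, Runs ans e (enc a) (enc (f a)) t 0 ∧ t ≤ τ a

/-- `f` is computable without queries. -/
def Comp (f : α → β) : Prop := ∃ e τ, Prog.Computes e f τ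

/-- `f` is computable without queries in polynomial time, with outputs of polynomial size. -/
def PolyFun (f : α → β) : Prop :=
  (∃ e τ, Prog.Computes e f τ ∧ PolyBdd τ) ∧ PolyBdd fun a => esize (f a)

theorem PolyFun.toComp {f : α → β} (hf : PolyFun f) : Comp f := by
  obtain ⟨⟨e, τ, h, -⟩, -⟩ := hf
  exact ⟨e, τ, h⟩

namespace Prog.Computes

theorem id : Computes .id (fun a : α => a) fun _ => 1 := fun _ _ => ⟨1, Runs.id _, le_rfl⟩

theorem fst {e : Prog} {f : α → β × γ} {τ : α → ℕ} (h : Computes e f τ) :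
    Computes (.comp .fst e) (fun a => (f a).1) fun a => τ a + 2 := fun ans a => by
  obtain ⟨t, ht, hle⟩ := h ans a
  exact ⟨_, Runs.comp ht (Runs.fst _), by dsimp only; omega⟩

theorem snd {e : Prog} {f : α → β × γ} {τ : α → ℕ} (h : Computes e f τ) :
    Computes (.comp .snd e) (fun a => (f a).2) fun a => τ a + 2 := fun ans a => by
  obtain ⟨t, ht, hle⟩ := h ans a
  exact ⟨_, Runs.comp ht (Runs.snd _), by dsimp only; omega⟩

theorem comp {e₁ e₂ : Prog} {g : β → γ} {f : α → β} {τ₁ : β → ℕ} {τ₂ : α → ℕ}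
    (hg : Computes e₁ g τ₁) (hf : Computes e₂ f τ₂) :
    Computes (.comp e₁ e₂) (fun a => g (f a)) fun a => τ₂ a + τ₁ (f a) + 1 := fun ans a => by
  obtain ⟨t, ht, hle⟩ := hf ans a
  obtain ⟨t₁, ht₁, hle₁⟩ := hg ans (f a)
  exact ⟨_, Runs.comp ht ht₁, by dsimp only; omega⟩

theorem pair {e₁ e₂ : Prog} {f : α → β} {g : α → γ} {τ₁ τ₂ : α → ℕ}
    (hf : Computes e₁ f τ₁) (hg : Computes e₂ g τ₂) :
    Computes (.pair e₁ e₂) (fun a => (f a, g a)) fun a => τ₁ a + τ₂ a + 1 := fun ans a => by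
  obtain ⟨t, ht, hle⟩ := hf ans a
  obtain ⟨t₁, ht₁, hle₁⟩ := hg ans a
  exact ⟨_, Runs.pair ht ht₁, by dsimp only; omega⟩

theorem ite {e₁ e₂ e₃ : Prog} {c : α → Bool} {f g : α → β} {τ₁ τ₂ τ₃ : α → ℕ}
    (hc : Computes e₁ c τ₁) (hf : Computes e₂ f τ₂) (hg : Computes e₃ g τ₃) :
    Computes (.ite e₁ e₂ e₃) (fun a => if c a then f a else g a)
      fun a => τ₁ a + τ₂ a + τ₃ a + 1 := fun ans a => by
  obtain ⟨t, ht, hle⟩ := hc ans a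
  cases h : c a with
  | true =>
    obtain ⟨t₁, ht₁, hle₁⟩ := hf ans a
    rw [h] at ht
    refine ⟨t + t₁ + 1, by
      simpa [h] using Runs.ite_true (g := e₃) ht (by simp [enc, DTree.ofBool]) ht₁, ?_⟩
    dsimp only
    omega
  | false =>
    obtain ⟨t₁, ht₁, hle₁⟩ := hg ans a
    rw [h] at ht
    refine ⟨t + t₁ + 1, by simpa [h] using Runs.ite_false (f := e₂) ht ht₁, ?_⟩
    dsimp only
    omega

end Prog.Computes

/-- The program that always outputs the tree. -/
def constProg : DTree → Prog
  | .nil => .nil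
  | .cons x y => .pair (constProg x) (constProg y)

theorem runs_constProg (x : DTree) :
    ∃ t, ∀ ans y, Runs ans (constProg x) y x t 0 := by
  induction x with
  | nil => exact ⟨1, fun ans y => Runs.nil y⟩
  | cons x y ihx ihy =>
    obtain ⟨t₁, h₁⟩ := ihx
    obtain ⟨t₂, h₂⟩ := ihy
    exact ⟨_, fun ans z => Runs.pair (h₁ ans z) (h₂ ans z)⟩

/-! ### Loops over lists -/

/-- One step of the loop below. -/
def foldBody (e : Prog) : Prog :=
  .pair .fst (.pair
    (.comp e (.pair .fst (.pair (.comp .fst .snd) (.comp .fst (.comp .snd .snd)))))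
    (.comp .snd (.comp .snd .snd)))

/-- A loop on triples of a parameter, a state and a list. -/
def foldLoop (e : Prog) : Prog := .while (.comp .snd .snd) (foldBody e)

/-- The time taken by the loop. -/
def foldTime {σ β : Type} (h : σ → β → σ) (τ : σ → β → ℕ) : σ → List β → ℕ
  | _, [] => 4
  | s, b :: l => τ s b + 24 + foldTime h τ (h s b) l

/-- The number of queries of the loop. -/
def foldCost {σ β : Type} (h : σ → β → σ) (c : σ → β → ℕ) : σ → List β → ℕ
  | _, [] => 0
  | s, b :: l => c s b + foldCost h c (h s b) l

theorem foldCost_zero {σ β : Type} (h : σ → β → σ) (l : List β) (s : σ) :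
    foldCost h (fun _ _ => 0) s l = 0 := by
  induction l generalizing s with
  | nil => rfl
  | cons b l ih => rw [foldCost, ih]

theorem foldCost_mono {σ β : Type} {h : σ → β → σ} {c c₁ : σ → β → ℕ} (hc : ∀ s b, c s b ≤ c₁ s b)
    (l : List β) (s : σ) : foldCost h c s l ≤ foldCost h c₁ s l := by
  induction l generalizing s with
  | nil => exact le_rfl
  | cons b l ih => exact Nat.add_le_add (hc s b) (ih _)

theorem foldCost_le {σ β : Type} {h : σ → β → σ} {c : σ → β → ℕ} {K : ℕ} (hc : ∀ s b, c s b ≤ K)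
    (l : List β) (s : σ) : foldCost h c s l ≤ K * l.length := by
  induction l generalizing s with
  | nil => exact le_rfl
  | cons b l ih =>
    have := Nat.add_le_add (hc s b) (ih (h s b))
    rw [List.length_cons, Nat.mul_succ, Nat.add_comm]
    exact this

/-- In `foldTime`, 24 is made up of 3 steps for the guard, 20 for the body apart from `e`, and 1 for
the loop itself; the final 4 is the failing guard. -/
theorem runs_foldLoop {ans : DTree → Bool} {e : Prog} {a : α} {h : σ → β → σ} {τ c : σ → β → ℕ}
    (he : ∀ s b, ∃ t, Runs ans e (enc (a, s, b)) (enc (h s b)) t (c s b) ∧ t ≤ τ s b)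
    (l : List β) (s : σ) :
    ∃ t, Runs ans (foldLoop e) (enc (a, s, l)) (enc (a, l.foldl h s, ([] : List β))) t
      (foldCost h c s l) ∧ t ≤ foldTime h τ s l := by
  induction l generalizing s with
  | nil =>
    refine ⟨_, Runs.while_done (t := 3) (q := 0) ?_, le_rfl⟩
    exact Runs.comp (Runs.snd _) (Runs.snd _)
  | cons b l ih =>
    obtain ⟨t₁, h₁, hle₁⟩ := he s b
    obtain ⟨t₂, h₂, hle₂⟩ := ih (h s b)
    have hc : Runs ans (.comp .snd .snd) (enc (a, s, b :: l)) (enc (b :: l)) 3 0 :=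
      Runs.comp (Runs.snd _) (Runs.snd _)
    have hx : Runs ans (.pair .fst (.pair (.comp .fst .snd) (.comp .fst (.comp .snd .snd))))
        (enc (a, s, b :: l)) (enc (a, s, b)) 11 0 :=
      Runs.pair (Runs.fst _) (Runs.pair (Runs.comp (Runs.snd _) (Runs.fst _))
        (Runs.comp (Runs.comp (Runs.snd _) (Runs.snd _)) (Runs.fst _)))
    have hl : Runs ans (.comp .snd (.comp .snd .snd)) (enc (a, s, b :: l)) (enc l) 5 0 :=
      Runs.comp (Runs.comp (Runs.snd _) (Runs.snd _)) (Runs.snd _)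
    have h₃ : Runs ans (foldBody e) (enc (a, s, b :: l)) (enc (a, h s b, l)) _ _ :=
      Runs.pair (Runs.fst _) (Runs.pair (Runs.comp hx h₁) hl)
    have h₄ := Runs.while_step hc (by simp [enc_cons]) h₃ h₂
    rw [show 0 + (0 + (0 + c s b + 0)) + foldCost h c (h s b) l = foldCost h c s (b :: l) by
      simp only [foldCost]; omega] at h₄
    refine ⟨_, h₄, ?_⟩
    simp only [foldTime]
    omega

theorem runs_foldProg {ans : DTree → Bool} {ef eg eh : Prog} {a : α} {l : List β} {s : σ}
    {h : σ → β → σ} {τ c : σ → β → ℕ} {t₁ t₂ : ℕ}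
    (hf : Runs ans ef (enc a) (enc l) t₁ 0) (hg : Runs ans eg (enc a) (enc s) t₂ 0)
    (he : ∀ s b, ∃ t, Runs ans eh (enc (a, s, b)) (enc (h s b)) t (c s b) ∧ t ≤ τ s b) :
    ∃ t, Runs ans (.comp (.comp .fst .snd) (.comp (foldLoop eh) (.pair .id (.pair eg ef))))
      (enc a) (enc (l.foldl h s)) t (foldCost h c s l) ∧ t ≤ t₁ + t₂ + foldTime h τ s l + 10 := by
  obtain ⟨t₃, h₃, hle₃⟩ := runs_foldLoop he l s
  have h₄ := Runs.comp (Runs.comp (Runs.pair (Runs.id _) (Runs.pair hg hf)) h₃)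
    (Runs.comp (Runs.snd _) (Runs.fst _))
  rw [show 0 + (0 + 0) + foldCost h c s l + (0 + 0) = foldCost h c s l by omega] at h₄
  exact ⟨_, h₄, by omega⟩

theorem computes_foldl {ef eg eh : Prog} {f : α → List β} {g : α → σ} {h : α → σ → β → σ}
    {τ₁ τ₂ : α → ℕ} {τ₃ : α × σ × β → ℕ} (hf : ef.Computes f τ₁) (hg : eg.Computes g τ₂)
    (hh : eh.Computes (fun x : α × σ × β => h x.1 x.2.1 x.2.2) τ₃) :
    ∃ e : Prog, e.Computes (fun a => (f a).foldl (h a) (g a))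
      fun a => τ₁ a + τ₂ a + foldTime (h a) (fun s b => τ₃ (a, s, b)) (g a) (f a) + 10 := by
  refine ⟨.comp (.comp .fst .snd) (.comp (foldLoop eh) (.pair .id (.pair eg ef))),
    fun ans a => ?_⟩
  obtain ⟨t₁, h₁, hle₁⟩ := hf ans a
  obtain ⟨t₂, h₂, hle₂⟩ := hg ans a
  obtain ⟨t₃, h₃, hle₃⟩ := runs_foldProg (h := h a) (τ := fun s b => τ₃ (a, s, b))
    (c := fun _ _ => 0) h₁ h₂ (fun s b => hh ans (a, s, b))
  rw [foldCost_zero] at h₃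
  refine ⟨_, h₃, ?_⟩
  dsimp only at hle₃ ⊢
  omega

/-- The bound is asked only for states that occur after a prefix of the list: these have controlled
size, arbitrary states do not. -/
theorem foldTime_le {σ β : Type} {h : σ → β → σ} {τ : σ → β → ℕ} {K : ℕ} (l : List β) (s : σ)
    (hK : ∀ l₁ b l₂, l = l₁ ++ b :: l₂ → τ (l₁.foldl h s) b ≤ K) :
    foldTime h τ s l ≤ l.length * (K + 24) + 4 := by
  induction l generalizing s with
  | nil => simp [foldTime]
  | cons b l ih =>
    have h₁ := hK [] b l rfl
    have h₂ := ih (h s b) fun l₁ c l₂ hl => hK (b :: l₁) c l₂ (by rw [hl]; rfl)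
    simp only [List.foldl_nil] at h₁
    simp only [foldTime, List.length_cons]
    rw [Nat.add_mul]
    omega

/-! ### Closure properties of query-free computability. -/

namespace Comp

theorem comp {g : β → γ} {f : α → β} (hg : Comp g) (hf : Comp f) : Comp fun a => g (f a) := by
  obtain ⟨e₁, τ₁, h₁⟩ := hg
  obtain ⟨e₂, τ₂, h₂⟩ := hf
  exact ⟨_, _, h₁.comp h₂⟩

theorem pair {f : α → β} {g : α → γ} (hf : Comp f) (hg : Comp g) : Comp fun a => (f a, g a) := by
  obtain ⟨e₁, τ₁, h₁⟩ := hf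
  obtain ⟨e₂, τ₂, h₂⟩ := hg
  exact ⟨_, _, h₁.pair h₂⟩

theorem ite {c : α → Bool} {f g : α → β} (hc : Comp c) (hf : Comp f) (hg : Comp g) :
    Comp fun a => if c a then f a else g a := by
  obtain ⟨e₁, τ₁, h₁⟩ := hc
  obtain ⟨e₂, τ₂, h₂⟩ := hf
  obtain ⟨e₃, τ₃, h₃⟩ := hg
  exact ⟨_, _, h₁.ite h₂ h₃⟩

theorem foldl {f : α → List β} {g : α → σ} {h : α → σ → β → σ} (hf : Comp f) (hg : Comp g)
    (hh : Comp fun x : α × σ × β => h x.1 x.2.1 x.2.2) :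
    Comp fun a => (f a).foldl (h a) (g a) := by
  obtain ⟨e₁, τ₁, h₁⟩ := hf
  obtain ⟨e₂, τ₂, h₂⟩ := hg
  obtain ⟨e₃, τ₃, h₃⟩ := hh
  obtain ⟨e, he⟩ := computes_foldl h₁ h₂ h₃
  exact ⟨e, _, he⟩

end Comp

/-- `f` is computable with membership queries, `c` being a bound on the number of queries. -/
def QFun (f : (List ℕ → Bool) → α → β) (c : (List ℕ → Bool) → α → ℕ) : Prop :=
  ∃ e : Prog, ∀ (ans : DTree → Bool) (a : α), ∃ t q,
    Runs ans e (enc a) (enc (f (fun w => ans (enc w)) a)) t q ∧ q ≤ c (fun w => ans (enc w)) a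

theorem Comp.toQFun {f : α → β} (hf : Comp f) : QFun (fun _ a => f a) fun _ _ => 0 := by
  obtain ⟨e, τ, h⟩ := hf
  exact ⟨e, fun ans a => (h ans a).imp fun _ h => ⟨0, h.1, le_rfl⟩⟩

/-! ### Closure properties of computations with queries. -/

namespace QFun

theorem mono {f : (List ℕ → Bool) → α → β} {c c₁ : (List ℕ → Bool) → α → ℕ} (hf : QFun f c)
    (h : ∀ o a, c o a ≤ c₁ o a) : QFun f c₁ := by
  obtain ⟨e, he⟩ := hf
  refine ⟨e, fun ans a => ?_⟩
  obtain ⟨t, q, ht, hq⟩ := he ans a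
  exact ⟨t, q, ht, hq.trans (h _ _)⟩

theorem query : QFun (fun o (w : List ℕ) => o w) fun _ _ => 1 :=
  ⟨.query, fun _ _ => ⟨1, 1, Runs.query _, le_rfl⟩⟩

theorem comp {g : (List ℕ → Bool) → β → γ} {f : (List ℕ → Bool) → α → β}
    {c₁ : (List ℕ → Bool) → β → ℕ} {c₂ : (List ℕ → Bool) → α → ℕ} (hg : QFun g c₁)
    (hf : QFun f c₂) : QFun (fun o a => g o (f o a)) fun o a => c₂ o a + c₁ o (f o a) := by
  obtain ⟨e₁, h₁⟩ := hg
  obtain ⟨e₂, h₂⟩ := hf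
  refine ⟨.comp e₁ e₂, fun ans a => ?_⟩
  obtain ⟨t₂, q₂, h₂, hq₂⟩ := h₂ ans a
  obtain ⟨t₁, q₁, h₁, hq₁⟩ := h₁ ans (f (fun w => ans (enc w)) a)
  exact ⟨_, _, Runs.comp h₂ h₁, Nat.add_le_add hq₂ hq₁⟩

theorem pair {f : (List ℕ → Bool) → α → β} {g : (List ℕ → Bool) → α → γ}
    {c₁ c₂ : (List ℕ → Bool) → α → ℕ} (hf : QFun f c₁) (hg : QFun g c₂) :
    QFun (fun o a => (f o a, g o a)) fun o a => c₁ o a + c₂ o a := by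
  obtain ⟨e₁, h₁⟩ := hf
  obtain ⟨e₂, h₂⟩ := hg
  refine ⟨.pair e₁ e₂, fun ans a => ?_⟩
  obtain ⟨t₁, q₁, h₁, hq₁⟩ := h₁ ans a
  obtain ⟨t₂, q₂, h₂, hq₂⟩ := h₂ ans a
  exact ⟨_, _, Runs.pair h₁ h₂, Nat.add_le_add hq₁ hq₂⟩

theorem ite {c : α → Bool} {f g : (List ℕ → Bool) → α → β} {c₁ c₂ : (List ℕ → Bool) → α → ℕ}
    (hc : Comp c) (hf : QFun f c₁) (hg : QFun g c₂) :
    QFun (fun o a => if c a then f o a else g o a) fun o a => if c a then c₁ o a else c₂ o a := by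
  obtain ⟨e, τ, h⟩ := hc
  obtain ⟨e₁, h₁⟩ := hf
  obtain ⟨e₂, h₂⟩ := hg
  refine ⟨.ite e e₁ e₂, fun ans a => ?_⟩
  obtain ⟨t, h, -⟩ := h ans a
  cases hb : c a with
  | true =>
    obtain ⟨t₁, q₁, h₁, hq₁⟩ := h₁ ans a
    rw [hb] at h
    have := Runs.ite_true (g := e₂) h (by simp [enc, DTree.ofBool]) h₁
    exact ⟨_, _, by simpa [hb] using this, by simpa [hb] using hq₁⟩
  | false =>
    obtain ⟨t₂, q₂, h₂, hq₂⟩ := h₂ ans a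
    rw [hb] at h
    have := Runs.ite_false (f := e₁) h h₂
    exact ⟨_, _, by simpa [hb] using this, by simpa [hb] using hq₂⟩

theorem foldl {f : α → List β} {g : α → σ} {h : (List ℕ → Bool) → α → σ → β → σ}
    {c : (List ℕ → Bool) → α → σ → β → ℕ} (hf : Comp f) (hg : Comp g)
    (hh : QFun (fun o (x : α × σ × β) => h o x.1 x.2.1 x.2.2)
      fun o x => c o x.1 x.2.1 x.2.2) :
    QFun (fun o a => (f a).foldl (h o a) (g a))
      fun o a => foldCost (h o a) (c o a) (g a) (f a) := by
  obtain ⟨e₁, τ₁, h₁⟩ := hf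
  obtain ⟨e₂, τ₂, h₂⟩ := hg
  obtain ⟨e₃, h₃⟩ := hh
  refine ⟨.comp (.comp .fst .snd) (.comp (foldLoop e₃) (.pair .id (.pair e₂ e₁))),
    fun ans a => ?_⟩
  obtain ⟨t₁, h₁, -⟩ := h₁ ans a
  obtain ⟨t₂, h₂, -⟩ := h₂ ans a
  -- Times and query counts are chosen after the answers are fixed, so no time bound uniform in the
  -- answers is needed.
  choose τ κ hτ hκ using fun s b => h₃ ans (a, s, b)
  obtain ⟨t, ht, -⟩ := runs_foldProg (τ := τ) h₁ h₂ fun s b => ⟨τ s b, hτ s b, le_rfl⟩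
  exact ⟨t, _, ht, foldCost_mono (fun s b => hκ s b) _ _⟩

end QFun

/-! ### Closure properties of polynomial time. -/

namespace PolyFun

theorem size_bdd {f : α → β} (hf : PolyFun f) : PolyBdd fun a => esize (f a) := hf.2

theorem id : PolyFun fun a : α => a := ⟨⟨_, _, Prog.Computes.id, PolyBdd.const 1⟩, PolyBdd.size⟩

theorem const (b : β) : PolyFun fun _ : α => b := by
  obtain ⟨t, ht⟩ := runs_constProg (enc b)
  exact ⟨⟨constProg (enc b), fun _ => t, fun ans a => ⟨t, ht ans _, le_rfl⟩, PolyBdd.const t⟩,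
    PolyBdd.const (esize b)⟩

theorem comp {g : β → γ} {f : α → β} (hg : PolyFun g) (hf : PolyFun f) :
    PolyFun fun a => g (f a) := by
  obtain ⟨⟨e₁, τ₁, h₁, b₁⟩, s₁⟩ := hg
  obtain ⟨⟨e₂, τ₂, h₂, b₂⟩, s₂⟩ := hf
  exact ⟨⟨_, _, h₁.comp h₂, (b₂.add (b₁.comp s₂)).add (.const 1)⟩, s₁.comp s₂⟩

theorem fst {f : α → β × γ} (hf : PolyFun f) : PolyFun fun a => (f a).1 := by
  obtain ⟨⟨e₁, τ₁, h₁, b₁⟩, s₁⟩ := hf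
  refine ⟨⟨_, _, h₁.fst, b₁.add (.const 2)⟩, s₁.mono fun a => ?_⟩
  have := esize_pair (f a).1 (f a).2
  simp only [Prod.mk.eta] at this
  dsimp only
  omega

theorem snd {f : α → β × γ} (hf : PolyFun f) : PolyFun fun a => (f a).2 := by
  obtain ⟨⟨e₁, τ₁, h₁, b₁⟩, s₁⟩ := hf
  refine ⟨⟨_, _, h₁.snd, b₁.add (.const 2)⟩, s₁.mono fun a => ?_⟩
  have := esize_pair (f a).1 (f a).2
  simp only [Prod.mk.eta] at this
  dsimp only
  omega

theorem pair {f : α → β} {g : α → γ} (hf : PolyFun f) (hg : PolyFun g) :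
    PolyFun fun a => (f a, g a) := by
  obtain ⟨⟨e₁, τ₁, h₁, b₁⟩, s₁⟩ := hf
  obtain ⟨⟨e₂, τ₂, h₂, b₂⟩, s₂⟩ := hg
  exact ⟨⟨_, _, h₁.pair h₂, (b₁.add b₂).add (.const 1)⟩, (s₁.add s₂).add (.const 1)⟩

theorem ite {c : α → Bool} {f g : α → β} (hc : PolyFun c) (hf : PolyFun f) (hg : PolyFun g) :
    PolyFun fun a => if c a then f a else g a := by
  obtain ⟨⟨e₁, τ₁, h₁, b₁⟩, s₁⟩ := hc
  obtain ⟨⟨e₂, τ₂, h₂, b₂⟩, s₂⟩ := hf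
  obtain ⟨⟨e₃, τ₃, h₃, b₃⟩, s₃⟩ := hg
  refine ⟨⟨_, _, h₁.ite h₂ h₃, ((b₁.add b₂).add b₃).add (.const 1)⟩,
    (s₂.add s₃).mono fun a => ?_⟩
  dsimp only
  split <;> omega

/-- Loops whose state grows by a polynomially bounded amount in each step. -/
theorem foldl {f : α → List β} {g : α → σ} {h : α → σ → β → σ} (hf : PolyFun f) (hg : PolyFun g)
    (hh : PolyFun fun x : α × σ × β => h x.1 x.2.1 x.2.2) {B : α → ℕ} (hB : PolyBdd B)
    (hle : ∀ a s b, b ∈ f a → esize (h a s b) ≤ esize s + B a) :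
    PolyFun fun a => (f a).foldl (h a) (g a) := by
  obtain ⟨⟨e₁, τ₁, h₁, b₁⟩, s₁⟩ := hf
  obtain ⟨⟨e₂, τ₂, h₂, b₂⟩, s₂⟩ := hg
  obtain ⟨⟨e₃, τ₃, h₃, P, hP⟩, s₃⟩ := hh
  obtain ⟨e, he⟩ := computes_foldl h₁ h₂ h₃
  -- The growth is additive with a bound that depends only on the parameter, so it does not compound
  -- over the iterations.
  have size_le : ∀ a, ∀ l : List β, (∀ b ∈ l, b ∈ f a) → ∀ s,
      esize (l.foldl (h a) s) ≤ esize s + l.length * B a := by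
    intro a l
    induction l with
    | nil => intro _ s; simp
    | cons b l ih =>
      intro hl s
      have i₁ := ih (fun c hc => hl c (List.mem_cons_of_mem _ hc)) (h a s b)
      have i₂ := hle a s b (hl b List.mem_cons_self)
      simp only [List.foldl_cons, List.length_cons]
      rw [Nat.add_mul]
      omega
  have hS : PolyBdd fun a => esize (g a) + esize (f a) * B a := s₂.add (s₁.mul hB)
  have hle' : ∀ a l₁ l₂, f a = l₁ ++ l₂ →
      esize (l₁.foldl (h a) (g a)) ≤ esize (g a) + esize (f a) * B a := by
    intro a l₁ l₂ hl
    refine (size_le a l₁ (fun b hb => by rw [hl]; exact List.mem_append_left _ hb) _).trans ?_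
    have h₁ : l₁.length ≤ esize (f a) := by
      have := length_lt_esize (f a)
      rw [hl, List.length_append] at this
      rw [hl]
      omega
    exact Nat.add_le_add_left (Nat.mul_le_mul_right _ h₁) _
  refine ⟨⟨e, _, he, ?_⟩, hS.mono fun a => hle' a (f a) [] (by simp)⟩
  -- This bounds the size of the input of the loop body, the triple of parameter, state and list
  -- element, in every iteration.
  have hN : PolyBdd fun a => esize a + ((esize (g a) + esize (f a) * B a) + esize (f a) + 1) + 1 :=
    (PolyBdd.size.add ((hS.add s₁).add (.const 1))).add (.const 1)
  obtain ⟨R, hR⟩ := hN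
  have hK : PolyBdd fun a : α => (P.comp R).eval (esize a) := ⟨P.comp R, fun a => le_rfl⟩
  refine ((b₁.add b₂).add ((s₁.mul (hK.add (.const 24))).add (.const 4))).add (.const 10)
    |>.mono fun a => ?_
  refine Nat.add_le_add_right (Nat.add_le_add_left ((foldTime_le (K := (P.comp R).eval (esize a))
    _ _ fun l₁ b l₂ hl => ?_).trans ?_) _) _
  · refine (hP _).trans ?_
    rw [Polynomial.eval_comp]
    refine polynomial_eval_mono P (le_trans ?_ (hR a))
    rw [esize_pair, esize_pair]
    have h₁ := hle' a l₁ _ hl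
    have h₂ : esize b < esize (f a) := esize_le_of_mem (by rw [hl]; simp)
    dsimp only
    omega
  · exact Nat.add_le_add_right (Nat.mul_le_mul_right _ (length_lt_esize _).le) _

/-! ### Booleans and numbers -/

theorem not {c : α → Bool} (hc : PolyFun c) : PolyFun fun a => !c a := by
  have h : PolyFun fun a => if c a then false else true := ite hc (const _) (const _)
  refine (funext fun a => ?_ : (fun a => !c a) = _) ▸ h
  cases c a <;> rfl

theorem and {c d : α → Bool} (hc : PolyFun c) (hd : PolyFun d) : PolyFun fun a => c a && d a := by
  have h : PolyFun fun a => if c a then d a else false := ite hc hd (const _)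
  refine (funext fun a => ?_ : (fun a => c a && d a) = _) ▸ h
  cases c a <;> rfl

theorem or {c d : α → Bool} (hc : PolyFun c) (hd : PolyFun d) : PolyFun fun a => c a || d a := by
  have h : PolyFun fun a => if c a then true else d a := ite hc (const _) hd
  refine (funext fun a => ?_ : (fun a => c a || d a) = _) ▸ h
  cases c a <;> rfl

/-- Functions that are computed by the same program on other encodings. -/
theorem of_enc_eq {α' β' : Type} [TreeEnc α'] [TreeEnc β'] {f : α → β} (hf : PolyFun f)
    {f' : α' → β'} (i : α' → α) (hi : ∀ a, enc (i a) = enc a)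
    (h : ∀ a, enc (f (i a)) = enc (f' a)) : PolyFun f' := by
  obtain ⟨⟨e, τ, he, P, hP⟩, R, hR⟩ := hf
  refine ⟨⟨e, fun a => τ (i a), fun ans a => ?_, P, fun a => ?_⟩, R, fun a => ?_⟩
  · have := he ans (i a)
    rwa [hi, h] at this
  · have := hP (i a)
    rwa [show esize (i a) = esize a from congrArg DTree.size (hi a)] at this
  · have := hR (i a)
    dsimp only at this ⊢
    rwa [show esize (i a) = esize a from congrArg DTree.size (hi a),
      show esize (f (i a)) = esize (f' a) from congrArg DTree.size (h a)] at this

theorem cons {f : α → β} {g : α → List β} (hf : PolyFun f) (hg : PolyFun g) :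
    PolyFun fun a => f a :: g a :=
  of_enc_eq (hf.pair hg) (fun a => a) (fun _ => rfl) fun _ => rfl

theorem encode {f : α → β} (hf : PolyFun f) : PolyFun fun a => enc (f a) :=
  of_enc_eq hf (fun a => a) (fun _ => rfl) fun _ => rfl

theorem tail {f : α → List β} (hf : PolyFun f) : PolyFun fun a => (f a).tail := by
  have h : PolyFun fun x : List β => x.tail := by
    refine ⟨⟨.snd, fun _ => 1, fun ans l => ⟨1, ?_, le_rfl⟩, .const 1⟩, PolyBdd.size.mono ?_⟩
    · convert! Runs.snd (ans := ans) (enc l) using 1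
      cases l <;> rfl
    · intro l
      cases l
      · exact le_rfl
      · rw [esize_cons]; dsimp only [List.tail]; omega
  exact h.comp hf

theorem isEmpty {f : α → List β} (hf : PolyFun f) : PolyFun fun a => (f a).isEmpty := by
  have h : PolyFun fun x : List β => x.isEmpty := by
    refine ⟨⟨.ite .id .nil (constProg (enc true)), fun _ => 5, fun ans l => ?_, .const 5⟩,
      (PolyBdd.const 3).mono fun l => esize_bool_le _⟩
    cases l with
    | nil => exact ⟨_, Runs.ite_false (Runs.id _) (Runs.pair (Runs.nil _) (Runs.nil _)), le_rfl⟩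
    | cons b l =>
      exact ⟨_, Runs.ite_true (Runs.id _) (by simp [enc_cons]) (Runs.nil _), by norm_num⟩
  exact h.comp hf

theorem headD {f : α → List β} {g : α → β} (hf : PolyFun f) (hg : PolyFun g) :
    PolyFun fun a => (f a).headD (g a) := by
  have h : PolyFun fun x : List β × β => x.1.headD x.2 := by
    refine ⟨⟨.ite .fst (.comp .fst .fst) .snd, fun _ => 5, fun ans x => ?_, .const 5⟩,
      PolyBdd.size.mono fun x => ?_⟩
    · obtain ⟨l, b⟩ := x
      cases l with
      | nil => exact ⟨_, Runs.ite_false (Runs.fst _) (Runs.snd _), by norm_num⟩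
      | cons c l =>
        exact ⟨_, Runs.ite_true (Runs.fst _) (by simp [enc_pair, enc_cons, DTree.fst])
          (Runs.comp (Runs.fst _) (Runs.fst _)), by norm_num⟩
    · obtain ⟨l, b⟩ := x
      cases l <;> simp [esize_pair, esize_cons] <;> omega
  exact h.comp (hf.pair hg)

theorem succ {f : α → ℕ} (hf : PolyFun f) : PolyFun fun a => f a + 1 :=
  of_enc_eq ((const ()).pair hf) (fun a => a) (fun _ => rfl) fun _ => rfl

theorem enc_replicate (n : ℕ) : enc (List.replicate n ()) = enc n := by
  induction n with
  | zero => rfl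
  | succ n ih => rw [List.replicate_succ, enc_cons, ih]; rfl

/-- Unary numbers and lists of units have the same encoding. Loops over lists thereby become loops
over numbers, at no cost. -/
theorem replicate_unit {f : α → ℕ} (hf : PolyFun f) :
    PolyFun fun a => List.replicate (f a) () :=
  of_enc_eq hf (fun a => a) (fun _ => rfl) fun _ => (enc_replicate _).symm

theorem pred {f : α → ℕ} (hf : PolyFun f) : PolyFun fun a => f a - 1 := by
  refine of_enc_eq (tail (replicate_unit hf)) (fun a => a) (fun _ => rfl) fun a => ?_
  rw [List.tail_replicate, enc_replicate]

theorem isZero {f : α → ℕ} (hf : PolyFun f) : PolyFun fun a => decide (f a = 0) := by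
  refine of_enc_eq (isEmpty (replicate_unit hf)) (fun a => a) (fun _ => rfl) fun a => ?_
  cases f a <;> rfl

theorem foldl_replicate_pred (m n : ℕ) :
    (List.replicate n ()).foldl (fun s _ => s - 1) m = m - n := by
  induction n generalizing m with
  | zero => rfl
  | succ n ih => rw [List.replicate_succ, List.foldl_cons, ih]; omega

theorem esize_le_esize_of_le {m n : ℕ} (h : m ≤ n) : esize m ≤ esize n := by
  induction h with
  | refl => exact le_rfl
  | step _ ih => rw [Nat.succ_eq_add_one, esize_succ]; omega

theorem sub {f g : α → ℕ} (hf : PolyFun f) (hg : PolyFun g) : PolyFun fun a => f a - g a := by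
  have h := foldl (h := fun _ s _ => s - 1) (replicate_unit hg) hf (pred (fst (snd id)))
    (PolyBdd.const 0) fun a s b _ => esize_le_esize_of_le (Nat.sub_le s 1)
  simpa only [foldl_replicate_pred] using h

theorem natLe {f g : α → ℕ} (hf : PolyFun f) (hg : PolyFun g) :
    PolyFun fun a => decide (f a ≤ g a) := by
  simpa only [Nat.sub_eq_zero_iff_le] using isZero (sub hf hg)

theorem natEq {f g : α → ℕ} (hf : PolyFun f) (hg : PolyFun g) :
    PolyFun fun a => decide (f a = g a) := by
  have h := and (natLe hf hg) (natLe hg hf)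
  refine (funext fun a => ?_ : (fun a => decide (f a = g a)) = _) ▸ h
  rw [← Bool.decide_and, decide_eq_decide]
  omega

theorem boolEq {f g : α → Bool} (hf : PolyFun f) (hg : PolyFun g) :
    PolyFun fun a => f a == g a := by
  refine (funext fun a => ?_ : (fun a => f a == g a) = _) ▸ ite hf hg (not hg)
  cases f a <;> cases g a <;> rfl

/-! ### Lists -/

theorem foldl_cons_eq {β : Type} (l s : List β) : l.foldl (fun s b => b :: s) s = l.reverse ++ s := by
  induction l generalizing s with
  | nil => rfl
  | cons b l ih => simp [ih]

theorem reverseAppend {f g : α → List β} (hf : PolyFun f) (hg : PolyFun g) :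
    PolyFun fun a => (f a).reverse ++ g a := by
  have h := foldl (h := fun _ s b => b :: s) hf hg (cons (snd (snd id)) (fst (snd id)))
    (hf.size_bdd.add (.const 1)) fun a s b hb => by
      have := esize_le_of_mem hb
      rw [esize_cons]; omega
  simpa only [foldl_cons_eq] using h

theorem reverse {f : α → List β} (hf : PolyFun f) : PolyFun fun a => (f a).reverse := by
  simpa using reverseAppend hf (const [])

theorem append {f g : α → List β} (hf : PolyFun f) (hg : PolyFun g) :
    PolyFun fun a => f a ++ g a := by
  simpa using reverseAppend (reverse hf) hg

theorem foldl_append_eq {β γ : Type} (k : β → List γ) (l : List β) (s : List γ) :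
    l.foldl (fun s b => (k b).reverse ++ s) s = (l.flatMap k).reverse ++ s := by
  induction l generalizing s with
  | nil => rfl
  | cons b l ih => simp [ih]

theorem flatMap {f : α → List β} {k : α → β → List γ} (hf : PolyFun f)
    (hk : PolyFun fun x : α × β => k x.1 x.2) : PolyFun fun a => (f a).flatMap (k a) := by
  obtain ⟨P, hP⟩ := hk.size_bdd
  obtain ⟨R, hR⟩ : PolyBdd fun a => esize a + esize (f a) + 1 :=
    (PolyBdd.size.add hf.size_bdd).add (.const 1)
  have h := foldl (h := fun a s b => (k a b).reverse ++ s) hf (const [])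
    (reverseAppend (hk.comp (pair (fst id) (snd (snd id)))) (fst (snd id)))
    (B := fun a => (P.comp R).eval (esize a)) ⟨P.comp R, fun a => le_rfl⟩ fun a s b hb => by
      have h₁ := esize_le_of_mem hb
      have h₂ := hP (a, b)
      have h₃ : P.eval (esize (a, b)) ≤ (P.comp R).eval (esize a) := by
        rw [Polynomial.eval_comp]
        refine polynomial_eval_mono P (le_trans ?_ (hR a))
        rw [esize_pair]
        dsimp only
        omega
      have h₄ := esize_append (k a b).reverse s
      have h₅ : esize (k a b).reverse = esize (k a b) := by
        generalize k a b = l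
        induction l with
        | nil => rfl
        | cons c l ih =>
          have := esize_append l.reverse [c]
          rw [List.reverse_cons]
          simp only [esize_cons, esize_nil] at this ⊢
          omega
      dsimp only at h₂ ⊢
      omega
  simpa only [foldl_append_eq, List.append_nil, List.reverse_reverse] using reverse h

theorem map {f : α → List β} {k : α → β → γ} (hf : PolyFun f)
    (hk : PolyFun fun x : α × β => k x.1 x.2) : PolyFun fun a => (f a).map (k a) := by
  have h := flatMap (k := fun a b => [k a b]) hf (cons hk (const []))
  refine (funext fun a => ?_ : (fun a => (f a).map (k a)) = _) ▸ h
  induction f a with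
  | nil => rfl
  | cons b l ih => simp [ih]

theorem filter {f : α → List β} {k : α → β → Bool} (hf : PolyFun f)
    (hk : PolyFun fun x : α × β => k x.1 x.2) : PolyFun fun a => (f a).filter (k a) := by
  have h := flatMap (k := fun a b => if k a b then [b] else []) hf
    (ite hk (cons (snd id) (const [])) (const []))
  refine (funext fun a => ?_ : (fun a => (f a).filter (k a)) = _) ▸ h
  induction f a with
  | nil => rfl
  | cons b l ih => rw [List.filter_cons, List.flatMap_cons, ih]; split <;> simp

theorem any {f : α → List β} {k : α → β → Bool} (hf : PolyFun f)
    (hk : PolyFun fun x : α × β => k x.1 x.2) : PolyFun fun a => (f a).any (k a) := by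
  refine (funext fun a => ?_ : (fun a => (f a).any (k a)) = _) ▸ not (isEmpty (filter hf hk))
  induction f a with
  | nil => rfl
  | cons b l ih => rw [List.filter_cons, List.any_cons, ih]; split <;> simp_all

theorem all {f : α → List β} {k : α → β → Bool} (hf : PolyFun f)
    (hk : PolyFun fun x : α × β => k x.1 x.2) : PolyFun fun a => (f a).all (k a) := by
  refine (funext fun a => ?_ : (fun a => (f a).all (k a)) = _) ▸ not (any (k := fun a b => !k a b) hf (not hk))
  rw [List.all_eq_not_any_not]

theorem length {f : α → List β} (hf : PolyFun f) : PolyFun fun a => (f a).length := by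
  refine of_enc_eq (map (k := fun _ _ => ()) hf (const ())) (fun a => a) (fun _ => rfl) fun a => ?_
  rw [List.map_const', enc_replicate]

theorem range {f : α → ℕ} (hf : PolyFun f) : PolyFun fun a => List.range (f a) := by
  have h₁ : PolyFun fun a => (List.replicate (f a) ()).map fun _ => f a :=
    map (replicate_unit hf) (hf.comp (fst id))
  -- The guard `s.length ≤ x.1` always holds in the actual run. It is there because the growth
  -- condition of `foldl` speaks of all states.
  have h₂ : PolyFun fun x : ℕ × List ℕ => (List.replicate x.1 ()).foldl
      (fun s _ => if s.length ≤ x.1 then s.length :: s else s) ([] : List ℕ) := by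
    have hif := ite (natLe (length (fst (snd id))) (fst (fst id)))
      (cons (length (fst (snd id))) (fst (snd id))) (fst (snd id))
      (α := (ℕ × List ℕ) × List ℕ × Unit)
    simp only [decide_eq_true_eq] at hif
    refine foldl (h := fun x s _ => if s.length ≤ x.1 then s.length :: s else s)
      (replicate_unit (fst id)) (const []) hif (PolyBdd.size.add (.const 1)) fun a s b _ => ?_
    split_ifs with hs
    · have := esize_le_esize_of_le hs
      rw [esize_cons]
      have h := esize_pair a.1 a.2
      simp only [Prod.mk.eta] at h
      omega
    · omega
  have h₃ := reverse (h₂.comp (pair hf (const ([] : List ℕ))))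
  refine (funext fun a => ?_ : (fun a => List.range (f a)) = _) ▸ h₃
  have : ∀ n m, n ≤ m → (List.replicate n ()).foldl
      (fun s _ => if s.length ≤ m then s.length :: s else s) ([] : List ℕ)
      = (List.range n).reverse := by
    intro n m hnm
    induction n with
    | zero => rfl
    | succ n ih =>
      rw [List.replicate_succ', List.foldl_append, ih (by omega), List.range_succ]
      simpa using by omega
  rw [this _ _ le_rfl, List.reverse_reverse]

theorem iterate_tail {β : Type} (n : ℕ) (l : List β) :
    (List.replicate n ()).foldl (fun s _ => s.tail) l = l.drop n := by
  induction n generalizing l with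
  | zero => rfl
  | succ n ih => rw [List.replicate_succ, List.foldl_cons, ih]; cases l <;> simp

theorem drop {f : α → List β} {g : α → ℕ} (hf : PolyFun f) (hg : PolyFun g) :
    PolyFun fun a => (f a).drop (g a) := by
  have h := foldl (h := fun _ s _ => s.tail) (replicate_unit hg) hf (tail (fst (snd id)))
    (PolyBdd.const 0) fun a s b _ => by
      cases s
      · exact le_rfl
      · rw [esize_cons]; dsimp only [List.tail]; omega
  simpa only [iterate_tail] using h

theorem take {f : α → List β} {g : α → ℕ} (hf : PolyFun f) (hg : PolyFun g) :
    PolyFun fun a => (f a).take (g a) := by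
  have h := reverse (drop (reverse hf) (sub (length hf) hg))
  refine (funext fun a => ?_ : (fun a => (f a).take (g a)) = _) ▸ h
  rw [List.drop_reverse, List.reverse_reverse]
  rcases le_total (g a) (f a).length with h | h
  · congr 1; omega
  · rw [List.take_of_length_le h, List.take_of_length_le (by omega)]

theorem getD {f : α → List β} {g : α → ℕ} {d : α → β} (hf : PolyFun f) (hg : PolyFun g)
    (hd : PolyFun d) : PolyFun fun a => (f a).getD (g a) (d a) := by
  have h := headD (drop hf hg) hd
  refine (funext fun a => ?_ : (fun a => (f a).getD (g a) (d a)) = _) ▸ h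
  rw [List.headD_eq_head?_getD, List.head?_drop, List.getD_eq_getElem?_getD]

theorem half {f : α → ℕ} (hf : PolyFun f) : PolyFun fun a => f a / 2 := by
  have key : ∀ n, (List.replicate n ()).foldl
      (fun (s : ℕ × Bool) _ => if s.2 then (s.1 + 1, false) else (s.1, true)) (0, false)
      = (n / 2, decide (n % 2 = 1)) := by
    intro n
    induction n with
    | zero => rfl
    | succ n ih =>
      rw [List.replicate_succ', List.foldl_append, ih]
      rcases Nat.mod_two_eq_zero_or_one n with h | h
      · simp [h]; omega
      · simp [h]; omega
  have h := fst (foldl (h := fun _ (s : ℕ × Bool) _ => if s.2 then (s.1 + 1, false) else (s.1, true))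
    (replicate_unit hf) (const (0, false))
    (ite (snd (fst (snd id))) (pair (succ (fst (fst (snd id)))) (const _))
      (pair (fst (fst (snd id))) (const _))) (PolyBdd.const 4) fun a s b _ => by
        obtain ⟨n, c⟩ := s
        have h₁ : esize false = 1 := rfl
        have h₂ : esize true = 3 := rfl
        cases c
        · simp [esize_pair, h₁, h₂]
        · simp [esize_pair, esize_succ, h₁, h₂])
  simpa only [key] using h

end PolyFun

end Library

/-! ## Strategies in negotiation diagrams -/

namespace Diagram

variable {Γ : DistAlphabet} {M : Diagram Γ}

/-- The configuration after `a` was executed at the node `u`. -/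
def move (M : Diagram Γ) (C : M.Config) (u : Fin M.nodes) (a : Γ.Act) : M.Config :=
  fun p => (M.δ u a p).getD (C p)

namespace IsNegotiation

theorem dnode_eq_of_mem_out (hM : M.IsNegotiation) {u : Fin M.nodes} {a : Γ.Act}
    (h : a ∈ M.out u) : M.dnode u = Γ.dom a := by
  obtain ⟨p, hp⟩ := h
  obtain ⟨v, hv⟩ := Option.isSome_iff_exists.1 hp
  exact (hM.dom_match _ _ _ _ hv).1

theorem exists_of_mem_out (hM : M.IsNegotiation) {u : Fin M.nodes} {a : Γ.Act}
    (h : a ∈ M.out u) {p : Γ.Proc} (hp : p ∈ M.dnode u) : ∃ v, M.δ u a p = some v := by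
  have he := hM.dnode_eq_of_mem_out h
  obtain ⟨q, hq⟩ := h
  obtain ⟨v, hv⟩ := Option.isSome_iff_exists.1 hq
  exact Option.isSome_iff_exists.1 ((hM.dom_match _ _ _ _ hv).2.2.2 p (he ▸ hp))

theorem mem_out {u v : Fin M.nodes} {a : Γ.Act} {p : Γ.Proc}
    (h : M.δ u a p = some v) : a ∈ M.out u := ⟨p, by rw [h]; rfl⟩

theorem mem_dnode (hM : M.IsNegotiation) {u v : Fin M.nodes} {a : Γ.Act} {p : Γ.Proc}
    (h : M.δ u a p = some v) : p ∈ M.dnode u ∧ p ∈ M.dnode v := by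
  obtain ⟨h₁, h₂, h₃, -⟩ := hM.dom_match _ _ _ _ h
  exact ⟨h₁ ▸ h₂, h₃⟩

theorem delta_eq_none (hM : M.IsNegotiation) {u : Fin M.nodes} {a : Γ.Act} {p : Γ.Proc}
    (h : p ∉ M.dnode u) : M.δ u a p = none := by
  cases hv : M.δ u a p with
  | none => rfl
  | some v => exact absurd (hM.mem_dnode hv).1 h

theorem out_final' (hM : M.IsNegotiation) {a : Γ.Act} : a ∉ M.out M.final := by
  rw [hM.out_final]; exact Set.notMem_empty _

end IsNegotiation

theorem move_of_some {C : M.Config} {u v : Fin M.nodes} {a : Γ.Act} {p : Γ.Proc}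
    (h : M.δ u a p = some v) : M.move C u a p = v := by simp [move, h]

theorem move_of_notMem (hM : M.IsNegotiation) {C : M.Config} {u : Fin M.nodes} {a : Γ.Act}
    {p : Γ.Proc} (h : p ∉ M.dnode u) : M.move C u a p = C p := by
  simp [move, hM.delta_eq_none h]

theorem step_iff (hM : M.IsNegotiation) {C C₁ : M.Config} {a : Γ.Act} :
    M.Step C a C₁ ↔ ∃ u, M.Enabled C u ∧ a ∈ M.out u ∧ C₁ = M.move C u a := by
  constructor
  · rintro ⟨u, hu, ha, h₁, h₂⟩
    refine ⟨u, hu, ha, funext fun p => ?_⟩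
    by_cases hp : p ∈ Γ.dom a
    · rw [move_of_some (h₁ p hp)]
    · rw [move_of_notMem hM (by rwa [hM.dnode_eq_of_mem_out ha]), h₂ p hp]
  · rintro ⟨u, hu, ha, rfl⟩
    refine ⟨u, hu, ha, fun p hp => ?_, fun p hp => ?_⟩
    · obtain ⟨v, hv⟩ := hM.exists_of_mem_out ha (by rwa [hM.dnode_eq_of_mem_out ha])
      rw [move_of_some hv, hv]
    · rw [move_of_notMem hM (by rwa [hM.dnode_eq_of_mem_out ha])]

theorem disjoint_of_enabled {C : M.Config} {u v : Fin M.nodes} (hu : M.Enabled C u)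
    (hv : M.Enabled C v) (h : u ≠ v) : Disjoint (M.dnode u) (M.dnode v) :=
  Finset.disjoint_left.2 fun p hp hq => h ((hu p hp).symm.trans (hv p hq))

theorem Enabled.move (hM : M.IsNegotiation) {C : M.Config} {u v : Fin M.nodes} {a : Γ.Act}
    (hu : M.Enabled C u) (hv : M.Enabled C v) (h : u ≠ v) : M.Enabled (M.move C u a) v :=
  fun p hp => by
    rw [move_of_notMem hM (Finset.disjoint_right.1 (disjoint_of_enabled hu hv h) hp), hv p hp]

theorem move_comm (hM : M.IsNegotiation) {C : M.Config} {u v : Fin M.nodes} {a b : Γ.Act}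
    (h : Disjoint (M.dnode u) (M.dnode v)) :
    M.move (M.move C u a) v b = M.move (M.move C v b) u a := by
  funext p
  by_cases hu : p ∈ M.dnode u
  · have hv := Finset.disjoint_left.1 h hu
    simp [Diagram.move, hM.delta_eq_none hv]
  · simp [Diagram.move, hM.delta_eq_none hu]

theorem Exec.append {C C₁ C₂ : M.Config} {w w₁ : Γ.Word} (h : M.Exec C w C₁)
    (h₁ : M.Exec C₁ w₁ C₂) : M.Exec C (w ++ w₁) C₂ := by
  induction h with
  | nil => exact h₁
  | cons hs _ ih => exact .cons hs (ih h₁)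

/-- Reachable configurations. -/
def Reachable (M : Diagram Γ) (C : M.Config) : Prop := ∃ w, M.Exec M.initConfig w C

theorem Reachable.exec {C C₁ : M.Config} {w : Γ.Word} (h : M.Reachable C)
    (h₁ : M.Exec C w C₁) : M.Reachable C₁ := by
  obtain ⟨w₀, h₀⟩ := h
  exact ⟨_, h₀.append h₁⟩

theorem Reachable.move (hM : M.IsNegotiation) {C : M.Config} {u : Fin M.nodes} {a : Γ.Act}
    (h : M.Reachable C) (hu : M.Enabled C u) (ha : a ∈ M.out u) : M.Reachable (M.move C u a) :=
  h.exec (.cons ((step_iff hM).2 ⟨u, hu, ha, rfl⟩) (.nil _))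

theorem Reachable.init : M.Reachable M.initConfig := ⟨[], .nil _⟩

theorem Sound.exists_exec (hS : M.Sound) {C : M.Config} (h : M.Reachable C) :
    ∃ v, M.Exec C v M.finalConfig := by
  obtain ⟨w, hw⟩ := h
  exact hS w C hw

/-- Some process can go from `u` to `v`. -/
def Edge (M : Diagram Γ) (u v : Fin M.nodes) : Prop := ∃ a p, M.δ u a p = some v

/-- Local reachability. -/
def LReach (M : Diagram Γ) : Fin M.nodes → Fin M.nodes → Prop := Relation.ReflTransGen M.Edge

theorem Enabled.eq_final (hM : M.IsNegotiation) {u : Fin M.nodes}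
    (h : M.Enabled M.finalConfig u) : u = M.final := by
  obtain ⟨p, hp⟩ := hM.dnode_nonempty u
  exact (h p hp).symm

theorem lReach_of_exec (hM : M.IsNegotiation) {C C₁ : M.Config} {w : Γ.Word}
    (h : M.Exec C w C₁) (p : Γ.Proc) : M.LReach (C p) (C₁ p) := by
  induction h with
  | nil => exact .refl
  | cons hs _ ih =>
    obtain ⟨u, hu, ha, rfl⟩ := (step_iff hM).1 hs
    by_cases hp : p ∈ M.dnode u
    · obtain ⟨v, hv⟩ := hM.exists_of_mem_out ha hp
      rw [move_of_some hv] at ih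
      rw [hu p hp]
      exact .head ⟨_, _, hv⟩ ih
    · rwa [move_of_notMem hM hp] at ih

theorem Reachable.lReach (hM : M.IsNegotiation) {C : M.Config} (h : M.Reachable C)
    (p : Γ.Proc) : M.LReach M.init (C p) := by
  obtain ⟨w, hw⟩ := h
  exact lReach_of_exec hM hw p

/-- Just before the first move of `p`, its node is enabled; if `p` never moves, it is at the final
node, which is enabled at the end. -/
theorem exists_enabled_of_exec (hM : M.IsNegotiation) {C C₁ : M.Config} {w : Γ.Word}
    (h : M.Exec C w C₁) (hf : C₁ = M.finalConfig) (p : Γ.Proc) :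
    ∃ w₁ C₂, M.Exec C w₁ C₂ ∧ M.Enabled C₂ (C p) := by
  induction h with
  | nil => exact ⟨[], _, .nil _, fun q _ => by rw [hf]; rfl⟩
  | @cons C _ _ _ _ hs _ ih =>
    obtain ⟨u, hu, ha, rfl⟩ := (step_iff hM).1 hs
    by_cases hp : p ∈ M.dnode u
    · exact ⟨[], _, .nil _, by rw [hu p hp]; exact hu⟩
    · obtain ⟨w₁, C₂, h₁, h₂⟩ := ih hf
      rw [move_of_notMem hM hp] at h₂
      exact ⟨_, C₂, .cons hs h₁, h₂⟩

/-- Along a local path: execute the edge, extend to a successful execution, and stop when the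
process is about to leave its new node. So in a sound negotiation local reachability implies being
enabled somewhere. -/
theorem Sound.exists_enabled (hM : M.IsNegotiation) (hS : M.Sound) {n : Fin M.nodes}
    (h : M.LReach M.init n) : ∃ C, M.Reachable C ∧ M.Enabled C n := by
  induction h with
  | refl => exact ⟨M.initConfig, .init, fun _ _ => rfl⟩
  | tail _ he ih =>
    obtain ⟨a, p, hv⟩ := he
    obtain ⟨C, hC, hu⟩ := ih
    have hr := hC.move hM hu (IsNegotiation.mem_out hv)
    obtain ⟨w, hw⟩ := hS.exists_exec hr
    obtain ⟨w₁, C₂, h₁, h₂⟩ := exists_enabled_of_exec hM hw rfl p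
    rw [move_of_some hv] at h₂
    exact ⟨C₂, hr.exec h₁, h₂⟩

theorem Sound.lReach_final (hM : M.IsNegotiation) (hS : M.Sound) {n : Fin M.nodes}
    (h : M.LReach M.init n) : M.LReach n M.final := by
  obtain ⟨C, hC, hn⟩ := hS.exists_enabled hM h
  obtain ⟨w, hw⟩ := hS.exists_exec hC
  obtain ⟨p, hp⟩ := hM.dnode_nonempty n
  have := lReach_of_exec hM hw p
  rwa [hn p hp] at this

/-! ### Strategies -/

/-- `σ` chooses an action for some nodes, so that some process gets closer to the final node. -/
structure IsStrategy (M : Diagram Γ) (σ : Fin M.nodes → Option Γ.Act) (rank : Fin M.nodes → ℕ) :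
    Prop where
  mem_out : ∀ u a, σ u = some a → a ∈ M.out u
  desc : ∀ u a, σ u = some a → ∃ p v, M.δ u a p = some v ∧ rank v < rank u

/-- Runs that follow the strategy; the list contains the executed nodes. -/
inductive SRun (M : Diagram Γ) (σ : Fin M.nodes → Option Γ.Act) :
    M.Config → List (Fin M.nodes) → M.Config → Prop
  | nil (C : M.Config) : SRun M σ C [] C
  | cons {C C₁ : M.Config} {u : Fin M.nodes} {a : Γ.Act} {l : List (Fin M.nodes)} :
      M.Enabled C u → σ u = some a → SRun M σ (M.move C u a) l C₁ → SRun M σ C (u :: l) C₁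

/-- The strategy leads to the final configuration. -/
def Good (M : Diagram Γ) (σ : Fin M.nodes → Option Γ.Act) (C : M.Config) : Prop :=
  ∃ l, M.SRun σ C l M.finalConfig

section Strategy

variable {σ : Fin M.nodes → Option Γ.Act} {rank : Fin M.nodes → ℕ}

theorem SRun.append {C C₁ C₂ : M.Config} {l l₁ : List (Fin M.nodes)} (h : M.SRun σ C l C₁)
    (h₁ : M.SRun σ C₁ l₁ C₂) : M.SRun σ C (l ++ l₁) C₂ := by
  induction h with
  | nil => exact h₁
  | cons hu ha _ ih => exact .cons hu ha (ih h₁)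

theorem IsStrategy.final (hM : M.IsNegotiation) (hσ : M.IsStrategy σ rank) :
    σ M.final = none := by
  cases h : σ M.final with
  | none => rfl
  | some a => exact absurd (hσ.mem_out _ _ h) hM.out_final'

theorem SRun.reachable (hM : M.IsNegotiation) (hσ : M.IsStrategy σ rank) {C C₁ : M.Config}
    {l : List (Fin M.nodes)} (h : M.SRun σ C l C₁) (hC : M.Reachable C) : M.Reachable C₁ := by
  induction h with
  | nil => exact hC
  | cons hu ha _ ih => exact ih (hC.move hM hu (hσ.mem_out _ _ ha))

theorem SRun.isSome_of_mem {C C₁ : M.Config} {l : List (Fin M.nodes)} (h : M.SRun σ C l C₁)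
    {u : Fin M.nodes} (hu : u ∈ l) : (σ u).isSome := by
  induction h with
  | nil => simp at hu
  | cons _ ha _ ih =>
    rcases List.mem_cons.1 hu with rfl | hu
    · rw [ha]; rfl
    · exact ih hu

/-- Enabled nodes can be executed first. -/
theorem SRun.diamond (hM : M.IsNegotiation) (hσ : M.IsStrategy σ rank) {C C₁ : M.Config}
    {l : List (Fin M.nodes)} (h : M.SRun σ C l C₁) (hf : C₁ = M.finalConfig) {u : Fin M.nodes}
    {a : Γ.Act} (hu : M.Enabled C u) (ha : σ u = some a) :
    ∃ l₁, M.SRun σ (M.move C u a) l₁ C₁ ∧ l.length = l₁.length + 1 := by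
  induction h with
  | nil =>
    rw [hf] at hu
    rw [hu.eq_final hM, hσ.final hM] at ha
    cases ha
  | @cons C C₁ v b l hv hb hr ih =>
    by_cases huv : u = v
    · subst huv
      rw [ha] at hb
      cases hb
      exact ⟨l, hr, rfl⟩
    · obtain ⟨l₁, h₁, h₂⟩ := ih hf (hv.move hM hu (Ne.symm huv))
      rw [move_comm hM (disjoint_of_enabled hv hu (Ne.symm huv))] at h₁
      exact ⟨v :: l₁, .cons (hu.move hM hv huv) hb h₁, by simp [h₂]⟩

theorem Good.srun (hM : M.IsNegotiation) (hσ : M.IsStrategy σ rank) {C C₁ : M.Config}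
    {l : List (Fin M.nodes)} (h : M.SRun σ C l C₁) (hC : M.Good σ C) : M.Good σ C₁ := by
  induction h with
  | nil => exact hC
  | cons hu ha _ ih =>
    obtain ⟨l, hl⟩ := hC
    obtain ⟨l₁, h₁, -⟩ := hl.diamond hM hσ rfl hu ha
    exact ih ⟨l₁, h₁⟩

theorem SRun.good {C C₁ : M.Config} {l : List (Fin M.nodes)} (h : M.SRun σ C l C₁)
    (hC : M.Good σ C₁) : M.Good σ C := by
  obtain ⟨l₁, h₁⟩ := hC
  exact ⟨_, h.append h₁⟩

/-- As long as `n` is not executed it stays enabled, so the executed nodes share no process with it.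
The action `a` need not be the one of the strategy. -/
theorem SRun.commute (hM : M.IsNegotiation) {C C₁ : M.Config} {l : List (Fin M.nodes)}
    (h : M.SRun σ C l C₁) {n : Fin M.nodes} {a : Γ.Act} (hn : n ∉ l) (he : M.Enabled C n) :
    M.SRun σ (M.move C n a) l (M.move C₁ n a) ∧ M.Enabled C₁ n := by
  induction h with
  | nil => exact ⟨.nil _, he⟩
  | @cons C C₁ v b l hv hb hr ih =>
    rw [List.mem_cons, not_or] at hn
    obtain ⟨h₁, h₂⟩ := ih hn.2 (hv.move hM he (Ne.symm hn.1))
    rw [move_comm hM (disjoint_of_enabled hv he (Ne.symm hn.1))] at h₁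
    exact ⟨.cons (he.move hM hv hn.1) hb h₁, h₂⟩

/-- Executing `u` puts `p` at `v`, and `p` can be back at `u` only after `v` was executed. The first
half, for runs that start with `p` at `v`, is what makes the induction work. -/
theorem SRun.count_le_succ (hM : M.IsNegotiation) {C C₁ : M.Config}
    {l : List (Fin M.nodes)} (h : M.SRun σ C l C₁) {u v : Fin M.nodes} {a : Γ.Act} {p : Γ.Proc}
    (ha : σ u = some a) (hv : M.δ u a p = some v) (huv : u ≠ v) :
    (C p = v → l.count u ≤ l.count v) ∧ l.count u ≤ l.count v + 1 := by
  induction h with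
  | nil => simp
  | @cons C C₁ x b l hx hb hr ih =>
    obtain ⟨hpu, hpv⟩ := hM.mem_dnode hv
    by_cases hxu : x = u
    · subst hxu
      rw [ha] at hb
      cases hb
      rw [move_of_some hv] at ih
      rw [List.count_cons_self, List.count_cons_of_ne huv]
      refine ⟨fun hC => absurd ((hx p hpu).symm.trans hC) huv, ?_⟩
      have := ih.1 rfl
      omega
    · rw [List.count_cons_of_ne hxu]
      by_cases hxv : x = v
      · subst hxv
        rw [List.count_cons_self]
        have := ih.2
        exact ⟨fun _ => this, by omega⟩
      · rw [List.count_cons_of_ne hxv]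
        refine ⟨fun hC => ih.1 ?_, ih.2⟩
        rw [move_of_notMem hM, hC]
        intro hp
        exact hxv ((hx p hp).symm.trans hC)

/-- Induction on the rank: the chosen action leads some process to a node of smaller rank, which is
executed at most once less often. -/
theorem SRun.count_le_rank (hM : M.IsNegotiation) (hσ : M.IsStrategy σ rank) {C C₁ : M.Config}
    {l : List (Fin M.nodes)} (h : M.SRun σ C l C₁) (u : Fin M.nodes) : l.count u ≤ rank u := by
  induction hk : rank u using Nat.strong_induction_on generalizing u with
  | _ k ih =>
    cases ha : σ u with
    | none =>
      rw [List.count_eq_zero_of_not_mem]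
      · exact Nat.zero_le _
      · intro hu
        have := h.isSome_of_mem hu
        rw [ha] at this
        cases this
    | some a =>
      obtain ⟨p, v, hv, hr⟩ := hσ.desc u a ha
      have h₁ := (h.count_le_succ hM ha hv (by rintro rfl; exact lt_irrefl _ hr)).2
      have h₂ := ih (rank v) (hk ▸ hr) v rfl
      omega

theorem SRun.length_le (hM : M.IsNegotiation) (hσ : M.IsStrategy σ rank) {C C₁ : M.Config}
    {l : List (Fin M.nodes)} (h : M.SRun σ C l C₁) : l.length ≤ ∑ u, rank u := by
  rw [← List.sum_toFinset_count_eq_length l]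
  exact (Finset.sum_le_sum fun u _ => h.count_le_rank hM hσ u).trans
    (Finset.sum_le_sum_of_subset (Finset.subset_univ _))

/-- Every run that follows the strategy and avoids some nodes terminates. -/
theorem exists_stuck (hM : M.IsNegotiation) (hσ : M.IsStrategy σ rank) (C : M.Config)
    (B : Set (Fin M.nodes)) : ∃ l C₁, M.SRun σ C l C₁ ∧ (∀ u ∈ l, u ∉ B) ∧
      ∀ u, u ∉ B → (σ u).isSome → ¬ M.Enabled C₁ u := by
  by_contra hcon
  push Not at hcon
  -- Without a stuck configuration there would be runs of every length, against `SRun.length_le`.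
  have : ∀ k, ∃ l C₁, M.SRun σ C l C₁ ∧ (∀ u ∈ l, u ∉ B) ∧ l.length = k := by
    intro k
    induction k with
    | zero => exact ⟨[], C, .nil _, by simp, rfl⟩
    | succ k ih =>
      obtain ⟨l, C₁, h₁, h₂, h₃⟩ := ih
      obtain ⟨u, hu, hs, he⟩ := hcon l C₁ h₁ h₂
      obtain ⟨a, ha⟩ := Option.isSome_iff_exists.1 hs
      refine ⟨l ++ [u], _, h₁.append (.cons he ha (.nil _)), ?_, by simp [h₃]⟩
      intro v hv
      rcases List.mem_append.1 hv with hv | hv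
      · exact h₂ v hv
      · rw [List.mem_singleton.1 hv]; exact hu
  obtain ⟨l, C₁, h₁, -, h₃⟩ := this (∑ u, rank u + 1)
  have := h₁.length_le hM hσ
  omega

/-- Under the strategy, `p` goes from `u` to `v`. -/
def SNext (M : Diagram Γ) (σ : Fin M.nodes → Option Γ.Act) (p : Γ.Proc) (u v : Fin M.nodes) :
    Prop := ∃ a, σ u = some a ∧ M.δ u a p = some v

/-- Local reachability under the strategy. -/
def SReach (M : Diagram Γ) (σ : Fin M.nodes → Option Γ.Act) :
    Fin M.nodes → Fin M.nodes → Prop := Relation.ReflTransGen fun u v => ∃ p, M.SNext σ p u v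

/-- `m` is the first node of `q` among the nodes that the strategy visits from `n`. -/
def IsFirst (M : Diagram Γ) (σ : Fin M.nodes → Option Γ.Act) (n : Fin M.nodes) (q : Γ.Proc)
    (m : Fin M.nodes) : Prop :=
  M.SReach σ n m ∧ q ∈ M.dnode m ∧ (σ m).isSome ∧ ∀ u, M.SReach σ n u → ¬ M.SNext σ q u m

/-- The configuration is determined by the strategy and the node `n`. -/
def IsCanonical (M : Diagram Γ) (σ : Fin M.nodes → Option Γ.Act) (n : Fin M.nodes)
    (C : M.Config) : Prop :=
  ∀ q m, M.IsFirst σ n q m ↔ C q = m ∧ m ≠ M.final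

/-- First nodes fix the processes that are not at the final node; all others are then at the final
node. -/
theorem IsCanonical.unique {n : Fin M.nodes} {C C₁ : M.Config} (h : M.IsCanonical σ n C)
    (h₁ : M.IsCanonical σ n C₁) : C = C₁ := by
  funext q
  by_cases hq : C q = M.final
  · by_contra hne
    have := ((h q (C₁ q)).1 ((h₁ q (C₁ q)).2 ⟨rfl, fun h => hne (hq.trans h.symm)⟩)).1
    exact hne this
  · exact (((h₁ q (C q)).1 ((h q (C q)).2 ⟨rfl, hq⟩)).1).symm

/-- Trace an executed node backwards: if `u₀` is enabled after `x` was executed but not before, then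
`x` moved some process to `u₀`. -/
theorem SRun.exists_enabled_sReach {C C₁ : M.Config} {l : List (Fin M.nodes)}
    (hM : M.IsNegotiation) (hσ : M.IsStrategy σ rank)
    (h : M.SRun σ C l C₁) {u : Fin M.nodes} (hu : u ∈ l) :
    ∃ u₀, M.Enabled C u₀ ∧ (σ u₀).isSome ∧ M.SReach σ u₀ u := by
  induction h with
  | nil => simp at hu
  | @cons C C₁ x b l hx hb hr ih =>
    rcases List.mem_cons.1 hu with rfl | hu
    · exact ⟨u, hx, by rw [hb]; rfl, .refl⟩
    · obtain ⟨u₀, h₁, h₂, h₃⟩ := ih hu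
      by_cases he : M.Enabled C u₀
      · exact ⟨u₀, he, h₂, h₃⟩
      · unfold Enabled at he
        push Not at he
        obtain ⟨p, hp, hne⟩ := he
        have hpx : p ∈ M.dnode x := by
          by_contra hpx
          have := h₁ p hp
          rw [move_of_notMem hM hpx] at this
          exact hne this
        obtain ⟨v, hv⟩ := hM.exists_of_mem_out (hσ.mem_out _ _ hb) hpx
        have hvu := h₁ p hp
        rw [move_of_some hv] at hvu
        subst hvu
        exact ⟨x, hx, by rw [hb]; rfl, .head ⟨p, b, hb, hv⟩ h₃⟩

theorem SRun.mem_of_ne_final (hM : M.IsNegotiation) {C C₁ : M.Config}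
    {l : List (Fin M.nodes)} (h : M.SRun σ C l C₁) (hf : C₁ = M.finalConfig) {p : Γ.Proc}
    (hp : C p ≠ M.final) : C p ∈ l ∧ p ∈ M.dnode (C p) := by
  induction h with
  | nil => rw [hf] at hp; exact absurd rfl hp
  | @cons C C₁ x b l hx hb hr ih =>
    by_cases hpx : p ∈ M.dnode x
    · rw [hx p hpx]; exact ⟨List.mem_cons_self, hpx⟩
    · rw [move_of_notMem hM hpx] at ih
      obtain ⟨h₁, h₂⟩ := ih hf hp
      exact ⟨List.mem_cons_of_mem _ h₁, h₂⟩

theorem SRun.mem_of_sNext (hM : M.IsNegotiation) {C C₁ : M.Config}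
    {l : List (Fin M.nodes)} (h : M.SRun σ C l C₁) (hf : C₁ = M.finalConfig) {p : Γ.Proc}
    {u v : Fin M.nodes} (hu : u ∈ l) (hv : M.SNext σ p u v) : v ∈ l ∨ v = M.final := by
  induction h with
  | nil => simp at hu
  | @cons C C₁ x b l hx hb hr ih =>
    rcases List.mem_cons.1 hu with rfl | hu
    · obtain ⟨a, ha, hv⟩ := hv
      rw [ha] at hb
      cases hb
      by_cases hvf : v = M.final
      · exact .inr hvf
      · have := (hr.mem_of_ne_final hM hf (p := p) (by rwa [move_of_some hv])).1
        rw [move_of_some hv] at this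
        exact .inl (List.mem_cons_of_mem _ this)
    · exact (ih hf hu).imp_left (List.mem_cons_of_mem _)

theorem SRun.reaches (hM : M.IsNegotiation) (hσ : M.IsStrategy σ rank) {C C₁ : M.Config}
    {l : List (Fin M.nodes)} (h : M.SRun σ C l C₁) (p : Γ.Proc) :
    (∀ u ∈ l, p ∈ M.dnode u → Relation.ReflTransGen (M.SNext σ p) (C p) u) ∧
      Relation.ReflTransGen (M.SNext σ p) (C p) (C₁ p) := by
  induction h with
  | nil => exact ⟨by simp, .refl⟩
  | @cons C C₁ x b l hx hb hr ih =>
    have key : Relation.ReflTransGen (M.SNext σ p) (C p) (M.move C x b p) := by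
      by_cases hpx : p ∈ M.dnode x
      · obtain ⟨v, hv⟩ := hM.exists_of_mem_out (hσ.mem_out _ _ hb) hpx
        rw [move_of_some hv, hx p hpx]
        exact .single ⟨b, hb, hv⟩
      · rw [move_of_notMem hM hpx]
    refine ⟨fun u hu hp => ?_, key.trans ih.2⟩
    rcases List.mem_cons.1 hu with rfl | hu
    · rw [hx p hp]
    · exact key.trans (ih.1 u hu hp)

/-- For a deterministic relation, whatever is reached from a point of a cycle lies on the cycle. -/
theorem reflTransGen_symm_of_transGen {α : Type} {r : α → α → Prop}
    (hr : ∀ x y z, r x y → r x z → y = z) {m x : α} (h : Relation.TransGen r m m)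
    (hx : Relation.ReflTransGen r m x) : Relation.ReflTransGen r x m := by
  induction hx with
  | refl => exact .refl
  | tail _ hyz ih =>
    rcases Relation.ReflTransGen.cases_head ih with rfl | ⟨z, h₁, h₂⟩
    · obtain ⟨z, h₁, h₂⟩ := Relation.TransGen.head'_iff.1 h
      rwa [hr _ _ _ hyz h₁]
    · rwa [hr _ _ _ hyz h₁]

/-- The nodes executed on the way to success are exactly the non-final ones that the strategy
reaches from `n`. Under the strategy each process follows a single path, so its current node is the
one on this path without a predecessor among them. -/
theorem SRun.isCanonical (hM : M.IsNegotiation) (hσ : M.IsStrategy σ rank) {C C₁ : M.Config}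
    {l : List (Fin M.nodes)} (h : M.SRun σ C l C₁) (hf : C₁ = M.finalConfig) {n : Fin M.nodes}
    (hn : M.Enabled C n) (hs : (σ n).isSome)
    (honly : ∀ u, (σ u).isSome → M.Enabled C u → u = n) : M.IsCanonical σ n C := by
  have hfin : ¬ (σ M.final).isSome := by rw [hσ.final hM]; simp
  have hnf : n ≠ M.final := by rintro rfl; exact hfin hs
  have hnl : n ∈ l := by
    obtain ⟨p, hp⟩ := hM.dnode_nonempty n
    have := (h.mem_of_ne_final hM hf (p := p) (by rwa [hn p hp])).1
    rwa [hn p hp] at this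
  -- Every process that arrives at a non-final node has to leave it later, so reachable nodes are
  -- executed.
  have hreach : ∀ u, M.SReach σ n u → u ∈ l ∨ u = M.final := by
    intro u hu
    induction hu with
    | refl => exact .inl hnl
    | tail _ he ih =>
      obtain ⟨p, he⟩ := he
      rcases ih with ih | rfl
      · exact h.mem_of_sNext hM hf ih he
      · obtain ⟨a, ha, -⟩ := he
        rw [hσ.final hM] at ha
        cases ha
  -- Conversely, an executed node is reached from an enabled node of the strategy, and `n` is the
  -- only one.
  have hmem : ∀ u ∈ l, M.SReach σ n u := by
    intro u hu
    obtain ⟨u₀, h₁, h₂, h₃⟩ := h.exists_enabled_sReach hM hσ hu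
    rwa [honly u₀ h₂ h₁] at h₃
  intro q m
  have hq := h.reaches hM hσ q
  rw [show C₁ q = M.final by rw [hf]; rfl] at hq
  constructor
  · rintro ⟨h₁, h₂, h₃, h₄⟩
    have hmf : m ≠ M.final := by rintro rfl; exact hfin h₃
    refine ⟨?_, hmf⟩
    have hml : m ∈ l := (hreach m h₁).resolve_right hmf
    rcases Relation.ReflTransGen.cases_tail (hq.1 m hml h₂) with he | ⟨u, h₅, h₆⟩
    · exact he.symm
    -- Otherwise `m` has a predecessor on the path of `q`, and this predecessor is also reachable
    -- from `n`.
    · exfalso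
      have hul : ∀ x, Relation.ReflTransGen (M.SNext σ q) (C q) x → x ∈ l ∨ x = M.final := by
        intro x hx
        induction hx with
        | refl =>
          by_cases hc : C q = M.final
          · exact .inr hc
          · exact .inl (h.mem_of_ne_final hM hf hc).1
        | tail _ he ih =>
          rcases ih with ih | rfl
          · exact h.mem_of_sNext hM hf ih he
          · obtain ⟨a, ha, -⟩ := he
            rw [hσ.final hM] at ha
            cases ha
      rcases hul u h₅ with hu | rfl
      · exact h₄ u (hmem u hu) h₆
      · obtain ⟨a, ha, -⟩ := h₆
        rw [hσ.final hM] at ha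
        cases ha
  · rintro ⟨rfl, hmf⟩
    obtain ⟨h₁, h₂⟩ := h.mem_of_ne_final hM hf hmf
    refine ⟨hmem _ h₁, h₂, h.isSome_of_mem h₁, fun u hu hnext => hmf ?_⟩
    have hul : u ∈ l := by
      refine (hreach u hu).resolve_right ?_
      rintro rfl
      obtain ⟨a, ha, -⟩ := hnext
      rw [hσ.final hM] at ha
      cases ha
    obtain ⟨a, ha, hδ⟩ := id hnext
    -- A reachable predecessor of `C q` would lie on the path of `q` from `C q` and close a cycle.
    -- The final node, being on this path, would then lead back to `C q`, but the strategy stops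
    -- there.
    have hcyc : Relation.TransGen (M.SNext σ q) (C q) (C q) :=
      Relation.TransGen.tail' (hq.1 u hul (hM.mem_dnode hδ).1) hnext
    have hback := reflTransGen_symm_of_transGen (fun x y z => by
      rintro ⟨a, h₁, h₂⟩ ⟨b, h₃, h₄⟩
      rw [h₁] at h₃
      cases h₃
      rw [h₂] at h₄
      exact Option.some.inj h₄) hcyc hq.2
    rcases Relation.ReflTransGen.cases_head hback with he | ⟨z, ⟨b, hb, -⟩, -⟩
    · exact he.symm
    · rw [hσ.final hM] at hb
      cases hb

/-- In a good configuration, executing other nodes as long as possible leads to the canonical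
configuration of a given enabled node. -/
theorem Good.exists_canonical (hM : M.IsNegotiation) (hσ : M.IsStrategy σ rank) {C : M.Config}
    (hC : M.Good σ C) {n : Fin M.nodes} (hn : M.Enabled C n) (hs : (σ n).isSome) :
    ∃ l C₁, M.SRun σ C l C₁ ∧ n ∉ l ∧ M.IsCanonical σ n C₁ := by
  obtain ⟨l, C₁, h₁, h₂, h₃⟩ := exists_stuck hM hσ C {n}
  obtain ⟨a, ha⟩ := Option.isSome_iff_exists.1 hs
  have hnl : n ∉ l := fun h => h₂ n h rfl
  obtain ⟨l₁, h₄⟩ := hC.srun hM hσ h₁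
  refine ⟨l, C₁, h₁, hnl, h₄.isCanonical hM hσ rfl (h₁.commute hM (a := a) hnl hn).2 hs ?_⟩
  intro u hu he
  by_contra hne
  exact h₃ u hne hu he

/-- Play until stuck. By soundness, either this is success or an action is possible at some node;
that node is reachable and not final, so the strategy could have continued there. -/
theorem Sound.good (hM : M.IsNegotiation) (hσ : M.IsStrategy σ rank)
    (hd : ∀ u, M.LReach M.init u → M.LReach u M.final → u = M.final ∨ (σ u).isSome)
    (hS : M.Sound) {C : M.Config} (hC : M.Reachable C) : M.Good σ C := by
  obtain ⟨l, C₁, h₁, -, h₃⟩ := exists_stuck hM hσ C ∅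
  have hC₁ := h₁.reachable hM hσ hC
  obtain ⟨w, hw⟩ := hS.exists_exec hC₁
  generalize hD : M.finalConfig = D at hw
  cases hw with
  | nil => exact ⟨l, hD ▸ h₁⟩
  | cons hs _ =>
    exfalso
    obtain ⟨u, hu, ha, rfl⟩ := (step_iff hM).1 hs
    obtain ⟨p, hp⟩ := hM.dnode_nonempty u
    have hr := hC₁.lReach hM p
    rw [hu p hp] at hr
    rcases hd u hr (hS.lReach_final hM hr) with rfl | h
    · exact hM.out_final' ha
    · exact h₃ u (Set.notMem_empty _) h hu

theorem Sound.exists_isCanonical (hM : M.IsNegotiation) (hσ : M.IsStrategy σ rank)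
    (hd : ∀ u, M.LReach M.init u → M.LReach u M.final → u = M.final ∨ (σ u).isSome)
    (hS : M.Sound) {n : Fin M.nodes} (hn : M.LReach M.init n) (hnf : n ≠ M.final) :
    ∃ C, M.Reachable C ∧ M.Enabled C n ∧ M.IsCanonical σ n C := by
  obtain ⟨C, hC, he⟩ := hS.exists_enabled hM hn
  have hs := (hd n hn (hS.lReach_final hM hn)).resolve_left hnf
  obtain ⟨a, ha⟩ := Option.isSome_iff_exists.1 hs
  obtain ⟨l, C₁, h₁, h₂, h₃⟩ := (hS.good hM hσ hd hC).exists_canonical hM hσ he hs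
  exact ⟨C₁, h₁.reachable hM hσ hC, (h₁.commute hM (a := a) h₂ he).2, h₃⟩

/-- `Good` is invariant under all actions: before `a` is executed at `u`, the rest of the strategy
can be played up to the canonical configuration of `u`, where the effect of `a` is covered by
`hstep`. -/
theorem sound_of_good (hM : M.IsNegotiation) (hσ : M.IsStrategy σ rank)
    (hd : ∀ u, M.LReach M.init u → u = M.final ∨ (σ u).isSome)
    (h₀ : M.Good σ M.initConfig)
    (hstep : ∀ n a C, M.LReach M.init n → a ∈ M.out n → M.Enabled C n → M.IsCanonical σ n C →
      M.Good σ (M.move C n a)) : M.Sound := by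
  have key : ∀ C C₁ w, M.Exec C w C₁ → M.Reachable C → M.Good σ C → M.Good σ C₁ := by
    intro C C₁ w h
    induction h with
    | nil => exact fun _ h => h
    | @cons C _ _ a _ hs _ ih =>
      intro hr hg
      obtain ⟨u, hu, ha, rfl⟩ := (step_iff hM).1 hs
      refine ih (hr.move hM hu ha) ?_
      obtain ⟨p, hp⟩ := hM.dnode_nonempty u
      have hlr := hr.lReach hM p
      rw [hu p hp] at hlr
      have hsome : (σ u).isSome := (hd u hlr).resolve_left (by
        rintro rfl; exact hM.out_final' ha)
      -- The run `l` avoids `u`, so it can also be made after `a`; `SRun.good` then takes `Good`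
      -- back from the end of this run to its start.
      obtain ⟨l, C₂, h₁, h₂, h₃⟩ := hg.exists_canonical hM hσ hu hsome
      obtain ⟨h₄, h₅⟩ := h₁.commute hM (a := a) h₂ hu
      exact h₄.good (hstep u a C₂ hlr ha h₅ h₃)
  intro w C hw
  obtain ⟨l, hl⟩ := key _ _ _ hw .init h₀
  clear key hw
  generalize hD : M.finalConfig = D at hl
  clear hD
  induction hl with
  | nil => exact ⟨[], .nil _⟩
  | cons hu ha _ ih =>
    obtain ⟨v, hv⟩ := ih
    exact ⟨_, .cons ((step_iff hM).2 ⟨_, hu, hσ.mem_out _ _ ha, rfl⟩) hv⟩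

end Strategy

end Diagram

/-! ## The algorithms, on lists of transitions -/

/-- A transition: node, action, process and target. -/
abbrev Quad : Type := ℕ × ℕ × ℕ × ℕ

namespace TransList

/-- The node of `p` after the transitions in `h` (most recent first), `d` being the initial one. -/
def loc (d : ℕ) (h : List Quad) (p : ℕ) : ℕ :=
  ((h.filter fun e => decide (e.2.2.1 = p)).headD (0, 0, 0, d)).2.2.2

/-- The transitions of the action `a` at the node `u`. -/
def moves (E : List Quad) (u a : ℕ) : List Quad :=
  E.filter fun e => decide (e.1 = u) && decide (e.2.1 = a)

/-- All processes that `u` needs are at `u`. -/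
def canFire (E : List Quad) (d : ℕ) (h : List Quad) (u a : ℕ) : Bool :=
  (moves E u a).all fun e => decide (loc d h e.2.2.1 = u)

/-- Execute `a` at `u`, if possible. -/
def fire (E : List Quad) (d : ℕ) (h : List Quad) (u a : ℕ) : List Quad :=
  if canFire E d h u a then moves E u a ++ h else h

/-- `u` is the first component of a member of the list, or `r`. -/
def known (r : ℕ) (S : List Quad) (u : ℕ) : Bool :=
  decide (u = r) || S.any fun e => decide (e.1 = u)

/-- Add the transition, if its target is known and its source is not. -/
def growStep (r : ℕ) (S : List Quad) (e : Quad) : List Quad :=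
  if known r S e.1 then S else if known r S e.2.2.2 then e :: S else S

/-- For each node from which `r` can be reached, a transition that gets closer to `r`. -/
def grow (E : List Quad) (r : ℕ) : List Quad :=
  (E.flatMap fun _ => E).foldl (growStep r) []

/-- All transitions with the same source and action as one in `S`. -/
def strat (E S : List Quad) : List Quad :=
  E.filter fun e => S.any fun x => decide (x.1 = e.1) && decide (x.2.1 = e.2.1)

def rev (e : Quad) : Quad := (e.2.2.2, e.2.1, e.2.2.1, e.1)

/-- The node `u` can be reached from `n`. -/
def reaches (E : List Quad) (n u : ℕ) : Bool := known n (grow (E.map rev) n) u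

/-- The transitions that can be reached from `n`. -/
def within (E : List Quad) (n : ℕ) : List Quad :=
  E.filter fun e => reaches E n e.1

/-- A history that takes each process to its first node among those reachable from `n`. -/
def canon (E : List Quad) (n : ℕ) : List Quad :=
  ((within E n).filter fun e => !(within E n).any fun x =>
    decide (x.2.2.1 = e.2.2.1) && decide (x.2.2.2 = e.1)).map
      fun e => (e.1, e.2.1, e.2.2.1, e.1)

/-- Follow the strategy for as long as necessary. -/
def play (E F : List Quad) (d : ℕ) (h : List Quad) : List Quad :=
  (E.flatMap fun _ => E.flatMap fun _ => F).foldl (fun h e => fire E d h e.1 e.2.1) h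

/-- All of the first `k` processes are at `r`. -/
def allAt (k r d : ℕ) (h : List Quad) : Bool :=
  (List.range k).all fun p => decide (loc d h p = r)

/-- The strategy leads all processes to `r`. -/
def isGood (k r : ℕ) (E F : List Quad) (d : ℕ) (h : List Quad) : Bool :=
  allAt k r d (play E F d h)

/-- The test for soundness. -/
def soundTest (k i r : ℕ) (E : List Quad) : Bool :=
  (decide (i = r) || known r (grow E r) i) &&
  (E.all fun e => !reaches E i e.1 || known r (grow E r) e.2.2.2) &&
  isGood k r E (strat E (grow E r)) i [] &&
  E.all fun e => !reaches E i e.1 ||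
    isGood k r E (strat E (grow E r)) r
      (fire E r (canon (strat E (grow E r)) e.1) e.1 e.2.1)

end TransList

/-! ### Polynomial time bounds for the soundness test. -/

namespace PolyFun

open TransList

variable {α : Type} [TreeEnc α]

theorem loc {d p : α → ℕ} {h : α → List Quad} (hd : PolyFun d) (hh : PolyFun h)
    (hp : PolyFun p) : PolyFun fun a => TransList.loc (d a) (h a) (p a) :=
  snd (snd (snd (headD
    (filter (k := fun a (e : Quad) => decide (e.2.2.1 = p a)) hh
      (natEq (fst (snd (snd (snd id)))) (hp.comp (fst id))))
    (pair (const 0) (pair (const 0) (pair (const 0) hd))))))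

theorem moves {E : α → List Quad} {u b : α → ℕ} (hE : PolyFun E) (hu : PolyFun u)
    (hb : PolyFun b) : PolyFun fun a => TransList.moves (E a) (u a) (b a) :=
  filter (k := fun a (e : Quad) => decide (e.1 = u a) && decide (e.2.1 = b a)) hE
    (and (natEq (fst (snd id)) (hu.comp (fst id))) (natEq (fst (snd (snd id))) (hb.comp (fst id))))

theorem canFire {E h : α → List Quad} {d u b : α → ℕ} (hE : PolyFun E) (hd : PolyFun d)
    (hh : PolyFun h) (hu : PolyFun u) (hb : PolyFun b) :
    PolyFun fun a => TransList.canFire (E a) (d a) (h a) (u a) (b a) :=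
  all (k := fun a (e : Quad) => decide (TransList.loc (d a) (h a) e.2.2.1 = u a)) (moves hE hu hb)
    (natEq (loc (hd.comp (fst id)) (hh.comp (fst id)) (fst (snd (snd (snd id)))))
      (hu.comp (fst id)))

theorem fire {E h : α → List Quad} {d u b : α → ℕ} (hE : PolyFun E) (hd : PolyFun d)
    (hh : PolyFun h) (hu : PolyFun u) (hb : PolyFun b) :
    PolyFun fun a => TransList.fire (E a) (d a) (h a) (u a) (b a) :=
  ite (canFire hE hd hh hu hb) (append (moves hE hu hb) hh) hh

theorem known {S : α → List Quad} {r u : α → ℕ} (hr : PolyFun r) (hS : PolyFun S)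
    (hu : PolyFun u) : PolyFun fun a => TransList.known (r a) (S a) (u a) :=
  or (natEq hu hr) (any (k := fun a (e : Quad) => decide (e.1 = u a)) hS
    (natEq (fst (snd id)) (hu.comp (fst id))))

theorem growStep {S : α → List Quad} {r : α → ℕ} {e : α → Quad} (hr : PolyFun r)
    (hS : PolyFun S) (he : PolyFun e) : PolyFun fun a => TransList.growStep (r a) (S a) (e a) :=
  ite (known hr hS (fst he)) hS (ite (known hr hS (snd (snd (snd he)))) (cons he hS) hS)

theorem grow {E : α → List Quad} {r : α → ℕ} (hE : PolyFun E) (hr : PolyFun r) :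
    PolyFun fun a => TransList.grow (E a) (r a) :=
  foldl (h := fun a S (e : Quad) => TransList.growStep (r a) S e)
    (flatMap (k := fun a _ => E a) hE (hE.comp (fst id))) (const [])
    (growStep (hr.comp (fst id)) (fst (snd id)) (snd (snd id)))
    (hE.size_bdd.add (.const 1)) fun a S e he => by
      have hmem : e ∈ E a := by
        obtain ⟨_, _, h⟩ := List.mem_flatMap.1 he
        exact h
      have := esize_le_of_mem hmem
      unfold TransList.growStep
      split_ifs
      · omega
      · rw [esize_cons]; omega
      · omega

theorem strat {E S : α → List Quad} (hE : PolyFun E) (hS : PolyFun S) :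
    PolyFun fun a => TransList.strat (E a) (S a) :=
  filter (k := fun a (e : Quad) => (S a).any fun x => decide (x.1 = e.1) && decide (x.2.1 = e.2.1)) hE
    (any (k := fun (y : α × Quad) (x : Quad) => decide (x.1 = y.2.1) && decide (x.2.1 = y.2.2.1))
      (hS.comp (fst id))
      (and (natEq (fst (snd id)) (fst (snd (fst id))))
        (natEq (fst (snd (snd id))) (fst (snd (snd (fst id)))))))

theorem reaches {E : α → List Quad} {n u : α → ℕ} (hE : PolyFun E) (hn : PolyFun n)
    (hu : PolyFun u) : PolyFun fun a => TransList.reaches (E a) (n a) (u a) :=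
  known hn (grow (map (k := fun _ (e : Quad) => rev e) hE
    (pair (snd (snd (snd (snd id)))) (pair (fst (snd (snd id)))
      (pair (fst (snd (snd (snd id)))) (fst (snd id)))))) hn) hu

theorem within {E : α → List Quad} {n : α → ℕ} (hE : PolyFun E) (hn : PolyFun n) :
    PolyFun fun a => TransList.within (E a) (n a) :=
  filter (k := fun a (e : Quad) => TransList.reaches (E a) (n a) e.1) hE
    (reaches (hE.comp (fst id)) (hn.comp (fst id)) (fst (snd id)))

theorem canon {E : α → List Quad} {n : α → ℕ} (hE : PolyFun E) (hn : PolyFun n) :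
    PolyFun fun a => TransList.canon (E a) (n a) :=
  map (k := fun _ (e : Quad) => (e.1, e.2.1, e.2.2.1, e.1))
    (filter (k := fun a (e : Quad) => !(TransList.within (E a) (n a)).any fun x =>
      decide (x.2.2.1 = e.2.2.1) && decide (x.2.2.2 = e.1)) (within hE hn)
      (not (any (k := fun (y : α × Quad) (x : Quad) =>
          decide (x.2.2.1 = y.2.2.2.1) && decide (x.2.2.2 = y.2.1))
        ((within hE hn).comp (fst id))
        (and (natEq (fst (snd (snd (snd id)))) (fst (snd (snd (snd (fst id))))))
          (natEq (snd (snd (snd (snd id)))) (fst (snd (fst id))))))))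
    (pair (fst (snd id)) (pair (fst (snd (snd id))) (pair (fst (snd (snd (snd id))))
      (fst (snd id)))))

theorem play {E F h : α → List Quad} {d : α → ℕ} (hE : PolyFun E) (hF : PolyFun F)
    (hd : PolyFun d) (hh : PolyFun h) :
    PolyFun fun a => TransList.play (E a) (F a) (d a) (h a) :=
  foldl (h := fun a s (e : Quad) => TransList.fire (E a) (d a) s e.1 e.2.1)
    (flatMap (k := fun a _ => (E a).flatMap fun _ => F a) hE
      ((flatMap (k := fun a _ => F a) hE (hF.comp (fst id))).comp (fst id))) hh
    (fire (hE.comp (fst id)) (hd.comp (fst id)) (fst (snd id)) (fst (snd (snd id)))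
      (fst (snd (snd (snd id)))))
    hE.size_bdd fun a s e _ => by
      have h₁ := esize_filter_le
        (fun x : Quad => decide (x.1 = e.1) && decide (x.2.1 = e.2.1)) (E a)
      have h₂ := esize_append (TransList.moves (E a) e.1 e.2.1) s
      unfold TransList.fire
      unfold TransList.moves at *
      split_ifs <;> omega

theorem allAt {k r d : α → ℕ} {h : α → List Quad} (hk : PolyFun k) (hr : PolyFun r)
    (hd : PolyFun d) (hh : PolyFun h) :
    PolyFun fun a => TransList.allAt (k a) (r a) (d a) (h a) :=
  all (k := fun a p => decide (TransList.loc (d a) (h a) p = r a)) (range hk)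
    (natEq (loc (hd.comp (fst id)) (hh.comp (fst id)) (snd id)) (hr.comp (fst id)))

theorem isGood {E F h : α → List Quad} {k r d : α → ℕ} (hk : PolyFun k) (hr : PolyFun r)
    (hE : PolyFun E) (hF : PolyFun F) (hd : PolyFun d) (hh : PolyFun h) :
    PolyFun fun a => TransList.isGood (k a) (r a) (E a) (F a) (d a) (h a) :=
  allAt hk hr hd (play hE hF hd hh)

theorem soundTest {E : α → List Quad} {k i r : α → ℕ} (hk : PolyFun k) (hi : PolyFun i)
    (hr : PolyFun r) (hE : PolyFun E) :
    PolyFun fun a => TransList.soundTest (k a) (i a) (r a) (E a) :=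
  have hG := grow hE hr
  have hF := strat hE hG
  and (and (and
    (or (natEq hi hr) (known hr hG hi))
    (all (k := fun a (e : Quad) => !TransList.reaches (E a) (i a) e.1 ||
        TransList.known (r a) (TransList.grow (E a) (r a)) e.2.2.2) hE
      (or (not (reaches (hE.comp (fst id)) (hi.comp (fst id)) (fst (snd id))))
        (known (hr.comp (fst id)) (hG.comp (fst id)) (snd (snd (snd (snd id))))))))
    (isGood hk hr hE hF hi (const [])))
    (all (k := fun a (e : Quad) => !TransList.reaches (E a) (i a) e.1 ||
        TransList.isGood (k a) (r a) (E a)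
          (TransList.strat (E a) (TransList.grow (E a) (r a))) (r a)
          (TransList.fire (E a) (r a)
            (TransList.canon (TransList.strat (E a) (TransList.grow (E a) (r a))) e.1)
            e.1 e.2.1)) hE
      (or (not (reaches (hE.comp (fst id)) (hi.comp (fst id)) (fst (snd id))))
        (isGood (hk.comp (fst id)) (hr.comp (fst id)) (hE.comp (fst id)) (hF.comp (fst id))
          (hr.comp (fst id))
          (fire (hE.comp (fst id)) (hr.comp (fst id)) (canon (hF.comp (fst id)) (fst (snd id)))
            (fst (snd id)) (fst (snd (snd id)))))))

end PolyFun

/-- The encoded data of a negotiation diagram and its alphabet. -/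
abbrev RawDiagram : Type :=
  (ℕ × List (List ℕ)) × List (List ℕ) × List Quad × ℕ × ℕ

theorem PolyFun.soundTest_raw : PolyFun fun D : RawDiagram =>
    TransList.soundTest D.1.1 D.2.2.2.1 D.2.2.2.2 D.2.2.1 :=
  .soundTest (fst (fst id)) (fst (snd (snd (snd id)))) (snd (snd (snd (snd id))))
    (fst (snd (snd id)))

/-! ## Correctness of the algorithms -/

namespace TransList

theorem loc_nil (d p : ℕ) : loc d [] p = d := rfl

theorem loc_cons (d : ℕ) (e : Quad) (h : List Quad) (p : ℕ) :
    loc d (e :: h) p = if e.2.2.1 = p then e.2.2.2 else loc d h p := by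
  unfold loc
  rw [List.filter_cons]
  by_cases hp : e.2.2.1 = p <;> simp [hp]

theorem loc_append_of_notMem {d : ℕ} {l h : List Quad} {p : ℕ} (hl : ∀ e ∈ l, e.2.2.1 ≠ p) :
    loc d (l ++ h) p = loc d h p := by
  induction l with
  | nil => rfl
  | cons e l ih =>
    rw [List.cons_append, loc_cons, if_neg (hl e List.mem_cons_self)]
    exact ih fun x hx => hl x (List.mem_cons_of_mem _ hx)

theorem loc_append_of_mem {d : ℕ} {l h : List Quad} {p v : ℕ}
    (hl : ∀ e ∈ l, e.2.2.1 = p → e.2.2.2 = v) (hp : ∃ e ∈ l, e.2.2.1 = p) :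
    loc d (l ++ h) p = v := by
  induction l with
  | nil => simp at hp
  | cons e l ih =>
    rw [List.cons_append, loc_cons]
    split_ifs with he
    · exact hl e List.mem_cons_self he
    · refine ih (fun x hx => hl x (List.mem_cons_of_mem _ hx)) ?_
      obtain ⟨x, hx, hxp⟩ := hp
      rcases List.mem_cons.1 hx with rfl | hx
      · exact absurd hxp he
      · exact ⟨x, hx, hxp⟩

theorem mem_moves {E : List Quad} {u a : ℕ} {e : Quad} :
    e ∈ moves E u a ↔ e ∈ E ∧ e.1 = u ∧ e.2.1 = a := by
  simp [moves]

theorem known_iff {r : ℕ} {S : List Quad} {u : ℕ} :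
    known r S u = true ↔ u = r ∨ ∃ e ∈ S, e.1 = u := by
  simp [known]

theorem known_cons {r : ℕ} {S : List Quad} {e : Quad} {u : ℕ} (h : known r S u = true) :
    known r (e :: S) u = true := by
  rw [known_iff] at h ⊢
  refine h.imp_right ?_
  rintro ⟨x, hx, hu⟩
  exact ⟨x, List.mem_cons_of_mem _ hx, hu⟩

/-- Each transition leads to a known node and its source was not known before. -/
def Layered (r : ℕ) : List Quad → Prop
  | [] => True
  | e :: S => known r S e.2.2.2 = true ∧ known r S e.1 = false ∧ Layered r S

theorem growStep_induction {r : ℕ} {S : List Quad} {e : Quad} {P : List Quad → Prop} (h : P S)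
    (h₁ : known r S e.1 = false → known r S e.2.2.2 = true → P (e :: S)) :
    P (growStep r S e) := by
  unfold growStep
  split_ifs with h₂ h₃
  · exact h
  · exact h₁ (by simpa using h₂) h₃
  · exact h

theorem known_foldl {r : ℕ} (L S : List Quad) {u : ℕ} (h : known r S u = true) :
    known r (L.foldl (growStep r) S) u = true := by
  induction L generalizing S with
  | nil => exact h
  | cons e L ih =>
    exact ih _ (growStep_induction (P := fun S => known r S u = true) h fun _ _ => known_cons h)

theorem layered_foldl {r : ℕ} {E : List Quad} (L S : List Quad) (hL : ∀ e ∈ L, e ∈ E)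
    (h : Layered r S ∧ ∀ e ∈ S, e ∈ E) :
    Layered r (L.foldl (growStep r) S) ∧ ∀ e ∈ L.foldl (growStep r) S, e ∈ E := by
  induction L generalizing S with
  | nil => exact h
  | cons e L ih =>
    refine ih _ (fun x hx => hL x (List.mem_cons_of_mem _ hx))
      (growStep_induction (P := fun S => Layered r S ∧ ∀ e ∈ S, e ∈ E) h fun h₁ h₂ =>
        ⟨⟨h₂, h₁, h.1⟩, fun x hx => ?_⟩)
    rcases List.mem_cons.1 hx with rfl | hx
    · exact hL x List.mem_cons_self
    · exact h.2 x hx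

theorem layered_grow (E : List Quad) (r : ℕ) :
    Layered r (grow E r) ∧ ∀ e ∈ grow E r, e ∈ E := by
  refine layered_foldl _ _ (fun e he => ?_) ⟨trivial, by simp⟩
  obtain ⟨_, _, h⟩ := List.mem_flatMap.1 he
  exact h

/-- No transition can be added. -/
def Closed (E : List Quad) (r : ℕ) (S : List Quad) : Prop :=
  ∀ e ∈ E, known r S e.2.2.2 = true → known r S e.1 = true

theorem countP_lt {β : Type} {f g : β → Bool} (l : List β) (hle : ∀ x ∈ l, f x = true → g x = true)
    {x : β} (hx : x ∈ l) (hf : f x = false) (hg : g x = true) : l.countP f < l.countP g := by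
  induction l with
  | nil => simp at hx
  | cons y l ih =>
    have hle' : ∀ x ∈ l, f x = true → g x = true := fun x hx => hle x (List.mem_cons_of_mem _ hx)
    rw [List.countP_cons, List.countP_cons]
    rcases List.mem_cons.1 hx with rfl | hx
    · have := List.countP_mono_left hle'
      simp [hf, hg]
      omega
    · have h₁ := ih hle' hx
      have h₂ := hle y List.mem_cons_self
      split_ifs <;> first | omega | simp_all

/-- A round over all transitions either starts from a closed list or lowers the number of
transitions with unknown source. So as many rounds as there are transitions suffice, which is the
number that `grow` makes. -/
theorem closed_rounds {E : List Quad} {r : ℕ} (K : List Quad) (S : List Quad)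
    (h : E.countP (fun e => !known r S e.1) ≤ K.length) :
    Closed E r ((K.flatMap fun _ => E).foldl (growStep r) S) := by
  have round : ∀ S, ¬ Closed E r S → E.countP (fun e => !known r (E.foldl (growStep r) S) e.1) <
      E.countP (fun e => !known r S e.1) := by
    intro S hS
    unfold Closed at hS
    push Not at hS
    obtain ⟨e, he, hv, hu⟩ := hS
    refine countP_lt E (fun x _ hx => ?_) he ?_ (by simpa using hu)
    · by_contra hcon
      rw [known_foldl _ _ (by simpa using hcon)] at hx
      cases hx
    · obtain ⟨L₁, L₂, rfl⟩ := List.append_of_mem he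
      rw [Bool.not_eq_false', List.foldl_append, List.foldl_cons]
      refine known_foldl _ _ ?_
      have hv' := known_foldl L₁ S hv
      rw [growStep, if_pos hv']
      split_ifs with h₁
      · exact h₁
      · rw [known_iff]; exact .inr ⟨e, List.mem_cons_self, rfl⟩
  have closed_fold : ∀ S, Closed E r S → ∀ L : List Quad, (∀ e ∈ L, e ∈ E) →
      L.foldl (growStep r) S = S := by
    intro S hS L hL
    induction L with
    | nil => rfl
    | cons e L ih =>
      have hid : growStep r S e = S := by
        unfold growStep
        split_ifs with h₁ h₂
        · rfl
        · exact absurd (hS e (hL e List.mem_cons_self) h₂) h₁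
        · rfl
      rw [List.foldl_cons, hid]
      exact ih fun x hx => hL x (List.mem_cons_of_mem _ hx)
  induction K generalizing S with
  | nil =>
    by_contra hcon
    have := round S hcon
    simp only [List.length_nil] at h
    omega
  | cons k K ih =>
    by_cases hS : Closed E r S
    · rw [closed_fold S hS]
      · exact hS
      · intro e he
        obtain ⟨_, _, h⟩ := List.mem_flatMap.1 he
        exact h
    · rw [List.flatMap_cons, List.foldl_append]
      apply ih
      have := round S hS
      simp only [List.length_cons] at h
      omega

theorem closed_grow (E : List Quad) (r : ℕ) : Closed E r (grow E r) :=
  closed_rounds E [] List.countP_le_length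

/-- Edges of the graph on numbers given by a list of transitions. -/
def NEdge (E : List Quad) (x y : ℕ) : Prop := ∃ e ∈ E, e.1 = x ∧ e.2.2.2 = y

theorem Layered.reach {E : List Quad} {r : ℕ} {S : List Quad} (h : Layered r S)
    (hE : ∀ e ∈ S, e ∈ E) {u : ℕ} (hu : known r S u = true) :
    Relation.ReflTransGen (NEdge E) u r := by
  induction S generalizing u with
  | nil =>
    obtain rfl : u = r := by simpa [known] using hu
    exact .refl
  | cons e S ih =>
    obtain ⟨h₁, -, h₃⟩ := h
    have ih := fun {u} => @ih h₃ (fun x hx => hE x (List.mem_cons_of_mem _ hx)) u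
    rcases known_iff.1 hu with rfl | ⟨x, hx, rfl⟩
    · exact .refl
    · rcases List.mem_cons.1 hx with rfl | hx
      · exact .head ⟨x, hE x List.mem_cons_self, rfl, rfl⟩ (ih h₁)
      · exact ih (known_iff.2 (.inr ⟨x, hx, rfl⟩))

theorem known_grow_iff {E : List Quad} {r u : ℕ} :
    known r (grow E r) u = true ↔ Relation.ReflTransGen (NEdge E) u r := by
  obtain ⟨h₁, h₂⟩ := layered_grow E r
  refine ⟨h₁.reach h₂, fun h => ?_⟩
  induction h using Relation.ReflTransGen.head_induction_on with
  | refl => simp [known]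
  | head he _ ih =>
    obtain ⟨e, he, rfl, rfl⟩ := he
    exact closed_grow E r e he ih

theorem reaches_iff {E : List Quad} {n u : ℕ} :
    reaches E n u = true ↔ Relation.ReflTransGen (NEdge E) n u := by
  have : NEdge (E.map rev) = Function.swap (NEdge E) := by
    funext x y
    simp only [NEdge, List.mem_map, Function.swap, eq_iff_iff]
    constructor
    · rintro ⟨_, ⟨e, he, rfl⟩, rfl, rfl⟩
      exact ⟨e, he, rfl, rfl⟩
    · rintro ⟨e, he, rfl, rfl⟩
      exact ⟨_, ⟨e, he, rfl⟩, rfl, rfl⟩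
  rw [reaches, known_grow_iff, this, Relation.reflTransGen_swap]

/-- The height of a node in a layered list. -/
def depth : List Quad → ℕ → ℕ
  | [], _ => 0
  | e :: S, u => if e.1 = u then S.length + 1 else depth S u

theorem depth_le (S : List Quad) (u : ℕ) : depth S u ≤ S.length := by
  induction S with
  | nil => exact le_rfl
  | cons e S ih =>
    rw [depth, List.length_cons]
    split_ifs <;> omega

theorem Layered.known_target {r : ℕ} {S : List Quad} (h : Layered r S) {e : Quad}
    (he : e ∈ S) : known r S e.2.2.2 = true := by
  induction S with
  | nil => simp at he
  | cons x S ih =>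
    obtain ⟨h₁, -, h₃⟩ := h
    rcases List.mem_cons.1 he with rfl | he
    · exact known_cons h₁
    · exact known_cons (ih h₃ he)

/-- The source of a transition is added after its target. This makes `depth` a rank function for the
strategy. -/
theorem Layered.depth_lt {r : ℕ} {S : List Quad} (h : Layered r S) {e : Quad} (he : e ∈ S) :
    depth S e.2.2.2 < depth S e.1 := by
  induction S with
  | nil => simp at he
  | cons x S ih =>
    obtain ⟨h₁, h₂, h₃⟩ := h
    have hne : ∀ u, known r S u = true → x.1 ≠ u := by
      rintro u hu rfl
      rw [hu] at h₂
      cases h₂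
    rw [depth, depth]
    rcases List.mem_cons.1 he with rfl | he
    · rw [if_neg (hne _ h₁), if_pos rfl]
      exact Nat.lt_succ_of_le (depth_le _ _)
    · rw [if_neg (hne _ (h₃.known_target he)), if_neg (hne _ (known_iff.2 (.inr ⟨e, he, rfl⟩)))]
      exact ih h₃ he

/-- A source is unknown when it is added, so the list chooses at most one action per node. -/
theorem Layered.eq_of_fst_eq {r : ℕ} {S : List Quad} (h : Layered r S) {e x : Quad} (he : e ∈ S)
    (hx : x ∈ S) (hex : e.1 = x.1) : e = x := by
  induction S with
  | nil => simp at he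
  | cons y S ih =>
    obtain ⟨-, h₂, h₃⟩ := h
    have hne : ∀ z ∈ S, y.1 ≠ z.1 := by
      intro z hz hyz
      rw [hyz, known_iff.2 (.inr ⟨z, hz, rfl⟩)] at h₂
      cases h₂
    rcases List.mem_cons.1 he with rfl | he <;> rcases List.mem_cons.1 hx with rfl | hx
    · rfl
    · exact absurd hex (hne x hx)
    · exact absurd hex.symm (hne e ‹_›)
    · exact ih h₃ he hx

theorem Layered.nodup {r : ℕ} {S : List Quad} (h : Layered r S) : S.Nodup := by
  induction S with
  | nil => exact List.nodup_nil
  | cons y S ih =>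
    obtain ⟨-, h₂, h₃⟩ := h
    refine List.nodup_cons.2 ⟨fun hy => ?_, ih h₃⟩
    rw [known_iff.2 (.inr ⟨y, hy, rfl⟩)] at h₂
    cases h₂

/-- The sum of the ranks bounds the length of strategy runs; this is why `play` makes quadratically
many rounds. -/
theorem sum_depth_le (n : ℕ) (S : List Quad) :
    ∑ u : Fin n, depth S u.val ≤ S.length * S.length := by
  induction S with
  | nil => simp [depth]
  | cons e S ih =>
    have h₁ : ∑ u : Fin n, depth (e :: S) u.val ≤
        ∑ u : Fin n, ((if e.1 = u.val then S.length + 1 else 0) + depth S u.val) := by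
      refine Finset.sum_le_sum fun u _ => ?_
      rw [depth]
      split_ifs <;> omega
    have h₂ : ∑ u : Fin n, (if e.1 = u.val then S.length + 1 else 0) ≤ S.length + 1 := by
      rw [← Finset.sum_filter, Finset.sum_const, smul_eq_mul]
      have : (Finset.univ.filter fun u : Fin n => e.1 = u.val).card ≤ 1 := by
        refine Finset.card_le_one.2 fun a ha b hb => Fin.ext ?_
        rw [Finset.mem_filter] at ha hb
        exact ha.2.symm.trans hb.2
      calc _ ≤ 1 * (S.length + 1) := Nat.mul_le_mul_right _ this
        _ = _ := one_mul _
    rw [Finset.sum_add_distrib] at h₁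
    rw [List.length_cons]
    nlinarith

theorem mem_strat {E S : List Quad} {e : Quad} :
    e ∈ strat E S ↔ e ∈ E ∧ ∃ x ∈ S, x.1 = e.1 ∧ x.2.1 = e.2.1 := by
  simp [strat]

theorem allAt_iff {k r d : ℕ} {h : List Quad} :
    allAt k r d h = true ↔ ∀ p < k, loc d h p = r := by
  simp [allAt]

end TransList

/-! ### The list algorithms on diagrams: histories, the strategy and its canonical configurations.
-/

open TransList

namespace Diagram

variable {Γ : DistAlphabet} {M : Diagram Γ}

/-- The list of transitions of a diagram. -/
def transList (M : Diagram Γ) : List Quad :=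
  (List.finRange M.nodes).flatMap fun u =>
    (List.finRange Γ.acts).flatMap fun a =>
      (List.finRange Γ.procs).filterMap fun p =>
        (M.δ u a p).map fun v => (u.val, a.val, p.val, v.val)

theorem mem_transList {e : Quad} : e ∈ M.transList ↔
    ∃ (u : Fin M.nodes) (a : Γ.Act) (p : Γ.Proc) (v : Fin M.nodes),
      M.δ u a p = some v ∧ e = (u.val, a.val, p.val, v.val) := by
  simp only [transList, List.mem_flatMap, List.mem_filterMap, List.mem_finRange, true_and,
    Option.map_eq_some_iff]
  constructor
  · rintro ⟨u, a, p, v, h, rfl⟩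
    exact ⟨u, a, p, v, h, rfl⟩
  · rintro ⟨u, a, p, v, h, rfl⟩
    exact ⟨u, a, p, v, h, rfl⟩

/-- The history `h` represents the configuration `C`. -/
def Rep (M : Diagram Γ) (d : ℕ) (h : List Quad) (C : M.Config) : Prop :=
  ∀ p : Γ.Proc, loc d h p.val = (C p).val

theorem Rep.init : M.Rep M.init.val [] M.initConfig := fun _ => rfl

theorem mem_moves_transList {u : Fin M.nodes} {a : Γ.Act} {e : Quad} :
    e ∈ moves M.transList u.val a.val ↔
      ∃ (p : Γ.Proc) (v : Fin M.nodes), M.δ u a p = some v ∧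
        e = (u.val, a.val, p.val, v.val) := by
  rw [mem_moves, mem_transList]
  constructor
  · rintro ⟨⟨u', a', p, v, h, rfl⟩, h₁, h₂⟩
    obtain rfl := Fin.ext h₁
    obtain rfl := Fin.ext h₂
    exact ⟨p, v, h, rfl⟩
  · rintro ⟨p, v, h, rfl⟩
    exact ⟨⟨u, a, p, v, h, rfl⟩, rfl, rfl⟩

theorem Rep.canFire_iff (hM : M.IsNegotiation) {d : ℕ} {h : List Quad} {C : M.Config}
    (hC : M.Rep d h C) {u : Fin M.nodes} {a : Γ.Act} (ha : a ∈ M.out u) :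
    canFire M.transList d h u.val a.val = true ↔ M.Enabled C u := by
  simp only [canFire, List.all_eq_true, decide_eq_true_eq]
  constructor
  · intro hall p hp
    obtain ⟨v, hv⟩ := hM.exists_of_mem_out ha hp
    have := hall _ (mem_moves_transList.2 ⟨p, v, hv, rfl⟩)
    rw [hC p] at this
    exact Fin.ext this
  · intro he e hmem
    obtain ⟨p, v, hv, rfl⟩ := mem_moves_transList.1 hmem
    rw [hC p, he p (hM.mem_dnode hv).1]

/-- New transitions are put in front and `loc` reads the first one of a process. It does not matter
in which order the transitions of one action are listed, since they belong to different processes.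
-/
theorem Rep.fire_of_enabled (hM : M.IsNegotiation) {d : ℕ} {h : List Quad} {C : M.Config}
    (hC : M.Rep d h C) {u : Fin M.nodes} {a : Γ.Act} (ha : a ∈ M.out u) (hu : M.Enabled C u) :
    M.Rep d (fire M.transList d h u.val a.val) (M.move C u a) := by
  rw [fire, if_pos ((hC.canFire_iff hM ha).2 hu)]
  intro p
  by_cases hp : p ∈ M.dnode u
  · obtain ⟨v, hv⟩ := hM.exists_of_mem_out ha hp
    rw [move_of_some hv]
    refine loc_append_of_mem (fun e he hep => ?_)
      ⟨_, mem_moves_transList.2 ⟨p, v, hv, rfl⟩, rfl⟩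
    obtain ⟨q, x, hx, rfl⟩ := mem_moves_transList.1 he
    obtain rfl : q = p := Fin.ext hep
    rw [hv] at hx
    cases hx
    rfl
  · rw [move_of_notMem hM hp, ← hC p]
    refine loc_append_of_notMem fun e he hep => hp ?_
    obtain ⟨q, x, hx, rfl⟩ := mem_moves_transList.1 he
    obtain rfl : q = p := Fin.ext hep
    exact (hM.mem_dnode hx).1

theorem Rep.fire_of_not_enabled (hM : M.IsNegotiation) {d : ℕ} {h : List Quad} {C : M.Config}
    (hC : M.Rep d h C) {u : Fin M.nodes} {a : Γ.Act} (ha : a ∈ M.out u)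
    (hu : ¬ M.Enabled C u) : fire M.transList d h u.val a.val = h := by
  rw [fire, if_neg (mt (hC.canFire_iff hM ha).1 hu)]

theorem Rep.allAt_iff {d : ℕ} {h : List Quad} {C : M.Config} (hC : M.Rep d h C)
    (r : Fin M.nodes) : allAt Γ.procs r.val d h = true ↔ C = fun _ => r := by
  rw [TransList.allAt_iff]
  constructor
  · intro hall
    funext p
    have := hall p.val p.isLt
    rw [hC p] at this
    exact Fin.ext this
  · rintro rfl p hp
    exact hC ⟨p, hp⟩

theorem reflTransGen_val_iff {n : ℕ} {R : ℕ → ℕ → Prop} {R₁ : Fin n → Fin n → Prop}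
    (hR : ∀ x y, R x y ↔ ∃ u v : Fin n, u.val = x ∧ v.val = y ∧ R₁ u v) {u v : Fin n} :
    Relation.ReflTransGen R u.val v.val ↔ Relation.ReflTransGen R₁ u v := by
  constructor
  · generalize hy : v.val = y
    intro h
    induction h generalizing v with
    | refl => rw [Fin.ext hy]
    | tail _ he ih =>
      obtain ⟨u₁, v₁, rfl, rfl, hr⟩ := (hR _ _).1 he
      rw [Fin.ext hy]
      exact (ih rfl).tail hr
  · intro h
    exact h.lift (fun u : Fin n => u.val) fun a b hab => (hR _ _).2 ⟨a, b, rfl, rfl, hab⟩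

theorem nEdge_transList (x y : ℕ) : NEdge M.transList x y ↔
    ∃ u v : Fin M.nodes, u.val = x ∧ v.val = y ∧ M.Edge u v := by
  constructor
  · rintro ⟨e, he, rfl, rfl⟩
    obtain ⟨u, a, p, v, h, rfl⟩ := mem_transList.1 he
    exact ⟨u, v, rfl, rfl, a, p, h⟩
  · rintro ⟨u, v, rfl, rfl, a, p, h⟩
    exact ⟨_, mem_transList.2 ⟨u, a, p, v, h, rfl⟩, rfl, rfl⟩

theorem reaches_transList_iff {u v : Fin M.nodes} :
    reaches M.transList u.val v.val = true ↔ M.LReach u v := by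
  rw [reaches_iff, reflTransGen_val_iff nEdge_transList, LReach]

theorem known_grow_transList_iff {u r : Fin M.nodes} :
    known r.val (grow M.transList r.val) u.val = true ↔ M.LReach u r := by
  rw [known_grow_iff, reflTransGen_val_iff nEdge_transList, LReach]

open Classical in
/-- The strategy given by a layered list. -/
noncomputable def strategy (M : Diagram Γ) (u : Fin M.nodes) : Option Γ.Act :=
  if h : ∃ a : Γ.Act, ∃ e ∈ grow M.transList M.final.val, e.1 = u.val ∧ e.2.1 = a.val then
    some h.choose
  else none

theorem strategy_eq_some_iff {u : Fin M.nodes} {a : Γ.Act} : M.strategy u = some a ↔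
    ∃ e ∈ grow M.transList M.final.val, e.1 = u.val ∧ e.2.1 = a.val := by
  unfold strategy
  split_ifs with h
  · obtain ⟨e, he, h₁, h₂⟩ := h.choose_spec
    rw [Option.some_inj]
    constructor
    · rintro rfl
      exact ⟨e, he, h₁, h₂⟩
    · rintro ⟨x, hx, h₃, h₄⟩
      obtain rfl := (layered_grow _ _).1.eq_of_fst_eq he hx (h₁.trans h₃.symm)
      exact Fin.ext (h₂.symm.trans h₄)
  · simp only [false_iff]
    exact fun h₁ => h ⟨a, h₁⟩

theorem isStrategy_strategy : M.IsStrategy M.strategy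
    fun u => depth (grow M.transList M.final.val) u.val := by
  have key : ∀ u a, M.strategy u = some a → ∃ p v, M.δ u a p = some v ∧
      depth (grow M.transList M.final.val) v.val < depth (grow M.transList M.final.val) u.val := by
    intro u a h
    obtain ⟨e, he, h₁, h₂⟩ := strategy_eq_some_iff.1 h
    obtain ⟨hl, hE⟩ := layered_grow M.transList M.final.val
    have hd := hl.depth_lt he
    obtain ⟨u', a', p, v, hv, rfl⟩ := mem_transList.1 (hE e he)
    obtain rfl := Fin.ext h₁
    obtain rfl := Fin.ext h₂
    exact ⟨p, v, hv, hd⟩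
  refine ⟨fun u a h => ?_, key⟩
  obtain ⟨p, v, hv, -⟩ := key u a h
  exact IsNegotiation.mem_out hv

theorem lReach_final_iff {u : Fin M.nodes} :
    M.LReach u M.final ↔ u = M.final ∨ (M.strategy u).isSome := by
  rw [← known_grow_transList_iff, known_iff, Fin.ext_iff]
  refine or_congr_right ⟨?_, ?_⟩
  · rintro ⟨e, he, h₁⟩
    obtain ⟨u', a, p, v, -, rfl⟩ := mem_transList.1 ((layered_grow _ _).2 e he)
    rw [strategy_eq_some_iff.2 ⟨_, he, h₁, rfl⟩]
    rfl
  · intro h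
    obtain ⟨a, ha⟩ := Option.isSome_iff_exists.1 h
    obtain ⟨e, he, h₁, -⟩ := strategy_eq_some_iff.1 ha
    exact ⟨e, he, h₁⟩

/-- The transitions of the strategy. -/
def stratList (M : Diagram Γ) : List Quad := strat M.transList (grow M.transList M.final.val)

theorem mem_stratList {e : Quad} : e ∈ M.stratList ↔
    ∃ (u : Fin M.nodes) (a : Γ.Act) (p : Γ.Proc) (v : Fin M.nodes),
      M.strategy u = some a ∧ M.δ u a p = some v ∧ e = (u.val, a.val, p.val, v.val) := by
  rw [stratList, mem_strat, mem_transList]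
  constructor
  · rintro ⟨⟨u, a, p, v, hv, rfl⟩, x, hx, h₁, h₂⟩
    exact ⟨u, a, p, v, strategy_eq_some_iff.2 ⟨x, hx, h₁, h₂⟩, hv, rfl⟩
  · rintro ⟨u, a, p, v, ha, hv, rfl⟩
    obtain ⟨x, hx, h₁, h₂⟩ := strategy_eq_some_iff.1 ha
    exact ⟨⟨u, a, p, v, hv, rfl⟩, x, hx, h₁, h₂⟩

theorem nEdge_stratList (x y : ℕ) : NEdge M.stratList x y ↔
    ∃ u v : Fin M.nodes, u.val = x ∧ v.val = y ∧ ∃ p, M.SNext M.strategy p u v := by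
  constructor
  · rintro ⟨e, he, rfl, rfl⟩
    obtain ⟨u, a, p, v, h, h₁, rfl⟩ := mem_stratList.1 he
    exact ⟨u, v, rfl, rfl, p, a, h, h₁⟩
  · rintro ⟨u, v, rfl, rfl, p, a, h, h₁⟩
    exact ⟨_, mem_stratList.2 ⟨u, a, p, v, h, h₁, rfl⟩, rfl, rfl⟩

theorem reaches_stratList_iff {u v : Fin M.nodes} :
    reaches M.stratList u.val v.val = true ↔ M.SReach M.strategy u v := by
  rw [reaches_iff, reflTransGen_val_iff nEdge_stratList, SReach]

theorem mem_within {n : Fin M.nodes} {e : Quad} : e ∈ within M.stratList n.val ↔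
    ∃ (u : Fin M.nodes) (a : Γ.Act) (p : Γ.Proc) (v : Fin M.nodes), M.SReach M.strategy n u ∧
      M.strategy u = some a ∧ M.δ u a p = some v ∧ e = (u.val, a.val, p.val, v.val) := by
  rw [within, List.mem_filter, mem_stratList]
  constructor
  · rintro ⟨⟨u, a, p, v, ha, hv, rfl⟩, h⟩
    exact ⟨u, a, p, v, reaches_stratList_iff.1 h, ha, hv, rfl⟩
  · rintro ⟨u, a, p, v, h, ha, hv, rfl⟩
    exact ⟨⟨u, a, p, v, ha, hv, rfl⟩, reaches_stratList_iff.2 h⟩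

theorem mem_canon (hM : M.IsNegotiation) {n : Fin M.nodes} {e : Quad} :
    e ∈ canon M.stratList n.val ↔
    ∃ (m : Fin M.nodes) (a : Γ.Act) (p : Γ.Proc), M.IsFirst M.strategy n p m ∧
      M.strategy m = some a ∧ e = (m.val, a.val, p.val, m.val) := by
  simp only [canon, List.mem_map, List.mem_filter, mem_within, Bool.not_eq_true',
    List.any_eq_false, Bool.and_eq_true, decide_eq_true_eq, not_and]
  constructor
  · rintro ⟨_, ⟨⟨m, a, p, v, h, ha, hv, rfl⟩, hno⟩, rfl⟩
    refine ⟨m, a, p, ⟨h, (hM.mem_dnode hv).1, by rw [ha]; rfl, ?_⟩, ha, rfl⟩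
    rintro u hu ⟨b, hb, hm⟩
    exact hno (u.val, b.val, p.val, m.val) ⟨u, b, p, m, hu, hb, hm, rfl⟩ rfl rfl
  · rintro ⟨m, a, p, ⟨h, hp, -, hno⟩, ha, rfl⟩
    obtain ⟨v, hv⟩ := hM.exists_of_mem_out (isStrategy_strategy.mem_out _ _ ha) hp
    refine ⟨_, ⟨⟨m, a, p, v, h, ha, hv, rfl⟩, ?_⟩, rfl⟩
    rintro _ ⟨u, b, q, x, hu, hb, hx, rfl⟩ h₁ h₂
    obtain rfl : q = p := Fin.ext h₁
    obtain rfl : x = m := Fin.ext h₂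
    exact hno u hu ⟨b, hb, hx⟩

/-- The entries of `canon` are not real moves: their last component is the first node of the process
itself, so that `loc` returns it. Processes without a first node get the default, which has to be
the final node. -/
theorem IsCanonical.rep (hM : M.IsNegotiation) {n : Fin M.nodes} {C : M.Config}
    (hC : M.IsCanonical M.strategy n C) : M.Rep M.final.val (canon M.stratList n.val) C := by
  intro p
  rw [← List.append_nil (canon M.stratList n.val)]
  by_cases hp : C p = M.final
  · rw [loc_append_of_notMem, loc_nil, hp]
    intro e he hep
    obtain ⟨m, a, q, h₁, -, rfl⟩ := (mem_canon hM).1 he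
    obtain rfl : q = p := Fin.ext hep
    obtain ⟨h₂, h₃⟩ := (hC q m).1 h₁
    exact h₃ (h₂.symm.trans hp)
  · have hf := (hC p (C p)).2 ⟨rfl, hp⟩
    obtain ⟨a, ha⟩ := Option.isSome_iff_exists.1 hf.2.2.1
    refine loc_append_of_mem (fun e he hep => ?_)
      ⟨_, (mem_canon hM).2 ⟨C p, a, p, hf, ha, rfl⟩, rfl⟩
    obtain ⟨m, b, q, h₁, -, rfl⟩ := (mem_canon hM).1 he
    obtain rfl : q = p := Fin.ext hep
    rw [((hC q m).1 h₁).1]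

theorem Rep.play_srun (hM : M.IsNegotiation) {d : ℕ} (L : List Quad)
    (hL : ∀ e ∈ L, e ∈ M.stratList) {h : List Quad} {C : M.Config} (hC : M.Rep d h C) :
    ∃ l C₁, M.SRun M.strategy C l C₁ ∧
      M.Rep d (L.foldl (fun h e => fire M.transList d h e.1 e.2.1) h) C₁ := by
  induction L generalizing h C with
  | nil => exact ⟨[], C, .nil _, hC⟩
  | cons e L ih =>
    have ih := fun {h C} => @ih (fun x hx => hL x (List.mem_cons_of_mem _ hx)) h C
    obtain ⟨u, a, p, v, ha, hv, rfl⟩ := mem_stratList.1 (hL _ List.mem_cons_self)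
    rw [List.foldl_cons]
    by_cases hu : M.Enabled C u
    · obtain ⟨l, C₁, h₁, h₂⟩ := ih (hC.fire_of_enabled hM (IsNegotiation.mem_out hv) hu)
      exact ⟨_, C₁, .cons hu ha h₁, h₂⟩
    · rw [hC.fire_of_not_enabled hM (IsNegotiation.mem_out hv) hu]
      exact ih hC

/-- By confluence, each executed action shortens the remaining run to success. If a listed node is
enabled at the start of the pass, then either something is executed before its turn or it is
executed itself. -/
theorem Rep.play_length (hM : M.IsNegotiation) {d : ℕ} (L : List Quad)
    (hL : ∀ e ∈ L, e ∈ M.stratList) {h : List Quad} {C : M.Config} (hC : M.Rep d h C)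
    {l : List (Fin M.nodes)} (hl : M.SRun M.strategy C l M.finalConfig) :
    ∃ l₁ C₁, M.SRun M.strategy C₁ l₁ M.finalConfig ∧
      M.Rep d (L.foldl (fun h e => fire M.transList d h e.1 e.2.1) h) C₁ ∧
      l₁.length ≤ l.length ∧
      ((∃ e ∈ L, ∃ u : Fin M.nodes, u.val = e.1 ∧ M.Enabled C u) → l₁.length + 1 ≤ l.length) := by
  induction L generalizing h C l with
  | nil => exact ⟨l, C, hl, hC, le_rfl, by simp⟩
  | cons e L ih =>
    have ih := fun {h C} => @ih (fun x hx => hL x (List.mem_cons_of_mem _ hx)) h C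
    obtain ⟨u, a, p, v, ha, hv, rfl⟩ := mem_stratList.1 (hL _ List.mem_cons_self)
    rw [List.foldl_cons]
    by_cases hu : M.Enabled C u
    · obtain ⟨l₁, h₁, h₂⟩ := hl.diamond hM isStrategy_strategy rfl hu ha
      obtain ⟨l₂, C₁, h₃, h₄, h₅, -⟩ :=
        ih (hC.fire_of_enabled hM (IsNegotiation.mem_out hv) hu) h₁
      exact ⟨l₂, C₁, h₃, h₄, by omega, fun _ => by omega⟩
    · rw [hC.fire_of_not_enabled hM (IsNegotiation.mem_out hv) hu]
      obtain ⟨l₂, C₁, h₃, h₄, h₅, h₆⟩ := ih hC hl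
      refine ⟨l₂, C₁, h₃, h₄, h₅, ?_⟩
      rintro ⟨e, he, x, hx, hxe⟩
      rcases List.mem_cons.1 he with rfl | he
      · exact absurd (Fin.ext hx ▸ hxe) hu
      · exact h₆ ⟨e, he, x, hx, hxe⟩

/-- Only the length of `K` matters: each round shortens the remaining run unless it is already
empty. -/
theorem Rep.play_rounds (hM : M.IsNegotiation) {d : ℕ} (K : List (Quad × Quad)) {h : List Quad}
    {C : M.Config} (hC : M.Rep d h C) {l : List (Fin M.nodes)}
    (hl : M.SRun M.strategy C l M.finalConfig) (hK : l.length ≤ K.length) :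
    M.Rep d ((K.flatMap fun _ => M.stratList).foldl
      (fun h e => fire M.transList d h e.1 e.2.1) h) M.finalConfig := by
  induction K generalizing h C l with
  | nil =>
    obtain rfl : l = [] := List.length_eq_zero_iff.1 (by simpa using hK)
    generalize M.finalConfig = D at hl
    cases hl
    exact hC
  | cons k K ih =>
    rw [List.flatMap_cons, List.foldl_append]
    obtain ⟨l₁, C₁, h₁, h₂, h₃, h₄⟩ := hC.play_length hM M.stratList (fun _ h => h) hl
    refine ih h₂ h₁ ?_
    rw [List.length_cons] at hK
    cases l with
    | nil => simp only [List.length_nil] at h₃; omega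
    | cons u l =>
      have : l₁.length + 1 ≤ (u :: l).length := by
        generalize M.finalConfig = D at hl
        cases hl with
        | cons hu ha _ =>
          obtain ⟨p, v, hv, -⟩ := isStrategy_strategy.desc _ _ ha
          exact h₄ ⟨_, mem_stratList.2 ⟨u, _, p, v, ha, hv, rfl⟩, u, rfl, hu⟩
      omega

theorem SRun.length_le_transList (hM : M.IsNegotiation) {C C₁ : M.Config}
    {l : List (Fin M.nodes)} (hl : M.SRun M.strategy C l C₁) :
    l.length ≤ M.transList.length * M.transList.length := by
  obtain ⟨h₁, h₂⟩ := layered_grow M.transList M.final.val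
  have h₃ : (grow M.transList M.final.val).length ≤ M.transList.length :=
    (h₁.nodup.subperm h₂).length_le
  exact (hl.length_le hM isStrategy_strategy).trans
    ((sum_depth_le _ _).trans (Nat.mul_le_mul h₃ h₃))

theorem Rep.isGood_iff (hM : M.IsNegotiation) {d : ℕ} {h : List Quad} {C : M.Config}
    (hC : M.Rep d h C) :
    isGood Γ.procs M.final.val M.transList M.stratList d h = true ↔ M.Good M.strategy C := by
  -- The nested loops are rewritten as one loop over pairs of transitions, which only count the
  -- rounds.
  have hplay : play M.transList M.stratList d h =
      ((M.transList.flatMap fun x => M.transList.map fun y => (x, y)).flatMap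
        fun _ => M.stratList).foldl (fun h e => fire M.transList d h e.1 e.2.1) h := by
    rw [play, List.flatMap_assoc]
    simp only [List.flatMap_map]
  rw [isGood]
  constructor
  · intro hall
    obtain ⟨l, C₁, h₁, h₂⟩ := hC.play_srun hM
      (M.transList.flatMap fun _ => M.transList.flatMap fun _ => M.stratList) (fun e he => by
        simp only [List.mem_flatMap] at he
        obtain ⟨_, _, _, _, h⟩ := he
        exact h)
    rw [play, h₂.allAt_iff] at hall
    subst hall
    exact ⟨l, h₁⟩
  · rintro ⟨l, hl⟩
    rw [hplay]
    refine ((hC.play_rounds hM _ hl ?_).allAt_iff M.final).2 rfl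
    refine (hl.length_le_transList hM).trans (le_of_eq ?_)
    simp

/-- One direction is `sound_of_good`. For the other, a sound diagram is `Good` at all reachable
configurations. -/
theorem soundTest_iff (hM : M.IsNegotiation) :
    soundTest Γ.procs M.init.val M.final.val M.transList = true ↔ M.Sound := by
  have hσ := isStrategy_strategy (M := M)
  have hF : strat M.transList (grow M.transList M.final.val) = M.stratList := rfl
  have hinit : (decide (M.init.val = M.final.val) ||
      known M.final.val (grow M.transList M.final.val) M.init.val) = true ↔
      M.LReach M.init M.final := by
    rw [Bool.or_eq_true, known_grow_transList_iff, decide_eq_true_eq]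
    constructor
    · rintro (h | h)
      · rw [Fin.ext h]; exact .refl
      · exact h
    · exact .inr
  rw [soundTest, hF, Bool.and_eq_true, Bool.and_eq_true, Bool.and_eq_true, hinit,
    Rep.init.isGood_iff hM, List.all_eq_true, List.all_eq_true]
  constructor
  · rintro ⟨⟨⟨h₁, h₂⟩, h₃⟩, h₄⟩
    refine sound_of_good hM hσ (fun u hu => ?_) h₃ fun n a C hn ha hen hC => ?_
    · rw [← lReach_final_iff]
      rcases Relation.ReflTransGen.cases_tail hu with rfl | ⟨x, hx, a, p, hp⟩
      · exact h₁
      · have := h₂ _ (mem_transList.2 ⟨x, a, p, u, hp, rfl⟩)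
        rw [Bool.or_eq_true, Bool.not_eq_true', known_grow_transList_iff,
          ← Bool.not_eq_true, reaches_transList_iff] at this
        exact this.resolve_left (not_not.2 hx)
    · obtain ⟨p, hp⟩ := hM.dnode_nonempty n
      obtain ⟨v, hv⟩ := hM.exists_of_mem_out ha hp
      have := h₄ _ (mem_transList.2 ⟨n, a, p, v, hv, rfl⟩)
      rw [Bool.or_eq_true, Bool.not_eq_true', ← Bool.not_eq_true, reaches_transList_iff] at this
      have hgood := this.resolve_left (not_not.2 hn)
      exact ((hC.rep hM).fire_of_enabled hM ha hen).isGood_iff hM |>.1 hgood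
  · intro hS
    have hd : ∀ u, M.LReach M.init u → M.LReach u M.final →
        u = M.final ∨ (M.strategy u).isSome := fun u _ h => lReach_final_iff.1 h
    refine ⟨⟨⟨hS.lReach_final hM .refl, fun e he => ?_⟩, hS.good hM hσ hd .init⟩,
      fun e he => ?_⟩
    · obtain ⟨u, a, p, v, hv, rfl⟩ := mem_transList.1 he
      rw [Bool.or_eq_true, Bool.not_eq_true', known_grow_transList_iff,
          ← Bool.not_eq_true, reaches_transList_iff, or_iff_not_imp_left, not_not]
      exact fun h => hS.lReach_final hM (h.tail ⟨a, p, hv⟩)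
    · obtain ⟨u, a, p, v, hv, rfl⟩ := mem_transList.1 he
      rw [Bool.or_eq_true, Bool.not_eq_true', ← Bool.not_eq_true, reaches_transList_iff,
        or_iff_not_imp_left, not_not]
      intro hu
      have ha := IsNegotiation.mem_out hv
      -- The test uses the list `canon` without knowing that it describes a reachable configuration
      -- with this node enabled; soundness guarantees it.
      obtain ⟨C, hC, hen, hcan⟩ := hS.exists_isCanonical hM hσ hd hu (by
        rintro rfl; exact hM.out_final' ha)
      exact (((hcan.rep hM).fire_of_enabled hM ha hen).isGood_iff hM).2
        (hS.good hM hσ hd (hC.move hM hen ha))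

end Diagram

/-! ## Encodings of diagrams and tables -/

theorem encList_eq {α β : Type} [TreeEnc β] {f : α → DTree} {g : α → β}
    (h : ∀ a, f a = enc (g a)) (l : List α) : encList f l = enc (l.map g) := by
  induction l with
  | nil => rfl
  | cons a l ih => rw [encList, ih, List.map_cons, enc_cons, h]

/-- A word as a list of numbers. -/
def natWord {Γ : DistAlphabet} (w : Γ.Word) : List ℕ := w.map Fin.val

theorem encWord_eq {Γ : DistAlphabet} (w : Γ.Word) : encWord w = enc (natWord w) :=
  encList_eq (g := Fin.val) (fun _ => rfl) w

/-- A set as a list of numbers. -/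
def natSet {n : ℕ} (s : Finset (Fin n)) : List ℕ :=
  ((List.finRange n).filter fun i => decide (i ∈ s)).map Fin.val

theorem mem_natSet {n : ℕ} {s : Finset (Fin n)} {i : Fin n} : i.val ∈ natSet s ↔ i ∈ s := by
  simp only [natSet, List.mem_map, List.mem_filter, List.mem_finRange, true_and,
    decide_eq_true_eq]
  constructor
  · rintro ⟨j, hj, h⟩
    rwa [← Fin.ext h]
  · exact fun h => ⟨i, h, rfl⟩

theorem encFinset_eq {n : ℕ} (s : Finset (Fin n)) : encFinset s = enc (natSet s) :=
  encList_eq (g := Fin.val) (fun _ => rfl) _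

/-- The graph of a partial function as a list. -/
def graphList {Γ : DistAlphabet} {n : ℕ} {β γ : Type} (g : β → γ)
    (F : Fin n → Γ.Act → Γ.Proc → Option β) : List (ℕ × ℕ × ℕ × γ) :=
  (List.finRange n).flatMap fun u =>
    (List.finRange Γ.acts).flatMap fun a =>
      (List.finRange Γ.procs).filterMap fun p =>
        (F u a p).map fun y => (u.val, a.val, p.val, g y)

theorem mem_graphList {Γ : DistAlphabet} {n : ℕ} {β γ : Type} {g : β → γ}
    {F : Fin n → Γ.Act → Γ.Proc → Option β} {e : ℕ × ℕ × ℕ × γ} : e ∈ graphList g F ↔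
    ∃ u a p y, F u a p = some y ∧ e = (u.val, a.val, p.val, g y) := by
  simp only [graphList, List.mem_flatMap, List.mem_filterMap, List.mem_finRange, true_and,
    Option.map_eq_some_iff]
  constructor
  · rintro ⟨u, a, p, v, h, rfl⟩
    exact ⟨u, a, p, v, h, rfl⟩
  · rintro ⟨u, a, p, v, h, rfl⟩
    exact ⟨u, a, p, v, h, rfl⟩

theorem encPartial_eq {Γ : DistAlphabet} {n : ℕ} {β γ : Type} [TreeEnc γ] {f : β → DTree}
    {g : β → γ} (h : ∀ b, f b = enc (g b)) (F : Fin n → Γ.Act → Γ.Proc → Option β) :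
    encPartial f F = enc (graphList g F) := by
  unfold encPartial graphList
  change (enc (_ : List DTree) : DTree) = _
  have : ∀ l : List (ℕ × ℕ × ℕ × γ), enc (l.map fun e => enc e) = enc l := by
    intro l
    induction l with
    | nil => rfl
    | cons e l ih => rw [List.map_cons, enc_cons, enc_cons, ih]; rfl
  rw [← this]
  simp only [List.map_flatMap, List.map_filterMap, Option.map_map]
  congr 1
  refine List.flatMap_congr fun u _ => List.flatMap_congr fun a _ => ?_
  congr 1
  funext p
  cases F u a p with
  | none => rfl
  | some y => exact congrArg some (by dsimp only; rw [h]; rfl)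

/-- The domains of the actions as lists of numbers. -/
def domList (Γ : DistAlphabet) : List (List ℕ) :=
  (List.finRange Γ.acts).map fun a => natSet (Γ.dom a)

/-- The data that a diagram is encoded by. -/
def rawDiagram {Γ : DistAlphabet} (M : Diagram Γ) : RawDiagram :=
  ((Γ.procs, domList Γ), (List.finRange M.nodes).map (fun n => natSet (M.dnode n)),
    M.transList, M.init.val, M.final.val)

theorem encDiagram_eq {Γ : DistAlphabet} (M : Diagram Γ) :
    encDiagram M = enc (rawDiagram M) := by
  unfold encDiagram encAlphabet
  rw [encList_eq (fun a => encFinset_eq (Γ.dom a)), encList_eq (fun n => encFinset_eq (M.dnode n)),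
    encPartial_eq (f := encFin) (g := Fin.val) (fun _ => rfl)]
  rfl

/-- The encoded data of a table. -/
abbrev RawTable : Type := List (List ℕ) × List (List ℕ) × List (ℕ × ℕ × ℕ × List ℕ)

/-- The data that a table is encoded by. -/
def rawTable {Γ : DistAlphabet} (H : Table Γ) : RawTable :=
  ((List.finRange H.numQ).map (fun u => natWord (H.Q u)), H.T.map natWord,
    graphList natWord H.S)

theorem encTable_eq {Γ : DistAlphabet} (H : Table Γ) : encTable H = enc (rawTable H) := by
  unfold encTable
  rw [encList_eq (fun u => encWord_eq (H.Q u)), encList_eq encWord_eq,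
    encPartial_eq encWord_eq]
  rfl

theorem encNat_injective : Function.Injective encNat := by
  intro m
  induction m with
  | zero => intro n h; cases n with
    | zero => rfl
    | succ n => cases h
  | succ m ih => intro n h; cases n with
    | zero => cases h
    | succ n => injection h with _ h; rw [ih h]

theorem encWord_injective {Γ : DistAlphabet} : Function.Injective (encWord (Γ := Γ)) := by
  intro v
  induction v with
  | nil => intro w h; cases w with
    | nil => rfl
    | cons a w => cases h
  | cons a v ih => intro w h; cases w with
    | nil => cases h
    | cons b w =>
      injection h with h₁ h₂
      rw [ih h₂, Fin.ext (encNat_injective h₁)]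

theorem membership_encWord {Γ : DistAlphabet} {L : Set Γ.Word} {w : Γ.Word} :
    membership L (encWord w) = true ↔ w ∈ L := by
  unfold membership
  simp only [decide_eq_true_eq]
  constructor
  · rintro ⟨v, hv, h⟩
    rwa [encWord_injective h]
  · exact fun h => ⟨w, h, rfl⟩

/-! ## Traces -/

namespace DistAlphabet

variable {Γ : DistAlphabet}

/-- Each letter depends on an earlier letter or shares a process with `D`. -/
def Chain (D : Finset Γ.Proc) : Γ.Word → Prop
  | [] => True
  | c :: w => ¬ Disjoint (Γ.dom c) D ∧ Chain (D ∪ Γ.dom c) w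

theorem Chain.mono {D D₁ : Finset Γ.Proc} {w : Γ.Word} (h : Chain D w) (hD : D ⊆ D₁) :
    Chain D₁ w := by
  induction w generalizing D D₁ with
  | nil => trivial
  | cons c w ih =>
    exact ⟨fun hd => h.1 (hd.mono_right hD), ih h.2 (Finset.union_subset_union_left hD)⟩

theorem Chain.append {D : Finset Γ.Proc} {w v : Γ.Word} (h : Chain D w) (hv : Chain D v) :
    Chain D (w ++ v) := by
  induction w generalizing D with
  | nil => exact hv
  | cons c w ih => exact ⟨h.1, ih h.2 (hv.mono Finset.subset_union_left)⟩

theorem TraceEq.refl (w : Γ.Word) : Γ.TraceEq w w := Relation.ReflTransGen.refl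

theorem TraceEq.trans {u v w : Γ.Word} (h : Γ.TraceEq u v) (h₁ : Γ.TraceEq v w) :
    Γ.TraceEq u w := Relation.ReflTransGen.trans h h₁

theorem TraceEq.append_left {v w : Γ.Word} (u : Γ.Word) (h : Γ.TraceEq v w) :
    Γ.TraceEq (u ++ v) (u ++ w) := by
  refine h.lift (fun x => u ++ x) ?_
  rintro _ _ ⟨x, y, a, b, hd, rfl, rfl⟩
  exact ⟨u ++ x, y, a, b, hd, by simp, by simp⟩

theorem TraceEq.cons {v w : Γ.Word} (a : Γ.Act) (h : Γ.TraceEq v w) :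
    Γ.TraceEq (a :: v) (a :: w) := h.append_left [a]

theorem TraceEq.swap {a b : Γ.Act} (h : Disjoint (Γ.dom a) (Γ.dom b)) (w : Γ.Word) :
    Γ.TraceEq (a :: b :: w) (b :: a :: w) :=
  .single ⟨[], w, a, b, h, rfl, rfl⟩

theorem traceEq_front {x : Γ.Act} {y : Γ.Word} (h : ∀ c ∈ y, Disjoint (Γ.dom c) (Γ.dom x))
    (z : Γ.Word) : Γ.TraceEq (y ++ x :: z) (x :: (y ++ z)) := by
  induction y with
  | nil => exact .refl _
  | cons c y ih =>
    exact ((ih fun d hd => h d (List.mem_cons_of_mem _ hd)).cons c).trans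
      (.swap (h c List.mem_cons_self) _)

/-- The hypothesis says that every letter that can be moved to the front meets `D`. A letter that
could be moved up to a new letter `c` and is independent of it can be moved past it. -/
theorem chain_of_front {D : Finset Γ.Proc} {w : Γ.Word}
    (h : ∀ y x z, w = y ++ x :: z → (∀ c ∈ y, Disjoint (Γ.dom c) (Γ.dom x)) →
      ¬ Disjoint (Γ.dom x) D) : Chain D w := by
  induction w generalizing D with
  | nil => trivial
  | cons c w ih =>
    refine ⟨h [] c w rfl (by simp), ih fun y x z hw hy hd => ?_⟩
    rw [Finset.disjoint_union_right] at hd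
    refine h (c :: y) x z (by rw [hw]; rfl) (fun d hd' => ?_) hd.1
    rcases List.mem_cons.1 hd' with rfl | hd'
    · exact hd.2.symm
    · exact hy d hd'

theorem Chain.swap {D : Finset Γ.Proc} {y z : Γ.Word} {a b : Γ.Act}
    (hd : Disjoint (Γ.dom a) (Γ.dom b)) (h : Chain D (y ++ a :: b :: z)) :
    Chain D (y ++ b :: a :: z) := by
  induction y generalizing D with
  | nil =>
    obtain ⟨h₁, h₂, h₃⟩ := h
    rw [Finset.disjoint_union_right, not_and_or] at h₂
    refine ⟨h₂.resolve_right (not_not.2 hd.symm), ?_, ?_⟩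
    · exact fun h => h₁ (Finset.disjoint_union_right.1 h).1
    · rwa [Finset.union_right_comm]
  | cons c y ih => exact ⟨h.1, ih h.2⟩

theorem Chain.traceEq {b : Γ.Act} {w v : Γ.Word} (h : Chain (Γ.dom b) w)
    (hv : Γ.TraceEq (b :: w) v) : ∃ w₁, v = b :: w₁ ∧ Chain (Γ.dom b) w₁ := by
  induction hv with
  | refl => exact ⟨w, rfl, h⟩
  | tail _ hs ih =>
    obtain ⟨w₁, rfl, hw⟩ := ih
    obtain ⟨y, z, a, c, hd, h₁, rfl⟩ := hs
    cases y with
    | nil =>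
      injection h₁ with h₁ h₂
      subst h₁ h₂
      exact absurd hd.symm hw.1
    | cons x y =>
      injection h₁ with h₁ h₂
      subst h₁ h₂
      exact ⟨_, rfl, hw.swap hd⟩

/-- A letter that depends neither on `b` nor on any earlier letter could be moved to the front.
Conversely, the chain condition is invariant under swaps, and no swap involves `b`. -/
theorem isMin_iff {t : Γ.Word} {b : Γ.Act} :
    Γ.IsMin t b ↔ ∃ w, t = b :: w ∧ Chain (Γ.dom b) w := by
  constructor
  · intro h
    obtain ⟨w, rfl⟩ := h t (.refl _)
    refine ⟨w, rfl, chain_of_front ?_⟩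
    rintro y x z rfl hy hd
    obtain ⟨v, hv⟩ := h _ (((traceEq_front hy z).cons b).trans (.swap hd.symm _))
    injection hv with hv
    subst hv
    obtain ⟨p, hp⟩ := Γ.dom_nonempty x
    exact Finset.disjoint_left.1 hd hp hp
  · rintro ⟨w, rfl, hw⟩ v hv
    obtain ⟨w₁, h, -⟩ := hw.traceEq hv
    exact ⟨w₁, h⟩

theorem isMin_cons_iff {t : Γ.Word} {b c : Γ.Act} :
    Γ.IsMin (b :: t) c ↔ b = c ∧ Chain (Γ.dom b) t := by
  rw [isMin_iff]
  constructor
  · rintro ⟨w, h, hw⟩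
    injection h with h₁ h₂
    subst h₁ h₂
    exact ⟨rfl, hw⟩
  · rintro ⟨rfl, h⟩
    exact ⟨t, rfl, h⟩

theorem not_isMin_nil {b : Γ.Act} : ¬ Γ.IsMin [] b := by
  rw [isMin_iff]
  rintro ⟨w, h, -⟩
  cases h

theorem EquivT.symm {L : Set Γ.Word} {T : List Γ.Word} {x y : Γ.Word} (h : Γ.EquivT L T x y) :
    Γ.EquivT L T y x := fun t ht => (h t ht).symm

theorem EquivT.trans {L : Set Γ.Word} {T : List Γ.Word} {x y z : Γ.Word}
    (h : Γ.EquivT L T x y) (h₁ : Γ.EquivT L T y z) : Γ.EquivT L T x z :=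
  fun t ht => (h t ht).trans (h₁ t ht)

end DistAlphabet

/-! ## Executions of sound negotiations -/

namespace Diagram

open DistAlphabet

variable {Γ : DistAlphabet} {M : Diagram Γ}

theorem exec_nil_iff {C C₁ : M.Config} : M.Exec C [] C₁ ↔ C = C₁ := by
  constructor
  · intro h; cases h; rfl
  · rintro rfl; exact .nil _

theorem exec_cons_iff (hM : M.IsNegotiation) {C C₁ : M.Config} {a : Γ.Act} {w : Γ.Word} :
    M.Exec C (a :: w) C₁ ↔ ∃ u, M.Enabled C u ∧ a ∈ M.out u ∧ M.Exec (M.move C u a) w C₁ := by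
  constructor
  · intro h
    cases h with
    | cons hs h =>
      obtain ⟨u, hu, ha, rfl⟩ := (step_iff hM).1 hs
      exact ⟨u, hu, ha, h⟩
  · rintro ⟨u, hu, ha, h⟩
    exact .cons ((step_iff hM).2 ⟨u, hu, ha, rfl⟩) h

theorem exec_append_iff (hM : M.IsNegotiation) {C C₁ : M.Config} {v w : Γ.Word} :
    M.Exec C (v ++ w) C₁ ↔ ∃ C₂, M.Exec C v C₂ ∧ M.Exec C₂ w C₁ := by
  constructor
  · induction v generalizing C with
    | nil => exact fun h => ⟨C, .nil _, h⟩
    | cons a v ih =>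
      intro h
      obtain ⟨u, hu, ha, h⟩ := (exec_cons_iff hM).1 h
      obtain ⟨C₂, h₁, h₂⟩ := ih h
      exact ⟨C₂, (exec_cons_iff hM).2 ⟨u, hu, ha, h₁⟩, h₂⟩
  · rintro ⟨C₂, h₁, h₂⟩
    exact h₁.append h₂

theorem node_unique (hM : M.IsNegotiation) {C : M.Config} {a : Γ.Act} {u v : Fin M.nodes}
    (hu : M.Enabled C u) (ha : a ∈ M.out u) (hv : M.Enabled C v) (hb : a ∈ M.out v) :
    u = v := by
  obtain ⟨p, hp⟩ := Γ.dom_nonempty a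
  rw [← hu p (by rwa [hM.dnode_eq_of_mem_out ha]), hv p (by rwa [hM.dnode_eq_of_mem_out hb])]

theorem Exec.unique (hM : M.IsNegotiation) {C C₁ C₂ : M.Config} {w : Γ.Word}
    (h₁ : M.Exec C w C₁) (h₂ : M.Exec C w C₂) : C₁ = C₂ := by
  induction w generalizing C with
  | nil => rw [← exec_nil_iff.1 h₁, exec_nil_iff.1 h₂]
  | cons a w ih =>
    obtain ⟨u, hu, ha, h₁⟩ := (exec_cons_iff hM).1 h₁
    obtain ⟨v, hv, hb, h₂⟩ := (exec_cons_iff hM).1 h₂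
    obtain rfl := node_unique hM hu ha hv hb
    exact ih h₁ h₂

theorem Exec.swap (hM : M.IsNegotiation) {C C₁ : M.Config} {w v : Γ.Word} (hs : Γ.Swap w v)
    (h : M.Exec C w C₁) : M.Exec C v C₁ := by
  obtain ⟨x, y, a, b, hd, rfl, rfl⟩ := hs
  obtain ⟨C₂, h₁, h₂⟩ := (exec_append_iff hM).1 h
  refine (exec_append_iff hM).2 ⟨C₂, h₁, ?_⟩
  obtain ⟨u, hu, ha, h₂⟩ := (exec_cons_iff hM).1 h₂
  obtain ⟨n, hn, hb, h₂⟩ := (exec_cons_iff hM).1 h₂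
  rw [← hM.dnode_eq_of_mem_out ha, ← hM.dnode_eq_of_mem_out hb] at hd
  have hn' : M.Enabled C₂ n := fun p hp => by
    have := hn p hp
    rwa [move_of_notMem hM (Finset.disjoint_right.1 hd hp)] at this
  have hne : n ≠ u := by
    rintro rfl
    obtain ⟨p, hp⟩ := hM.dnode_nonempty n
    exact Finset.disjoint_left.1 hd hp hp
  rw [move_comm hM hd] at h₂
  exact (exec_cons_iff hM).2 ⟨n, hn', hb, (exec_cons_iff hM).2 ⟨u, hn'.move hM hu hne, ha, h₂⟩⟩

theorem Exec.traceEq (hM : M.IsNegotiation) {C C₁ : M.Config} {w v : Γ.Word}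
    (hs : Γ.TraceEq w v) (h : M.Exec C w C₁) : M.Exec C v C₁ := by
  induction hs with
  | refl => exact h
  | tail _ hs ih => exact ih.swap hM hs

theorem not_exec_final (hM : M.IsNegotiation) {C : M.Config} {a : Γ.Act} {w : Γ.Word} :
    ¬ M.Exec M.finalConfig (a :: w) C := by
  intro h
  obtain ⟨u, hu, ha, -⟩ := (exec_cons_iff hM).1 h
  rw [hu.eq_final hM] at ha
  exact hM.out_final' ha

/-- `n` is the only enabled node of `C` at which something can be executed. -/
def Only (M : Diagram Γ) (C : M.Config) (n : Fin M.nodes) : Prop :=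
  M.Enabled C n ∧ ∀ u, M.Enabled C u → (M.out u).Nonempty → u = n

/-- By soundness the strategy leads from such a configuration to success, and `n` is its only
enabled node; so the configuration is canonical for `n`. -/
theorem Sound.only_unique (hM : M.IsNegotiation) (hS : M.Sound) {C C₁ : M.Config}
    (hC : M.Reachable C) (hC₁ : M.Reachable C₁) {n : Fin M.nodes} (hn : n ≠ M.final)
    (h : M.Only C n) (h₁ : M.Only C₁ n) : C = C₁ := by
  have hσ := isStrategy_strategy (M := M)
  have hd : ∀ u, M.LReach M.init u → M.LReach u M.final →
      u = M.final ∨ (M.strategy u).isSome := fun u _ h => lReach_final_iff.1 h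
  have key : ∀ C, M.Reachable C → M.Only C n → M.IsCanonical M.strategy n C := by
    intro C hC h
    obtain ⟨l, hl⟩ := hS.good hM hσ hd hC
    obtain ⟨p, hp⟩ := hM.dnode_nonempty n
    have hr := hC.lReach hM p
    rw [h.1 p hp] at hr
    refine hl.isCanonical hM hσ rfl h.1 ((hd n hr (hS.lReach_final hM hr)).resolve_left hn) ?_
    intro u hu he
    obtain ⟨a, ha⟩ := Option.isSome_iff_exists.1 hu
    exact h.2 u he ⟨a, hσ.mem_out _ _ ha⟩
  exact (key C hC h).unique (key C₁ hC₁ h₁)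

/-- A node apart from `D` is never executed, as each letter of a chain meets the processes collected
so far. It would therefore stay enabled up to the final configuration, where no node with an
outgoing action is enabled. -/
theorem Exec.not_enabled_of_chain (hM : M.IsNegotiation) {C : M.Config} {w : Γ.Word}
    (h : M.Exec C w M.finalConfig) {D : Finset Γ.Proc} (hw : Chain D w) {u : Fin M.nodes}
    (hu : M.Enabled C u) (ho : (M.out u).Nonempty) (hD : Disjoint (M.dnode u) D) : False := by
  induction w generalizing C D with
  | nil =>
    rw [exec_nil_iff.1 h] at hu
    obtain ⟨a, ha⟩ := ho
    rw [hu.eq_final hM] at ha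
    exact hM.out_final' ha
  | cons c w ih =>
    obtain ⟨x, hx, hc, h⟩ := (exec_cons_iff hM).1 h
    have hxu : x ≠ u := by
      rintro rfl
      rw [hM.dnode_eq_of_mem_out hc] at hD
      exact hw.1 hD
    refine ih h hw.2 (hx.move hM hu hxu) (Finset.disjoint_union_right.2 ⟨hD, ?_⟩)
    rw [← hM.dnode_eq_of_mem_out hc]
    exact (disjoint_of_enabled hx hu hxu).symm

/-- Any other active node would be disjoint from the node of `b` and would be missed by the chain
that follows `b`. -/
theorem Exec.only_of_isMin (hM : M.IsNegotiation) {C : M.Config} {t : Γ.Word} {b : Γ.Act}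
    (h : M.Exec C t M.finalConfig) (hb : Γ.IsMin t b) :
    ∃ n, M.Only C n ∧ b ∈ M.out n := by
  obtain ⟨w, rfl, hw⟩ := isMin_iff.1 hb
  obtain ⟨n, hn, ha, h⟩ := (exec_cons_iff hM).1 h
  refine ⟨n, ⟨hn, fun u hu ho => ?_⟩, ha⟩
  by_contra hne
  have hdis := disjoint_of_enabled hu hn hne
  refine h.not_enabled_of_chain hM hw (hn.move hM hu (Ne.symm hne)) ho ?_
  rwa [← hM.dnode_eq_of_mem_out ha]

/-- `p` is at the only enabled node, or all processes are at the final node. -/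
def Tidy (M : Diagram Γ) (p : Γ.Proc) (C : M.Config) : Prop :=
  C = M.finalConfig ∨ C p ≠ M.final ∧ p ∈ M.dnode (C p) ∧ M.Only C (C p)

/-- `t` is empty, or `p` takes part in its least action. -/
def _root_.DistAlphabet.Starts (Γ : DistAlphabet) (p : Γ.Proc) (t : Γ.Word) : Prop :=
  t ≠ [] → ∃ a, Γ.IsMin t a ∧ p ∈ Γ.dom a

theorem Exec.tidy (hM : M.IsNegotiation) {C : M.Config} {t : Γ.Word} {p : Γ.Proc}
    (h : M.Exec C t M.finalConfig) (ht : Γ.Starts p t) : M.Tidy p C := by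
  cases t with
  | nil => exact .inl (exec_nil_iff.1 h)
  | cons b t =>
    obtain ⟨a, ha, hp⟩ := ht (by simp)
    obtain ⟨n, hn, hb⟩ := h.only_of_isMin hM ha
    have hpn : p ∈ M.dnode n := by rwa [hM.dnode_eq_of_mem_out hb]
    have := hn.1 p hpn
    refine .inr ?_
    rw [this]
    refine ⟨?_, hpn, hn⟩
    rintro rfl
    exact hM.out_final' hb

theorem Sound.tidy_unique (hM : M.IsNegotiation) (hS : M.Sound) {C C₁ : M.Config}
    (hC : M.Reachable C) (hC₁ : M.Reachable C₁) {p : Γ.Proc} (h : M.Tidy p C)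
    (h₁ : M.Tidy p C₁) (hp : C p = C₁ p) : C = C₁ := by
  rcases h with rfl | ⟨hf, -, ho⟩
  · rcases h₁ with rfl | ⟨hf, -, -⟩
    · rfl
    · exact absurd hp.symm hf
  · rcases h₁ with rfl | ⟨-, -, ho₁⟩
    · exact absurd hp hf
    · rw [← hp] at ho₁
      exact hS.only_unique hM hC hC₁ hf ho ho₁

theorem Exec.eq_of_notMem (hM : M.IsNegotiation) {C C₁ : M.Config} {w : Γ.Word}
    (h : M.Exec C w C₁) {p : Γ.Proc} (hp : ∀ c ∈ w, p ∉ Γ.dom c) : C₁ p = C p := by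
  induction w generalizing C with
  | nil => rw [exec_nil_iff.1 h]
  | cons c w ih =>
    obtain ⟨u, hu, hc, h⟩ := (exec_cons_iff hM).1 h
    rw [ih h fun d hd => hp d (List.mem_cons_of_mem _ hd), move_of_notMem hM]
    rw [hM.dnode_eq_of_mem_out hc]
    exact hp c List.mem_cons_self

theorem Exec.step (hM : M.IsNegotiation) {C C₁ : M.Config} {s : Γ.Word} {b : Γ.Act}
    {p : Γ.Proc} (h : M.Exec C s C₁) (hs : Γ.IsStep b p s) :
    M.Enabled C (C p) ∧ b ∈ M.out (C p) ∧ M.δ (C p) b p = some (C₁ p) := by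
  obtain ⟨hp, -, s₁, rfl, hs⟩ := hs
  obtain ⟨u, hu, hb, h⟩ := (exec_cons_iff hM).1 h
  have hpu : p ∈ M.dnode u := by rwa [hM.dnode_eq_of_mem_out hb]
  have := hu p hpu
  rw [this]
  refine ⟨hu, hb, ?_⟩
  obtain ⟨v, hv⟩ := hM.exists_of_mem_out hb hpu
  rw [h.eq_of_notMem hM hs, move_of_some hv, hv]

/-- Both steps take `p` to the same node, and the tests make both configurations tidy for `p`; so
the configurations coincide. The step read off a word can thus be replaced by the stored support. -/
theorem Sound.step_congr (hM : M.IsNegotiation) (hS : M.Sound) {x s s₁ t t₁ : Γ.Word}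
    {b : Γ.Act} {p : Γ.Proc} (hs : Γ.IsStep b p s) (hs₁ : Γ.IsStep b p s₁)
    (ht : Γ.Starts p t) (ht₁ : Γ.Starts p t₁) (h : x ++ s ++ t ∈ M.language)
    (h₁ : x ++ s₁ ++ t₁ ∈ M.language) : x ++ s ++ t₁ ∈ M.language := by
  obtain ⟨E, hE, ht'⟩ := (exec_append_iff hM).1 h
  obtain ⟨E₁, hE₁, ht₁'⟩ := (exec_append_iff hM).1 h₁
  obtain ⟨D, hD, hs'⟩ := (exec_append_iff hM).1 hE
  obtain ⟨D₁, hD₁, hs₁'⟩ := (exec_append_iff hM).1 hE₁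
  obtain rfl := hD.unique hM hD₁
  have h₂ := (hs'.step hM hs).2.2
  rw [(hs₁'.step hM hs₁).2.2, Option.some_inj] at h₂
  obtain rfl := hS.tidy_unique hM ⟨_, hE⟩ ⟨_, hE₁⟩ (ht'.tidy hM ht) (ht₁'.tidy hM ht₁) h₂.symm
  exact hE.append ht₁'

end Diagram

/-! ## The hypothesis negotiation -/

namespace Table

open DistAlphabet Diagram

variable {Γ : DistAlphabet} {N : Diagram Γ} {H : Table Γ}

theorem hyp_delta_iff {L : Set Γ.Word} (hH : H.Invariants L) {u v : Fin H.numQ} {b : Γ.Act}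
    {p : Γ.Proc} : (H.hyp L hH).δ u b p = some v ↔
      ∃ s, H.S u b p = some s ∧ Γ.EquivT L H.T (H.Q u ++ s) (H.Q v) := by
  change ((H.S u b p).bind fun s => (List.finRange H.numQ).find? _) = some v ↔ _
  rw [Option.bind_eq_some_iff]
  refine exists_congr fun s => and_congr_right fun _ => ?_
  constructor
  · intro h
    simpa using List.find?_some h
  · intro h
    cases hf : (List.finRange H.numQ).find? fun v => by
        classical exact decide (Γ.EquivT L H.T (H.Q u ++ s) (H.Q v)) with
    | none =>
      have := List.find?_eq_none.1 hf v (List.mem_finRange v)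
      simp only [decide_eq_true_eq] at this
      exact absurd h this
    | some w =>
      have := List.find?_some hf
      simp only [decide_eq_true_eq] at this
      rw [hH.uniqueness w v (this.symm.trans h)]

theorem hyp_delta_isSome {L : Set Γ.Word} (hH : H.Invariants L) {u : Fin H.numQ} {b : Γ.Act}
    {p : Γ.Proc} : ((H.hyp L hH).δ u b p).isSome ↔ (H.S u b p).isSome := by
  rw [Option.isSome_iff_exists, Option.isSome_iff_exists]
  constructor
  · rintro ⟨v, hv⟩
    obtain ⟨s, hs, -⟩ := (hyp_delta_iff hH).1 hv
    exact ⟨s, hs⟩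
  · rintro ⟨s, hs⟩
    obtain ⟨v, hv⟩ := hH.closure u b p s hs
    exact ⟨v, (hyp_delta_iff hH).2 ⟨s, hs, hv⟩⟩

theorem mem_hyp_dnode {L : Set Γ.Word} (hH : H.Invariants L) {u : Fin H.numQ} {p : Γ.Proc} :
    p ∈ (H.hyp L hH).dnode u ↔
      H.Q u ∈ L ∨ ∃ t ∈ H.T, H.Q u ++ t ∈ L ∧ ∃ a, Γ.IsMin t a ∧ p ∈ Γ.dom a := by
  unfold hyp
  simp

theorem hyp_init {L : Set Γ.Word} (hH : H.Invariants L) : H.Q (H.hyp L hH).init = [] :=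
  hH.exists_init.choose_spec

theorem hyp_final_iff {L : Set Γ.Word} (hH : H.Invariants L) {u : Fin H.numQ} :
    H.Q u ∈ L ↔ u = (H.hyp L hH).final := by
  have hspec := hH.existsUnique_final.choose_spec
  constructor
  · exact fun h => hspec.2 u h
  · rintro rfl; exact hspec.1

/-- Every node of the hypothesis stands for one node of `N`, the only one that can be active after
its word. In particular, the domain does not depend on the test by which it is defined. -/
theorem Invariants.exists_node (hN : N.IsNegotiation) (hH : H.Invariants N.language)
    (u : Fin H.numQ) : ∃ D n, N.Exec N.initConfig (H.Q u) D ∧ N.Enabled D n ∧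
      (∀ a v, N.Enabled D v → a ∈ N.out v → v = n) ∧
      (∀ p, p ∈ (H.hyp N.language hH).dnode u ↔ p ∈ N.dnode n) := by
  by_cases hu : H.Q u ∈ N.language
  · refine ⟨N.finalConfig, N.final, hu, fun _ _ => rfl, fun a v hv _ => hv.eq_final hN, ?_⟩
    intro p
    rw [mem_hyp_dnode, hN.dnode_final]
    simp [hu]
  · obtain ⟨t, ht, htL⟩ := hH.pref u
    have htne : t ≠ [] := by rintro rfl; exact hu (by simpa using htL)
    obtain ⟨b, hb⟩ := hH.coPrime_T t ht htne
    obtain ⟨D, hD, hDt⟩ := (exec_append_iff hN).1 htL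
    obtain ⟨n, hn, hbn⟩ := hDt.only_of_isMin hN hb
    refine ⟨D, n, hD, hn.1, fun a v hv ha => hn.2 v hv ⟨a, ha⟩, fun p => ?_⟩
    rw [mem_hyp_dnode]
    constructor
    · rintro (h | ⟨t₁, -, ht₁L, a, ha, hp⟩)
      · exact absurd h hu
      · obtain ⟨D₁, hD₁, hDt₁⟩ := (exec_append_iff hN).1 ht₁L
        obtain rfl := hD.unique hN hD₁
        obtain ⟨n₁, hn₁, han₁⟩ := hDt₁.only_of_isMin hN ha
        obtain rfl := hn.2 n₁ hn₁.1 ⟨a, han₁⟩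
        rwa [hN.dnode_eq_of_mem_out han₁]
    · intro hp
      exact .inr ⟨t, ht, htL, b, hb, by rwa [← hN.dnode_eq_of_mem_out hbn]⟩

theorem Invariants.exists_test (hH : H.Invariants N.language) {u v : Fin H.numQ} {b : Γ.Act}
    {p : Γ.Proc} (h : (H.hyp N.language hH).δ u b p = some v) :
    ∃ s t, H.S u b p = some s ∧ Γ.IsStep b p s ∧ t ∈ H.T ∧ Γ.Starts p t ∧
      H.Q u ++ s ++ t ∈ N.language ∧ H.Q v ++ t ∈ N.language ∧
      Γ.EquivT N.language H.T (H.Q u ++ s) (H.Q v) := by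
  obtain ⟨s, hs, heq⟩ := (hyp_delta_iff hH).1 h
  obtain ⟨t, ht, htL, hst⟩ := hH.pref_support u b p s hs
  exact ⟨s, t, hs, hH.isStep_S _ _ _ _ hs, ht, hst, htL, (heq t ht).1 htL, heq⟩

/-- The conditions are inherited from `N`: a support with label `b` begins by executing `b` at the
node of `N` for which `u` stands, and its test shows that `p` belongs to the target. After the word
of the final node nothing can be executed, so no support starts there. -/
theorem Invariants.isNegotiation (hN : N.IsNegotiation) (hH : H.Invariants N.language) :
    (H.hyp N.language hH).IsNegotiation where
  dnode_nonempty u := by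
    obtain ⟨D, n, -, -, -, hd⟩ := hH.exists_node hN u
    obtain ⟨p, hp⟩ := hN.dnode_nonempty n
    exact ⟨p, (hd p).2 hp⟩
  dnode_init := by
    obtain ⟨D, n, hD, hn, -, hd⟩ := hH.exists_node hN (H.hyp N.language hH).init
    rw [hyp_init, exec_nil_iff] at hD
    subst hD
    obtain ⟨p, hp⟩ := hN.dnode_nonempty n
    obtain rfl : N.init = n := hn p hp
    ext q
    rw [hd, hN.dnode_init]
  dnode_final := by
    exact Finset.eq_univ_iff_forall.2 fun q =>
      (mem_hyp_dnode hH).2 (.inl ((hyp_final_iff hH).2 rfl))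
  dom_match u b p v h := by
    obtain ⟨s, t, hs, hstep, ht, hst, htL, hvL, -⟩ := hH.exists_test h
    refine ⟨?_, hstep.1, ?_, fun q hq => ?_⟩
    · obtain ⟨D, n, hD, hn, ho, hd⟩ := hH.exists_node hN u
      obtain ⟨E, hE, -⟩ := (exec_append_iff hN).1 htL
      obtain ⟨D₁, hD₁, hs₁⟩ := (exec_append_iff hN).1 hE
      obtain rfl := hD.unique hN hD₁
      obtain ⟨h₁, h₂, -⟩ := hs₁.step hN hstep
      obtain h₃ := ho b _ h₁ h₂
      rw [h₃] at h₂
      ext q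
      rw [hd, hN.dnode_eq_of_mem_out h₂]
    · refine (mem_hyp_dnode hH).2 ?_
      cases t with
      | nil => exact .inl (by simpa using hvL)
      | cons c t => exact .inr ⟨_, ht, hvL, hst (by simp)⟩
    · exact (hyp_delta_isSome hH).2 (hH.domain u b p (by rw [hs]; rfl) q hq)
  out_final := by
    rw [Set.eq_empty_iff_forall_notMem]
    rintro b ⟨p, hp⟩
    obtain ⟨v, hv⟩ := Option.isSome_iff_exists.1 hp
    obtain ⟨s, t, hs, hstep, -, -, htL, -⟩ := hH.exists_test hv
    obtain ⟨E, hE, -⟩ := (exec_append_iff hN).1 htL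
    obtain ⟨D₁, hD₁, hs₁⟩ := (exec_append_iff hN).1 hE
    obtain rfl := ((hyp_final_iff hH).2 rfl : N.Exec _ _ _).unique hN hD₁
    obtain ⟨-, -, s₁, rfl, -⟩ := hstep
    exact not_exec_final hN hs₁

end Table

theorem exists_soundness_program : ∃ (check : Prog) (P : Polynomial ℕ),
    ∀ (Γ : DistAlphabet) (N : Diagram Γ), N.IsNegotiation → N.Sound →
    ∀ (H : Table Γ) (hH : H.Invariants N.language),
      ∃ (y : DTree) (t : ℕ),
        Runs (membership N.language) check (encDiagram (H.hyp N.language hH)) y t 0 ∧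
        t ≤ P.eval (encDiagram (H.hyp N.language hH)).size ∧
        (y ≠ .nil ↔ (H.hyp N.language hH).Sound) := by
  obtain ⟨⟨e, τ, he, P, hP⟩, -⟩ := PolyFun.soundTest_raw
  refine ⟨e, P, fun Γ N hN _ H hH => ?_⟩
  obtain ⟨t, ht, hle⟩ := he (membership N.language) (rawDiagram (H.hyp N.language hH))
  refine ⟨_, t, by rw [encDiagram_eq]; exact ht, ?_, ?_⟩
  · rw [encDiagram_eq]
    exact hle.trans (hP _)
  · rw [← Diagram.soundTest_iff (hH.isNegotiation hN)]
    have key : ∀ c : Bool, enc c ≠ DTree.nil ↔ c = true := by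
      intro c
      cases c <;> simp [enc, DTree.ofBool]
    exact key _

/-! ## The search for a counterexample, on lists of numbers -/

/-- A node and a word. -/
abbrev Item : Type := ℕ × List ℕ

/-- The encoded data of the hypothesis and of the table. -/
abbrev RawInput : Type := RawDiagram × RawTable

namespace RawInput

abbrev procs (I : RawInput) : ℕ := I.1.1.1
abbrev doms (I : RawInput) : List (List ℕ) := I.1.1.2
abbrev trans (I : RawInput) : List Quad := I.1.2.2.1
abbrev init (I : RawInput) : ℕ := I.1.2.2.2.1
abbrev final (I : RawInput) : ℕ := I.1.2.2.2.2
abbrev words (I : RawInput) : List (List ℕ) := I.2.1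
abbrev tests (I : RawInput) : List (List ℕ) := I.2.2.1
abbrev supports (I : RawInput) : List (ℕ × ℕ × ℕ × List ℕ) := I.2.2.2

end RawInput

namespace Search

open TransList

/-- Ask for the word of the node followed by the given word. -/
def ask (o : List ℕ → Bool) (Qs : List (List ℕ)) (x : Item) : Bool :=
  o (Qs.getD x.1 [] ++ x.2)

/-- Cut a sequence at its middle, such that the answer `b` still changes. -/
def bisectStep (f : Item → Bool) (b : Bool) (seg : List Item) : List Item :=
  if decide (3 ≤ seg.length) then
    if f (seg.getD (seg.length / 2) (0, [])) == b then seg.drop (seg.length / 2)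
    else seg.take (seg.length / 2 + 1)
  else seg

def bisect (f : Item → Bool) (b : Bool) (items : List Item) : List Item :=
  items.foldl (fun seg _ => bisectStep f b seg) items

/-- A transition labelled with the action at the head of the first word. -/
def targetOf (p : ℕ) (seg : List Item) : DTree :=
  enc (1, (seg.getD 0 (0, [])).1, (seg.getD 0 (0, [])).2.headD 0, p, seg.getD 1 (0, []))

/-- Report the last item, or the place where the answers change. -/
def finish (f : Item → Bool) (p : ℕ) (items : List Item) : DTree :=
  if f (items.headD (0, [])) == f (items.reverse.headD (0, [])) then
    enc (0, items.reverse.headD (0, []))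
  else targetOf p (bisect f (f (items.headD (0, []))) items)

def contains (l : List ℕ) (x : ℕ) : Bool := l.any fun y => decide (y = x)

/-- Take the letter, if it meets the processes collected so far. -/
def futureStep (doms : List (List ℕ)) (s : List ℕ × List ℕ) (c : ℕ) : List ℕ × List ℕ :=
  if (doms.getD c []).any (fun x => contains s.1 x) then (s.1 ++ doms.getD c [], s.2 ++ [c]) else s

/-- The letters that depend on the processes in `D`. -/
def future (doms : List (List ℕ)) (D w : List ℕ) : List ℕ :=
  (w.foldl (futureStep doms) (D, [])).2

/-- The transitions of `p` with the action at the head of the word. -/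
def next (E : List Quad) (p : ℕ) (x : Item) : List Quad :=
  (moves E x.1 (x.2.headD 0)).filter fun e => decide (e.2.2.1 = p)

/-- One step of `p` along a word; the last item comes first. -/
def walkStep (doms : List (List ℕ)) (E : List Quad) (p : ℕ) (acc : List Item) : List Item :=
  if (acc.headD (0, [])).2.isEmpty || (next E p (acc.headD (0, []))).isEmpty then acc
  else (((next E p (acc.headD (0, []))).headD (0, 0, 0, 0)).2.2.2,
    future doms [p] (acc.headD (0, [])).2.tail) :: acc

/-- The path of `p` along a word. -/
def walk (doms : List (List ℕ)) (E : List Quad) (p : ℕ) (x : Item) : List Item :=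
  (x.2.foldl (fun acc _ => walkStep doms E p acc) [x]).reverse

/-- The nodes from which the final node cannot be reached. -/
def lost (I : RawInput) : List ℕ :=
  (List.range I.words.length).filter fun u => !known I.final (grow I.trans I.final) u

/-- A shortest member. -/
def shortest (l : List (List ℕ)) : List ℕ :=
  l.foldl (fun s t => if decide (t.length ≤ s.length) then t else s) (l.headD [])

/-- The path of a process along a shortest test, from a lost node. -/
def lostItems (f : Item → Bool) (I : RawInput) : ℕ × List Item :=
  let u := (lost I).headD 0
  let t := shortest (I.tests.filter fun t => f (u, t))
  let p := (I.doms.getD (t.headD 0) []).headD 0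
  (p, walk I.doms I.trans p (u, t))

/-- Nothing can be executed, and not all processes are at the final node. -/
def dead (I : RawInput) (h : List Quad) : Bool :=
  (I.trans.all fun e => !canFire I.trans I.init h e.1 e.2.1) &&
    !allAt I.procs I.final I.init h

/-- Extend all histories by one action, unless there is a deadlock. -/
def extend (I : RawInput) (Hs : List (List Quad)) : List (List Quad) :=
  if Hs.any (dead I) then Hs
  else Hs.flatMap fun h => I.trans.map fun e => fire I.trans I.init h e.1 e.2.1

/-- As many elements as there are configurations. -/
def fuel (I : RawInput) : List (List ℕ) :=
  (List.range I.procs).foldl (fun l _ => l.flatMap fun _ => I.words) [[]]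

/-- A history that leads to a deadlock. -/
def deadlock (I : RawInput) : List Quad :=
  (((fuel I).foldl (fun Hs _ => extend I Hs) [[]]).filter (dead I)).headD []

/-- The support of a transition. -/
def support (S : List (ℕ × ℕ × ℕ × List ℕ)) (e : Quad) : List ℕ :=
  ((S.filter fun x => decide (x.1 = e.1) && (decide (x.2.1 = e.2.1) &&
    decide (x.2.2.1 = e.2.2.1))).headD (0, 0, 0, [])).2.2.2

/-- The path of a process to its node, followed by a test. -/
def pathItems (I : RawInput) (h : List Quad) (x : ℕ × List ℕ) : List Item :=
  (h.filter fun e => decide (e.2.2.1 = x.1)).foldl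
    (fun acc e => (e.1, support I.supports e ++ (acc.headD (0, [])).2) :: acc)
    [(loc I.init h x.1, x.2)]

/-- Processes with tests in whose least action they take part. -/
def pairs (I : RawInput) : List (ℕ × List ℕ) :=
  (List.range I.procs).flatMap fun q => (I.tests.filter fun t =>
    t.isEmpty || contains (I.doms.getD (t.headD 0) []) q).map fun t => (q, t)

/-- The answers for the first and the last item differ. -/
def differ (f : Item → Bool) (items : List Item) : Bool :=
  !(f (items.headD (0, [])) == f (items.reverse.headD (0, [])))

/-- The path of a process to a deadlock and a test, such that the answers differ. -/
def deadItems (f : Item → Bool) (I : RawInput) : ℕ × List Item :=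
  let h := deadlock I
  let x := ((pairs I).filter fun x => differ f (pathItems I h x)).headD (0, [])
  (x.1, pathItems I h x)

def itemsOf (f : Item → Bool) (I : RawInput) : ℕ × List Item :=
  if (lost I).isEmpty then deadItems f I else lostItems f I

def find (f : Item → Bool) (I : RawInput) : DTree :=
  finish f (itemsOf f I).1 (itemsOf f I).2

end Search

/-! ### Ingredients of the search that need no unbounded loops. -/

namespace PolyFun

variable {α : Type} [TreeEnc α]

theorem procs {f : α → RawInput} (hf : PolyFun f) : PolyFun fun a => (f a).procs :=
  fst (fst (fst hf))

theorem doms {f : α → RawInput} (hf : PolyFun f) : PolyFun fun a => (f a).doms :=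
  snd (fst (fst hf))

theorem trans {f : α → RawInput} (hf : PolyFun f) : PolyFun fun a => (f a).trans :=
  fst (snd (snd (fst hf)))

theorem init {f : α → RawInput} (hf : PolyFun f) : PolyFun fun a => (f a).init :=
  fst (snd (snd (snd (fst hf))))

theorem final {f : α → RawInput} (hf : PolyFun f) : PolyFun fun a => (f a).final :=
  snd (snd (snd (snd (fst hf))))

theorem words {f : α → RawInput} (hf : PolyFun f) : PolyFun fun a => (f a).words :=
  fst (snd hf)

theorem tests {f : α → RawInput} (hf : PolyFun f) : PolyFun fun a => (f a).tests :=
  fst (snd (snd hf))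

theorem supports {f : α → RawInput} (hf : PolyFun f) : PolyFun fun a => (f a).supports :=
  snd (snd (snd hf))

theorem targetOf {p : α → ℕ} {seg : α → List Item} (hp : PolyFun p) (hs : PolyFun seg) :
    PolyFun fun a => Search.targetOf (p a) (seg a) :=
  have h₀ := getD (d := fun _ => (0, [])) hs (const 0) (const _)
  encode (pair (const 1) (pair (fst h₀) (pair (headD (snd h₀) (const 0))
    (pair hp (getD (d := fun _ => (0, [])) hs (const 1) (const _))))))

theorem contains {l : α → List ℕ} {x : α → ℕ} (hl : PolyFun l) (hx : PolyFun x) :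
    PolyFun fun a => Search.contains (l a) (x a) :=
  any (k := fun a y => decide (y = x a)) hl (natEq (snd id) (hx.comp (fst id)))

theorem futureStep {d : α → List (List ℕ)} {s : α → List ℕ × List ℕ} {c : α → ℕ} (hd : PolyFun d)
    (hs : PolyFun s) (hc : PolyFun c) : PolyFun fun a => Search.futureStep (d a) (s a) (c a) :=
  have h := getD (d := fun _ => []) hd hc (const _)
  ite (any (k := fun a x => Search.contains (s a).1 x) h
      (contains ((fst hs).comp (fst id)) (snd id)))
    (pair (append (fst hs) h) (append (snd hs) (cons hc (const [])))) hs

theorem next {E : α → List Quad} {p : α → ℕ} {x : α → Item} (hE : PolyFun E) (hp : PolyFun p)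
    (hx : PolyFun x) : PolyFun fun a => Search.next (E a) (p a) (x a) :=
  filter (k := fun a (e : Quad) => decide (e.2.2.1 = p a))
    (moves hE (fst hx) (headD (snd hx) (const 0)))
    (natEq (fst (snd (snd (snd id)))) (hp.comp (fst id)))

theorem lost {I : α → RawInput} (hI : PolyFun I) : PolyFun fun a => Search.lost (I a) :=
  filter (k := fun a u => !TransList.known (I a).final
      (TransList.grow (I a).trans (I a).final) u) (range (length (words hI)))
    (not (known (final (hI.comp (fst id)))
      (grow (trans (hI.comp (fst id))) (final (hI.comp (fst id)))) (snd id)))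

theorem shortest {l : α → List (List ℕ)} (hl : PolyFun l) :
    PolyFun fun a => Search.shortest (l a) := by
  have h : PolyFun fun x : α × List ℕ × List ℕ =>
      if decide (x.2.2.length ≤ x.2.1.length) then x.2.2 else x.2.1 :=
    ite (natLe (length (snd (snd id))) (length (fst (snd id)))) (snd (snd id)) (fst (snd id))
  refine foldl (h := fun _ (s t : List ℕ) => if decide (t.length ≤ s.length) then t else s) hl
    (headD hl (const [])) h hl.size_bdd fun a s t ht => ?_
  have := esize_le_of_mem ht
  split_ifs <;> omega

theorem dead {I : α → RawInput} {h : α → List Quad} (hI : PolyFun I) (hh : PolyFun h) :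
    PolyFun fun a => Search.dead (I a) (h a) :=
  and (all (k := fun a (e : Quad) =>
      !TransList.canFire (I a).trans (I a).init (h a) e.1 e.2.1) (trans hI)
      (not (canFire (trans (hI.comp (fst id))) (init (hI.comp (fst id))) (hh.comp (fst id))
        (fst (snd id)) (fst (snd (snd id))))))
    (not (allAt (procs hI) (final hI) (init hI) hh))

theorem extend {I : α → RawInput} {Hs : α → List (List Quad)} (hI : PolyFun I)
    (hH : PolyFun Hs) : PolyFun fun a => Search.extend (I a) (Hs a) :=
  ite (any (k := fun a h => Search.dead (I a) h) hH (dead (hI.comp (fst id)) (snd id))) hH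
    (flatMap (k := fun a h => (I a).trans.map fun e =>
        TransList.fire (I a).trans (I a).init h e.1 e.2.1) hH
      (map (k := fun (x : α × List Quad) (e : Quad) =>
          TransList.fire (I x.1).trans (I x.1).init x.2 e.1 e.2.1) (trans (hI.comp (fst id)))
        (fire (trans (hI.comp (fst (fst id)))) (init (hI.comp (fst (fst id)))) (snd (fst id))
          (fst (snd id)) (fst (snd (snd id))))))

theorem support {S : α → List (ℕ × ℕ × ℕ × List ℕ)} {e : α → Quad} (hS : PolyFun S)
    (he : PolyFun e) : PolyFun fun a => Search.support (S a) (e a) :=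
  have he' := he.comp (fst (id (α := α × ℕ × ℕ × ℕ × List ℕ)))
  snd (snd (snd (headD (filter (k := fun a (x : ℕ × ℕ × ℕ × List ℕ) =>
      decide (x.1 = (e a).1) && (decide (x.2.1 = (e a).2.1) &&
        decide (x.2.2.1 = (e a).2.2.1))) hS
      (and (natEq (fst (snd id)) (fst he')) (and (natEq (fst (snd (snd id))) (fst (snd he')))
        (natEq (fst (snd (snd (snd id)))) (fst (snd (snd he'))))))) (const (0, 0, 0, [])))))

theorem pairs {I : α → RawInput} (hI : PolyFun I) : PolyFun fun a => Search.pairs (I a) := by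
  have h : PolyFun fun y : (α × ℕ) × List ℕ => y.2.isEmpty ||
      Search.contains ((I y.1.1).doms.getD (y.2.headD 0) []) y.1.2 :=
    or (isEmpty (snd id)) (contains (getD (d := fun _ => []) (doms (hI.comp (fst (fst id))))
      (headD (snd id) (const 0)) (const _)) (snd (fst id)))
  exact flatMap (k := fun a q => ((I a).tests.filter fun t =>
      t.isEmpty || Search.contains ((I a).doms.getD (t.headD 0) []) q).map fun t => (q, t))
    (range (procs hI))
    (map (k := fun (x : α × ℕ) (t : List ℕ) => (x.2, t))
      (filter (k := fun (x : α × ℕ) t =>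
          t.isEmpty || Search.contains ((I x.1).doms.getD (t.headD 0) []) x.2)
        (tests (hI.comp (fst id))) h)
      (pair (snd (fst id)) (snd id)))

end PolyFun

/-! ### Ingredients of the search without a time bound. -/

namespace Comp

open PolyFun (id fst snd)

variable {α : Type} [TreeEnc α]

theorem future {d : α → List (List ℕ)} {D w : α → List ℕ} (hd : Comp d) (hD : Comp D)
    (hw : Comp w) : Comp fun a => Search.future (d a) (D a) (w a) :=
  (snd id).toComp.comp (foldl (h := fun a s c => Search.futureStep (d a) s c) hw
    (hD.pair (PolyFun.const []).toComp)
    ((PolyFun.futureStep (fst id) (fst (snd id)) (snd (snd id))).toComp.comp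
      ((hd.comp (fst id).toComp).pair ((fst (snd id)).pair (snd (snd id))).toComp)))

theorem walkStep {d : α → List (List ℕ)} {E : α → List Quad} {p : α → ℕ} {acc : α → List Item}
    (hd : PolyFun d) (hE : PolyFun E) (hp : PolyFun p) (hacc : PolyFun acc) :
    Comp fun a => Search.walkStep (d a) (E a) (p a) (acc a) :=
  have hx := hacc.headD (PolyFun.const (0, []))
  have hn := PolyFun.next hE hp hx
  ite (PolyFun.or (PolyFun.isEmpty (snd hx)) (PolyFun.isEmpty hn)).toComp hacc.toComp
    ((PolyFun.cons (fst id) (snd id)).toComp.comp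
      (((snd (snd (snd (PolyFun.headD hn (PolyFun.const (0, 0, 0, 0)))))).toComp.pair
        (future hd.toComp (PolyFun.cons hp (PolyFun.const [])).toComp
          (PolyFun.tail (snd hx)).toComp)).pair hacc.toComp))

theorem walk {d : α → List (List ℕ)} {E : α → List Quad} {p : α → ℕ} {x : α → Item}
    (hd : PolyFun d) (hE : PolyFun E) (hp : PolyFun p) (hx : PolyFun x) :
    Comp fun a => Search.walk (d a) (E a) (p a) (x a) :=
  (PolyFun.reverse id).toComp.comp
    (foldl (h := fun a acc _ => Search.walkStep (d a) (E a) (p a) acc) (snd hx).toComp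
      (PolyFun.cons hx (PolyFun.const [])).toComp
      (walkStep (hd.comp (fst id)) (hE.comp (fst id)) (hp.comp (fst id)) (fst (snd id))))

theorem fuel : Comp Search.fuel := by
  have h : Comp fun x : RawInput × List (List ℕ) × ℕ => x.2.1.flatMap fun _ => x.1.words :=
    (PolyFun.flatMap (k := fun (x : RawInput × List (List ℕ) × ℕ) _ => x.1.words) (fst (snd id))
      (PolyFun.words (fst (fst id)))).toComp
  exact foldl (h := fun (I : RawInput) (l : List (List ℕ)) _ => l.flatMap fun _ => I.words)
    (PolyFun.range (PolyFun.procs id)).toComp (PolyFun.const [[]]).toComp h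

theorem deadlock : Comp Search.deadlock :=
  (PolyFun.headD (PolyFun.filter (k := fun (I : RawInput × List (List Quad)) h =>
      Search.dead I.1 h) (snd id) (PolyFun.dead (fst (fst id)) (snd id)))
      (PolyFun.const [])).toComp.comp
    ((PolyFun.id).toComp.pair
      (foldl (h := fun (I : RawInput) Hs _ => Search.extend I Hs) fuel (PolyFun.const [[]]).toComp
        (PolyFun.extend (fst id) (fst (snd id))).toComp))

theorem pathItems {I : α → RawInput} {h : α → List Quad} {x : α → ℕ × List ℕ} (hI : PolyFun I)
    (hh : PolyFun h) (hx : PolyFun x) : Comp fun a => Search.pathItems (I a) (h a) (x a) :=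
  foldl (h := fun a acc (e : Quad) =>
      (e.1, Search.support (I a).supports e ++ (acc.headD (0, [])).2) :: acc)
    (PolyFun.filter (k := fun a (e : Quad) => decide (e.2.2.1 = (x a).1)) hh
      (PolyFun.natEq (fst (snd (snd (snd id)))) (fst (hx.comp (fst id))))).toComp
    (PolyFun.cons (PolyFun.pair (PolyFun.loc (PolyFun.init hI) hh (fst hx)) (snd hx))
      (PolyFun.const [])).toComp
    (PolyFun.cons (PolyFun.pair (fst (snd (snd id)))
      (PolyFun.append (PolyFun.support (PolyFun.supports (hI.comp (fst id))) (snd (snd id)))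
        (snd (PolyFun.headD (fst (snd id)) (PolyFun.const (0, [])))))) (fst (snd id))).toComp

end Comp

/-! ### Query counts of the search. -/

namespace QFun

open PolyFun (id fst snd)

variable {α β : Type} [TreeEnc α] [TreeEnc β]

theorem filter {f : α → List β} {k : (List ℕ → Bool) → α → β → Bool} {K : ℕ} (hf : Comp f)
    (hk : QFun (fun o (x : α × β) => k o x.1 x.2) fun _ _ => K) :
    QFun (fun o a => (f a).filter (k o a)) fun _ a => K * (f a).length := by
  have h₁ : QFun (fun o (x : α × List β × β) => if k o x.1 x.2.2 then x.2.1 ++ [x.2.2] else x.2.1)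
      fun _ _ => K := by
    have h₂ := hk.comp (Comp.toQFun (f := fun x : α × List β × β => (x.1, x.2.2))
      (PolyFun.pair (fst id) (snd (snd id))).toComp)
    have h₃ := Comp.toQFun (f := fun x : Bool × α × List β × β =>
      if x.1 then x.2.2.1 ++ [x.2.2.2] else x.2.2.1)
      (PolyFun.ite (fst id) (PolyFun.append (fst (snd (snd id)))
        (PolyFun.cons (snd (snd (snd id))) (PolyFun.const []))) (fst (snd (snd id)))).toComp
    exact (h₃.comp (h₂.pair (Comp.toQFun PolyFun.id.toComp))).mono fun o a => by simp
  have h₄ := foldl (c := fun _ _ _ _ => K) (h := fun o a s b => if k o a b then s ++ [b] else s) hf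
    (PolyFun.const []).toComp h₁
  have key : ∀ (p : β → Bool) (l s : List β),
      l.foldl (fun s b => if p b then s ++ [b] else s) s = s ++ l.filter p := by
    intro p l
    induction l with
    | nil => simp
    | cons b l ih =>
      intro s
      rw [List.foldl_cons, ih, List.filter_cons]
      split <;> simp
  simp only [key, List.nil_append] at h₄
  exact h₄.mono fun o a => foldCost_le (fun _ _ => le_rfl) _ _

theorem ask {Qs : α → List (List ℕ)} {x : α → Item} (hQ : PolyFun Qs) (hx : PolyFun x) :
    QFun (fun o a => Search.ask o (Qs a) (x a)) fun _ _ => 1 :=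
  (query.comp (Comp.toQFun (PolyFun.append (PolyFun.getD hQ (fst hx) (PolyFun.const []))
    (snd hx)).toComp)).mono fun _ _ => by simp

end QFun

namespace Search

theorem bisectStep_of_lt {f : Item → Bool} {b : Bool} {seg : List Item} (h : seg.length < 3) :
    bisectStep f b seg = seg := by
  unfold bisectStep
  rw [if_neg (by simpa using h)]

theorem length_bisectStep {f : Item → Bool} {b : Bool} {seg : List Item} (h : 3 ≤ seg.length) :
    (bisectStep f b seg).length ≤ seg.length / 2 + 1 := by
  unfold bisectStep
  rw [if_pos (by simpa using h)]
  split
  · rw [List.length_drop]; omega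
  · rw [List.length_take]; omega

/-- The measure is the number of gaps, one less than the length n. A step leaves at most ⌊n/2⌋ gaps,
which is half of n - 1 rounded up, in accordance with the recursion for `Nat.clog`. -/
theorem foldCost_bisectStep {β : Type} (f : Item → Bool) (b : Bool) (l : List β)
    (seg : List Item) : foldCost (fun seg _ => bisectStep f b seg)
      (fun seg _ => if decide (3 ≤ seg.length) then 1 else 0) seg l
        ≤ Nat.clog 2 (seg.length - 1) := by
  induction l generalizing seg with
  | nil => exact Nat.zero_le _
  | cons c l ih =>
    rw [foldCost]
    refine (Nat.add_le_add_left (ih _) _).trans ?_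
    by_cases h : 3 ≤ seg.length
    · rw [if_pos (by simpa using h), Nat.clog_of_two_le (n := seg.length - 1) one_lt_two (by omega),
        Nat.add_comm]
      refine Nat.add_le_add_right (Nat.clog_mono_right 2 ?_) 1
      have := length_bisectStep (f := f) (b := b) h
      omega
    · rw [if_neg (by simpa using h), bisectStep_of_lt (by omega), Nat.zero_add]

end Search

namespace QFun

open PolyFun (id fst snd)

variable {α β : Type} [TreeEnc α] [TreeEnc β]

theorem bisectStep : QFun (fun o (x : List (List ℕ) × Bool × List Item) =>
    Search.bisectStep (Search.ask o x.1) x.2.1 x.2.2)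
      fun _ x => if decide (3 ≤ x.2.2.length) then 1 else 0 := by
  have hs : PolyFun fun x : List (List ℕ) × Bool × List Item => x.2.2 := snd (snd id)
  have hm : PolyFun fun x : List (List ℕ) × Bool × List Item => x.2.2.length / 2 :=
    PolyFun.half (PolyFun.length hs)
  have h₁ := ask (fst (id (α := List (List ℕ) × Bool × List Item)))
    (PolyFun.getD (d := fun _ => (0, [])) hs hm (PolyFun.const _))
  have h₂ : Comp fun y : Bool × List (List ℕ) × Bool × List Item =>
      if y.1 == y.2.2.1 then y.2.2.2.drop (y.2.2.2.length / 2)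
      else y.2.2.2.take (y.2.2.2.length / 2 + 1) :=
    (PolyFun.ite (PolyFun.boolEq (fst id) (fst (snd (snd id))))
      (PolyFun.drop (hs.comp (snd id)) (hm.comp (snd id)))
      (PolyFun.take (hs.comp (snd id)) (PolyFun.succ (hm.comp (snd id))))).toComp
  exact (ite (PolyFun.natLe (PolyFun.const 3) (PolyFun.length hs)).toComp
    (h₂.toQFun.comp (h₁.pair id.toComp.toQFun)) hs.toComp.toQFun).mono fun o a => by
      split_ifs <;> simp

theorem bisect : QFun (fun o (x : List (List ℕ) × Bool × List Item) =>
    Search.bisect (Search.ask o x.1) x.2.1 x.2.2)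
      fun _ x => Nat.clog 2 (x.2.2.length - 1) := by
  have h := foldl (α := List (List ℕ) × Bool × List Item) (β := Item)
    (f := fun x => x.2.2) (g := fun x => x.2.2)
    (h := fun o x s _ => Search.bisectStep (Search.ask o x.1) x.2.1 s)
    (c := fun _ _ s _ => if decide (3 ≤ s.length) then 1 else 0)
    (snd (snd id)).toComp (snd (snd id)).toComp
    ((bisectStep.comp (Comp.toQFun (f := fun y : (List (List ℕ) × Bool × List Item) ×
      List Item × Item => (y.1.1, y.1.2.1, y.2.1)) (PolyFun.pair (fst (fst id))
        (PolyFun.pair (fst (snd (fst id))) (fst (snd id)))).toComp)).mono fun o a => by simp)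
  exact h.mono fun o a => Search.foldCost_bisectStep _ _ _ _

theorem finish : QFun (fun o (x : List (List ℕ) × ℕ × List Item) =>
    Search.finish (Search.ask o x.1) x.2.1 x.2.2)
      fun _ x => 2 + Nat.clog 2 (x.2.2.length - 1) := by
  have hs : PolyFun fun x : List (List ℕ) × ℕ × List Item => x.2.2 := snd (snd id)
  have hx := PolyFun.headD hs (PolyFun.const (0, []))
  have hy := PolyFun.headD (PolyFun.reverse hs) (PolyFun.const (0, []))
  have h₁ := (ask (fst id) hx).pair (ask (fst id) hy)
  have hs' := hs.comp (snd (id (α := (Bool × Bool) × List (List ℕ) × ℕ × List Item)))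
  have h₂ := ite (α := (Bool × Bool) × List (List ℕ) × ℕ × List Item)
    (PolyFun.boolEq (fst (fst id)) (snd (fst id))).toComp
    (PolyFun.encode (PolyFun.pair (PolyFun.const 0) (hy.comp (snd id)))).toComp.toQFun
    ((PolyFun.targetOf (fst id) (snd id)).toComp.toQFun.comp
      ((Comp.toQFun (fst (snd (snd id))).toComp).pair (bisect.comp
        (PolyFun.pair (fst (snd id)) (PolyFun.pair (fst (fst id)) hs')).toComp.toQFun)))
  exact (h₂.comp (h₁.pair id.toComp.toQFun)).mono fun o a => by
    split_ifs <;> simp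

theorem lostItems : QFun (fun o (I : RawInput) => Search.lostItems (Search.ask o I.words) I)
    fun _ I => I.tests.length := by
  have hu := PolyFun.headD (PolyFun.lost id) (PolyFun.const 0)
  have h₁ : QFun (fun o (I : RawInput) => I.tests.filter fun t =>
      Search.ask o I.words ((Search.lost I).headD 0, t)) fun _ I => 1 * I.tests.length :=
    filter (k := fun o (I : RawInput) t => Search.ask o I.words ((Search.lost I).headD 0, t))
      (PolyFun.tests id).toComp
      (ask (PolyFun.words (fst id)) (PolyFun.pair (hu.comp (fst id)) (snd id)))
  have ht : PolyFun fun x : List (List ℕ) × RawInput => Search.shortest x.1 :=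
    PolyFun.shortest (fst id)
  have hp : PolyFun fun x : List (List ℕ) × RawInput =>
      (x.2.doms.getD ((Search.shortest x.1).headD 0) []).headD 0 :=
    PolyFun.headD (PolyFun.getD (d := fun _ => []) (PolyFun.doms (snd id))
      (PolyFun.headD ht (PolyFun.const 0)) (PolyFun.const _)) (PolyFun.const 0)
  have h₂ := hp.toComp.pair (Comp.walk (PolyFun.doms (snd id)) (PolyFun.trans (snd id)) hp
    (PolyFun.pair (hu.comp (snd id)) ht))
  exact (h₂.toQFun.comp (h₁.pair id.toComp.toQFun)).mono fun o a => by simp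

theorem deadItems : QFun (fun o (I : RawInput) => Search.deadItems (Search.ask o I.words) I)
    fun _ I => 2 * (Search.pairs I).length := by
  have h₀ := Comp.deadlock.pair id.toComp
  have hpath := Comp.pathItems (snd (fst (id (α := (List Quad × RawInput) × ℕ × List ℕ))))
    (fst (fst id)) (snd id)
  have h₁ : QFun (fun o (x : (List Quad × RawInput) × ℕ × List ℕ) =>
      Search.differ (Search.ask o x.1.2.words) (Search.pathItems x.1.2 x.1.1 x.2))
      fun _ _ => 2 := by
    have h₂ := (ask (fst (id (α := List (List ℕ) × List Item)))
        (PolyFun.headD (snd id) (PolyFun.const (0, [])))).pair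
      (ask (fst id) (PolyFun.headD (PolyFun.reverse (snd id)) (PolyFun.const (0, []))))
    have h₃ := (PolyFun.not (PolyFun.boolEq (fst id) (snd id))).toComp.toQFun.comp h₂
    exact (h₃.comp (Comp.toQFun ((PolyFun.words (snd (fst id))).toComp.pair hpath))).mono
      fun o a => by simp
  have h₂ := filter (k := fun o (y : List Quad × RawInput) x =>
    Search.differ (Search.ask o y.2.words) (Search.pathItems y.2 y.1 x))
    (PolyFun.pairs (snd id)).toComp h₁
  have hx := PolyFun.headD (fst (id (α := List (ℕ × List ℕ) × List Quad × RawInput)))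
    (PolyFun.const (0, []))
  have h₃ := (fst hx).toComp.pair (Comp.pathItems (snd (snd id)) (fst (snd id)) hx)
  exact ((h₃.toQFun.comp (h₂.pair id.toComp.toQFun)).comp h₀.toQFun).mono fun o a => by simp

theorem find : QFun (fun o (I : RawInput) => Search.find (Search.ask o I.words) I)
    fun o I => (if (Search.lost I).isEmpty then 2 * (Search.pairs I).length
      else I.tests.length) +
        (2 + Nat.clog 2 ((Search.itemsOf (Search.ask o I.words) I).2.length - 1)) := by
  have h₁ := ite (PolyFun.isEmpty (PolyFun.lost id)).toComp deadItems lostItems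
  have h₂ := ((PolyFun.words id).toComp.toQFun).pair h₁
  exact (finish.comp h₂).mono fun o I => by
    simp only [Nat.zero_add]
    exact le_rfl

end QFun

/-! ## Correctness of the search -/

namespace Search

variable {f : Item → Bool} {b : Bool}

/-- The answers change from `b` to `!b` along the sequence. -/
structure Changing (f : Item → Bool) (b : Bool) (R : Item → Item → Prop) (seg : List Item) :
    Prop where
  chain : seg.IsChain R
  ne_nil : seg ≠ []
  head : f (seg.head ne_nil) = b
  last : f (seg.getLast ne_nil) = !b

theorem Changing.two_le {R : Item → Item → Prop} {seg : List Item} (h : Changing f b R seg) :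
    2 ≤ seg.length := by
  obtain ⟨-, hne, h₁, h₂⟩ := h
  match seg, hne with
  | [x], _ => simp_all
  | x :: y :: l, _ => simp

/-- The middle item is kept in whichever part is chosen: as the first item if its answer is `b`, as
the last one otherwise. -/
theorem Changing.step {R : Item → Item → Prop} {seg : List Item} (h : Changing f b R seg) :
    Changing f b R (bisectStep f b seg) := by
  unfold bisectStep
  split
  · rename_i h3
    replace h3 : 3 ≤ seg.length := by simpa using h3
    have hm : seg.length / 2 < seg.length := by omega
    rw [List.getD_eq_getElem _ _ hm]
    split
    · rename_i hf
      refine ⟨h.chain.suffix (List.drop_suffix _ _), ?_, ?_, ?_⟩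
      · intro h0
        have := congrArg List.length h0
        rw [List.length_drop, List.length_nil] at this
        omega
      · rw [List.head_drop]
        simpa using hf
      · rw [List.getLast_drop]
        exact h.last
    · rename_i hf
      refine ⟨h.chain.prefix (List.take_prefix _ _), ?_, ?_, ?_⟩
      · intro h0
        have := congrArg List.length h0
        rw [List.length_take, List.length_nil] at this
        omega
      · rw [List.head_take]
        exact h.head
      · rw [List.getLast_eq_getElem, List.getElem_take]
        have : (List.take (seg.length / 2 + 1) seg).length - 1 = seg.length / 2 := by
          rw [List.length_take]; omega
        simp only [this]
        cases b <;> simpa using hf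
  · exact h

/-- From length 3 on, every step shortens the sequence, so as many rounds as there are items are
more than enough to reach length 2. -/
theorem Changing.foldl {R : Item → Item → Prop} {β : Type} (l : List β) {seg : List Item}
    (h : Changing f b R seg) :
    Changing f b R (l.foldl (fun seg _ => bisectStep f b seg) seg) ∧
      (seg.length ≤ l.length + 2 →
        (l.foldl (fun seg _ => bisectStep f b seg) seg).length = 2) := by
  induction l generalizing seg with
  | nil => exact ⟨h, fun h₁ => le_antisymm (by simpa using h₁) h.two_le⟩
  | cons c l ih =>
    refine ⟨(ih h.step).1, fun h₁ => (ih h.step).2 ?_⟩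
    rw [List.length_cons] at h₁
    by_cases h3 : 3 ≤ seg.length
    · have := length_bisectStep (f := f) (b := b) h3
      omega
    · rw [bisectStep_of_lt (by omega)]
      omega

theorem Changing.bisect {R : Item → Item → Prop} {items : List Item}
    (h : Changing f b R items) :
    ∃ x y, bisect f b items = [x, y] ∧ R x y ∧ f x = b ∧ f y = !b := by
  obtain ⟨h₁, h₂⟩ := h.foldl items
  obtain ⟨x, y, hxy⟩ := List.length_eq_two.1 (h₂ (by omega))
  refine ⟨x, y, hxy, ?_⟩
  rw [hxy] at h₁
  obtain ⟨hc, hne, hx, hy⟩ := h₁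
  simpa using ⟨by simpa using hc, hx, hy⟩

theorem finish_eq {R : Item → Item → Prop} {p : ℕ} {items : List Item} (hne : items ≠ [])
    (hc : items.IsChain R) :
    (f (items.head hne) = f (items.getLast hne) ∧ finish f p items = enc (0, items.getLast hne)) ∨
    ∃ x y, R x y ∧ f x = f (items.head hne) ∧ f y ≠ f x ∧
      finish f p items = enc (1, x.1, x.2.headD 0, p, y) := by
  have h₁ : items.headD (0, []) = items.head hne := by
    cases items with
    | nil => exact absurd rfl hne
    | cons x l => rfl
  have h₂ : items.reverse.headD (0, []) = items.getLast hne := by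
    rw [List.headD_eq_head?_getD, List.head?_reverse, List.getLast?_eq_getLast_of_ne_nil hne]
    rfl
  unfold finish
  rw [h₁, h₂]
  split
  · rename_i hf
    exact .inl ⟨by simpa using hf, rfl⟩
  · rename_i hf
    obtain ⟨x, y, hxy, hr, hx, hy⟩ := Changing.bisect (f := f) (b := f (items.head hne)) (R := R)
      (items := items) ⟨hc, hne, rfl, by
        cases h : f (items.head hne) <;> simpa [h] using hf⟩
    refine .inr ⟨x, y, hr, hx, ?_, ?_⟩
    · rw [hy, hx]
      cases f (items.head hne) <;> simp
    · rw [hxy]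
      rfl

end Search

/-! ### Residuals of traces after a step of one process. -/

namespace DistAlphabet

variable {Γ : DistAlphabet}

open Classical in
/-- The letters that depend on the processes in `D`. -/
noncomputable def fut (D : Finset Γ.Proc) : Γ.Word → Γ.Word
  | [] => []
  | c :: w => if Disjoint (Γ.dom c) D then fut D w else c :: fut (D ∪ Γ.dom c) w

open Classical in
/-- The letters that do not depend on the processes in `D`. -/
noncomputable def rest (D : Finset Γ.Proc) : Γ.Word → Γ.Word
  | [] => []
  | c :: w => if Disjoint (Γ.dom c) D then c :: rest D w else rest (D ∪ Γ.dom c) w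

theorem TraceEq.symm {u v : Γ.Word} (h : Γ.TraceEq u v) : Γ.TraceEq v u := by
  induction h with
  | refl => exact .refl _
  | tail _ hs ih =>
    obtain ⟨x, y, a, b, hd, rfl, rfl⟩ := hs
    exact .head ⟨x, y, b, a, hd.symm, rfl, rfl⟩ ih

theorem disjoint_of_mem_rest {D : Finset Γ.Proc} {w : Γ.Word} {c : Γ.Act} (h : c ∈ rest D w) :
    Disjoint (Γ.dom c) D := by
  induction w generalizing D with
  | nil => simp [rest] at h
  | cons a w ih =>
    rw [rest] at h
    split at h
    · rename_i hd
      rcases List.mem_cons.1 h with rfl | h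
      · exact hd
      · exact ih h
    · exact (Finset.disjoint_union_right.1 (ih h)).1

theorem traceEq_rest_fut (D : Finset Γ.Proc) (w : Γ.Word) :
    Γ.TraceEq w (rest D w ++ fut D w) := by
  induction w generalizing D with
  | nil => exact .refl _
  | cons a w ih =>
    rw [rest, fut]
    split
    · exact (ih D).cons a
    · exact ((ih _).cons a).trans (traceEq_front (fun c hc =>
        (Finset.disjoint_union_right.1 (disjoint_of_mem_rest hc)).2) _).symm

theorem chain_fut (D : Finset Γ.Proc) (w : Γ.Word) : Chain D (fut D w) := by
  induction w generalizing D with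
  | nil => trivial
  | cons a w ih =>
    rw [fut]
    split
    · exact ih D
    · rename_i hd
      exact ⟨hd, ih _⟩

theorem length_fut (D : Finset Γ.Proc) (w : Γ.Word) : (fut D w).length ≤ w.length := by
  induction w generalizing D with
  | nil => exact le_rfl
  | cons a w ih =>
    rw [fut]
    split
    · exact (ih D).trans (Nat.le_succ _)
    · exact Nat.succ_le_succ (ih _)

theorem Chain.of_append {D : Finset Γ.Proc} {v w : Γ.Word} (h : Chain D (v ++ w)) : Chain D v := by
  induction v generalizing D with
  | nil => trivial
  | cons a v ih => exact ⟨h.1, ih h.2⟩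

/-- The residual of a co-prime trace after its first step. -/
theorem exists_step_fut {b : Γ.Act} {t : Γ.Word} {p : Γ.Proc} (h : Chain (Γ.dom b) t)
    (hp : p ∈ Γ.dom b) : ∃ s, Γ.IsStep b p s ∧ Γ.TraceEq (b :: t) (s ++ fut {p} t) ∧
      Γ.Starts p (fut {p} t) := by
  -- The letters that do not depend on `p` are moved in front of those that do. The rearranged word
  -- is still a chain after `b`, hence so is its part without `p`, which gives a co-prime step.
  have ht := (traceEq_rest_fut {p} t).cons b
  obtain ⟨w, hw, hc⟩ := h.traceEq ht
  injection hw with _ hw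
  subst hw
  refine ⟨b :: rest {p} t, ⟨hp, ⟨b, isMin_cons_iff.2 ⟨rfl, hc.of_append⟩⟩, _, rfl, ?_⟩, ht, ?_⟩
  · intro c hc
    exact Finset.disjoint_singleton_right.1 (disjoint_of_mem_rest hc)
  · intro hne
    have := chain_fut {p} t
    cases hf : fut {p} t with
    | nil => exact absurd hf hne
    | cons c z =>
      rw [hf] at this
      obtain ⟨h₁, h₂⟩ := this
      rw [Finset.disjoint_singleton_right, not_not] at h₁
      refine ⟨c, isMin_cons_iff.2 ⟨rfl, ?_⟩, h₁⟩
      rwa [Finset.union_eq_right.2 (Finset.singleton_subset_iff.2 h₁)] at h₂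

end DistAlphabet

namespace Table

open DistAlphabet Search

variable {Γ : DistAlphabet}

theorem getD_domList (a : Γ.Act) : (domList Γ).getD a.val [] = natSet (Γ.dom a) := by
  simp [domList]

theorem contains_iff {l : List ℕ} {x : ℕ} : contains l x = true ↔ x ∈ l := by
  simp [contains]

theorem exists_of_mem_natSet {n : ℕ} {s : Finset (Fin n)} {x : ℕ} (h : x ∈ natSet s) :
    ∃ p ∈ s, p.val = x := by
  obtain ⟨p, hp, rfl⟩ := List.mem_map.1 h
  exact ⟨p, by simpa using hp, rfl⟩

theorem future_eq {D : Finset Γ.Proc} {l : List ℕ} (hl : ∀ p : Γ.Proc, p.val ∈ l ↔ p ∈ D)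
    (w : Γ.Word) : future (domList Γ) l (natWord w) = natWord (fut D w) := by
  have key : ∀ (w : Γ.Word) (D : Finset Γ.Proc) (l : List ℕ) (out : List ℕ),
      (∀ p : Γ.Proc, p.val ∈ l ↔ p ∈ D) →
      ((natWord w).foldl (futureStep (domList Γ)) (l, out)).2 = out ++ natWord (fut D w) := by
    intro w
    induction w with
    | nil => intro D l out _; simp [natWord, fut]
    | cons c w ih =>
      intro D l out hl
      have hany : ((domList Γ).getD c.val []).any (fun x => contains l x) = true ↔
          ¬ Disjoint (Γ.dom c) D := by
        rw [getD_domList, List.any_eq_true, Finset.not_disjoint_iff]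
        constructor
        · rintro ⟨x, hx, h⟩
          obtain ⟨p, hp, rfl⟩ := exists_of_mem_natSet hx
          exact ⟨p, hp, (hl p).1 (contains_iff.1 h)⟩
        · rintro ⟨p, hp, h⟩
          exact ⟨p.val, mem_natSet.2 hp, contains_iff.2 ((hl p).2 h)⟩
      rw [natWord, List.map_cons, List.foldl_cons, futureStep, fut]
      by_cases hd : Disjoint (Γ.dom c) D
      · rw [if_neg (by rw [hany]; exact not_not.2 hd), if_pos hd]
        exact ih D l out hl
      · rw [if_pos (hany.2 hd), if_neg hd]
        refine (ih (D ∪ Γ.dom c) _ _ fun p => ?_).trans (by simp [natWord])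
        rw [List.mem_append, hl, getD_domList, mem_natSet, Finset.mem_union]
  exact (key w D l [] hl).trans (List.nil_append _)

end Table

/-! ### Labelled diagrams, and the search from a lost node. -/

/-- Words of `N` for the nodes and transitions of `M`, and tests that tell the nodes apart. -/
structure Labelling {Γ : DistAlphabet} (N M : Diagram Γ) where
  Q : Fin M.nodes → Γ.Word
  T : List Γ.Word
  S : Fin M.nodes → Γ.Act → Γ.Proc → Option Γ.Word
  isNegotiation : M.IsNegotiation
  init_eq : Q M.init = []
  final_iff : ∀ u, Q u ∈ N.language ↔ u = M.final
  nil_mem_T : [] ∈ T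
  uniqueness : ∀ u v, Γ.EquivT N.language T (Q u) (Q v) → u = v
  pref : ∀ u, ∃ t ∈ T, Q u ++ t ∈ N.language
  coPrime_T : ∀ t ∈ T, t ≠ [] → Γ.CoPrime t
  starts : ∀ u, ∀ t ∈ T, Q u ++ t ∈ N.language → ∀ p ∈ M.dnode u, Γ.Starts p t
  mem_dnode : ∀ u p, p ∈ M.dnode u → Q u ∈ N.language ∨
    ∃ t ∈ T, Q u ++ t ∈ N.language ∧ ∃ a, Γ.IsMin t a ∧ p ∈ Γ.dom a
  equivT : ∀ u a p v s, M.δ u a p = some v → S u a p = some s →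
    Γ.EquivT N.language T (Q u ++ s) (Q v)
  exists_test : ∀ u a p v, M.δ u a p = some v → ∃ s t, S u a p = some s ∧ Γ.IsStep a p s ∧
    t ∈ T ∧ Γ.Starts p t ∧ Q u ++ s ++ t ∈ N.language

/-- The labelling of the hypothesis. -/
noncomputable def Table.labelling {Γ : DistAlphabet} {N : Diagram Γ} {H : Table Γ}
    (hN : N.IsNegotiation) (hH : H.Invariants N.language) :
    Labelling N (H.hyp N.language hH) where
  Q := H.Q
  T := H.T
  S := H.S
  isNegotiation := hH.isNegotiation hN
  init_eq := hyp_init hH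
  final_iff _ := hyp_final_iff hH
  nil_mem_T := hH.nil_mem_T
  uniqueness := hH.uniqueness
  pref := hH.pref
  coPrime_T := hH.coPrime_T
  starts u t ht htL p hp := by
    intro hne
    obtain ⟨b, hb⟩ := hH.coPrime_T t ht hne
    refine ⟨b, hb, ?_⟩
    obtain ⟨D, n, hD, hn, ho, hd⟩ := hH.exists_node hN u
    obtain ⟨D₁, hD₁, hDt⟩ := (Diagram.exec_append_iff hN).1 htL
    obtain rfl := hD.unique hN hD₁
    obtain ⟨n₁, hn₁, hb₁⟩ := hDt.only_of_isMin hN hb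
    obtain rfl := ho b n₁ hn₁.1 hb₁
    rw [← hN.dnode_eq_of_mem_out hb₁]
    exact (hd p).1 hp
  mem_dnode _ _ := (mem_hyp_dnode hH).1
  equivT u a p v s h hs := by
    obtain ⟨s₁, hs₁, he⟩ := (hyp_delta_iff hH).1 h
    obtain rfl : s₁ = s := Option.some_injective _ (hs₁.symm.trans hs)
    exact he
  exists_test u a p v h := by
    obtain ⟨s, t, hs, hstep, ht, hst, htL, -, -⟩ := hH.exists_test h
    exact ⟨s, t, hs, hstep, ht, hst, htL⟩

namespace Labelling

open DistAlphabet Diagram Search TransList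

variable {Γ : DistAlphabet} {N M : Diagram Γ}

/-- A node and a word, as numbers. -/
def item (u : Fin M.nodes) (r : Γ.Word) : Item := (u.val, natWord r)

/-- The encoded data. -/
def input (B : Labelling N M) : RawInput :=
  (rawDiagram M, (List.finRange M.nodes).map (fun u => natWord (B.Q u)), B.T.map natWord,
    graphList natWord B.S)

/-- The answers to the queries for nodes followed by words. -/
def Answers (B : Labelling N M) (f : Item → Bool) : Prop :=
  ∀ (u : Fin M.nodes) (r : Γ.Word), f (item u r) = true ↔ B.Q u ++ r ∈ N.language

theorem answers_ask (B : Labelling N M) :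
    B.Answers (ask (fun w => membership N.language (enc w)) B.input.words) := by
  intro u r
  unfold ask item
  have : B.input.words.getD u.val [] = natWord (B.Q u) := by
    simp [input, RawInput.words]
  rw [this, ← membership_encWord, encWord_eq]
  simp [natWord]

/-- A transition of `p` between two items, at which the answers can change from `b`. -/
def Link (B : Labelling N M) (f : Item → Bool) (b : Bool) (p : Γ.Proc)
    (x y : Item) : Prop :=
  ∃ u a v s r r₁, x = item u (a :: r) ∧ y = item v r₁ ∧
    M.δ u a p = some v ∧ B.S u a p = some s ∧ Γ.Starts p r₁ ∧
    (f x = b → f y ≠ b → ¬ (B.Q u ++ s ++ r₁ ∈ N.language ↔ B.Q v ++ r₁ ∈ N.language))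

/-- The empty word cannot tell the two sides apart, since it is a test and the target of a
transition is equivalent to the source followed by the support. So the word is nonempty and starts
with `p`. -/
theorem Link.coPrime {B : Labelling N M} {f : Item → Bool} {b : Bool} {p : Γ.Proc} {x y : Item}
    (h : Link B f b p x y) (hx : f x = b) (hy : f y ≠ b) :
    ∃ (u : Fin M.nodes) (a : Γ.Act) (v : Fin M.nodes) (r s : Γ.Word),
      enc (1, x.1, x.2.headD 0, p.val, y) = encFinding (Finding.target u a p v r) ∧
      M.δ u a p = some v ∧ Γ.CoPrime r ∧ B.S u a p = some s ∧
      ¬ (B.Q u ++ s ++ r ∈ N.language ↔ B.Q v ++ r ∈ N.language) := by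
  obtain ⟨u, a, v, s, r, r₁, rfl, rfl, hδ, hs, hst, hne⟩ := h
  refine ⟨u, a, v, r₁, s, ?_, hδ, ?_, hs, hne hx hy⟩
  · rw [encFinding, encWord_eq]
    rfl
  · by_cases h0 : r₁ = []
    · subst h0
      exact absurd (B.equivT _ _ _ _ _ hδ hs [] B.nil_mem_T) (hne hx hy)
    · obtain ⟨c, hc, -⟩ := hst h0
      exact ⟨c, hc⟩

theorem next_eq {B : Labelling N M} {u : Fin M.nodes} {a : Γ.Act} {p : Γ.Proc}
    {r : Γ.Word} {e : Quad} :
    e ∈ next B.input.trans p.val (item u (a :: r)) ↔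
      ∃ v : Fin M.nodes, M.δ u a p = some v ∧
        e = (u.val, a.val, p.val, v.val) := by
  unfold next
  rw [List.mem_filter]
  change e ∈ moves M.transList u.val a.val ∧ _ ↔ _
  rw [mem_moves_transList]
  constructor
  · rintro ⟨⟨q, v, h, rfl⟩, hp⟩
    obtain rfl : q = p := Fin.ext (by simpa using hp)
    exact ⟨v, h, rfl⟩
  · rintro ⟨v, h, rfl⟩
    exact ⟨⟨p, v, h, rfl⟩, by simp⟩

/-- The walk cannot be continued. -/
def Stuck (p : Γ.Proc) (v : Fin M.nodes) : Γ.Word → Prop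
  | [] => True
  | a :: _ => M.δ v a p = none

theorem walkStep_of_stuck {B : Labelling N M} {p : Γ.Proc} {v : Fin M.nodes}
    {r : Γ.Word} (h : Stuck p v r) (l : List Item) :
    walkStep (domList Γ) B.input.trans p.val (item v r :: l) = item v r :: l := by
  unfold walkStep
  rw [if_pos]
  cases r with
  | nil => rfl
  | cons a r =>
    rw [List.headD_cons, Bool.or_eq_true, List.isEmpty_iff (l := next _ _ _)]
    refine .inr (List.eq_nil_iff_forall_not_mem.2 fun e he => ?_)
    obtain ⟨w, hw, -⟩ := (next_eq).1 he
    rw [show M.δ v a p = none from h] at hw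
    cases hw

theorem walkStep_of_some {B : Labelling N M} {p : Γ.Proc} {v w : Fin M.nodes}
    {a : Γ.Act} {r : Γ.Word} (h : M.δ v a p = some w) (l : List Item) :
    walkStep (domList Γ) B.input.trans p.val (item v (a :: r) :: l) =
      item w (fut {p} r) :: item v (a :: r) :: l := by
  have hmem := (next_eq (r := r) (B := B)).2 ⟨w, h, rfl⟩
  unfold walkStep
  rw [List.headD_cons, if_neg]
  · congr 1
    refine Prod.ext ?_ ?_
    · cases hn : next B.input.trans p.val (item v (a :: r)) with
      | nil => rw [hn] at hmem; cases hmem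
      | cons e l =>
        obtain ⟨w₁, hw₁, rfl⟩ := (next_eq).1 (by rw [hn]; exact List.mem_cons_self)
        rw [h, Option.some_inj] at hw₁
        subst hw₁
        rfl
    · exact Table.future_eq (D := {p}) (fun q => by simp [Fin.ext_iff]) r
  · rw [Bool.or_eq_true, not_or]
    refine ⟨by simp [item, natWord], ?_⟩
    rw [List.isEmpty_iff]
    exact List.ne_nil_of_mem hmem

/-- The word of `x` factors into a step of `p` and the residual, up to trace equivalence. If it is
in the language, `Sound.step_congr` replaces this step by the support; this works only in the
direction from a positive to a negative answer, hence `true`. -/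
theorem link_walk (hN : N.IsNegotiation) (hS : N.Sound) {B : Labelling N M}
    {f : Item → Bool} (hf : B.Answers f) {p : Γ.Proc} {v w : Fin M.nodes} {a : Γ.Act}
    {r : Γ.Word} (h : M.δ v a p = some w) (hr : Γ.Starts p (a :: r)) :
    Link B f true p (item v (a :: r)) (item w (fut {p} r)) ∧ Γ.Starts p (fut {p} r) := by
  obtain ⟨c, hc, hp⟩ := hr (by simp)
  obtain ⟨rfl, hch⟩ := isMin_cons_iff.1 hc
  obtain ⟨x, hx, htr, hst⟩ := exists_step_fut hch hp
  obtain ⟨s, t, hs, hstep, -, ht, htL⟩ := B.exists_test _ _ _ _ h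
  refine ⟨⟨v, a, w, s, r, _, rfl, rfl, h, hs, hst, fun h₁ h₂ hiff => ?_⟩, hst⟩
  rw [hf] at h₁
  rw [ne_eq, hf] at h₂
  have h₃ : B.Q v ++ x ++ fut {p} r ∈ N.language := by
    rw [List.append_assoc]
    exact Exec.traceEq hN (htr.append_left _) h₁
  exact h₂ (hiff.1 (hS.step_congr hN hstep hx ht hst htL h₃))

/-- Each proper step shortens the word and a stuck walk does not move, so the length of the word is
a sufficient number of rounds. The relation is flipped because the list is built with the last item
first. -/
theorem walk_foldl (hN : N.IsNegotiation) (hS : N.Sound) {B : Labelling N M}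
    {f : Item → Bool} (hf : B.Answers f) {p : Γ.Proc} {β : Type} (l : List β)
    {v : Fin M.nodes} {r : Γ.Word} {acc : List Item} (hr : Γ.Starts p r)
    (hlen : Stuck p v r ∨ r.length ≤ l.length)
    (hc : (item v r :: acc).IsChain (flip (Link B f true p))) :
    ∃ (w : Fin M.nodes) (r₁ : Γ.Word) (acc₁ : List Item),
      l.foldl (fun acc _ => walkStep (domList Γ) B.input.trans p.val acc) (item v r :: acc) =
        item w r₁ :: acc₁ ∧ (item v r :: acc) <:+ (item w r₁ :: acc₁) ∧
      Γ.Starts p r₁ ∧ Stuck p w r₁ ∧ r₁.length ≤ r.length ∧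
      M.LReach v w ∧ (item w r₁ :: acc₁).IsChain (flip (Link B f true p)) ∧
      acc₁.length ≤ acc.length + l.length := by
  induction l generalizing v r acc with
  | nil =>
    refine ⟨v, r, acc, rfl, List.suffix_refl _, hr, hlen.elim (fun h => h) fun h => ?_, le_rfl,
      .refl, hc, le_rfl⟩
    rw [List.length_eq_zero_iff.1 (Nat.le_zero.1 h)]
    trivial
  | cons b l ih =>
    rw [List.foldl_cons, List.length_cons]
    by_cases hs : Stuck p v r
    · rw [walkStep_of_stuck hs]
      obtain ⟨w, r₁, acc₁, h₁, h₂, h₃, h₄, h₅, h₆, h₇, h₈⟩ := ih hr (.inl hs) hc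
      exact ⟨w, r₁, acc₁, h₁, h₂, h₃, h₄, h₅, h₆, h₇, by omega⟩
    · replace hlen := hlen.resolve_left hs
      cases r with
      | nil => exact absurd trivial hs
      | cons a r =>
        obtain ⟨x, hx⟩ := Option.ne_none_iff_exists'.1 (show M.δ v a p ≠ none from hs)
        obtain ⟨hl, hst⟩ := link_walk hN hS hf hx hr
        have hfut := length_fut {p} r
        rw [List.length_cons, List.length_cons] at hlen
        rw [walkStep_of_some hx]
        obtain ⟨w, r₁, acc₁, h₁, h₂, h₃, h₄, h₅, h₆, h₇, h₈⟩ :=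
          ih hst (.inr (by omega)) (List.isChain_cons_cons.2 ⟨hl, hc⟩)
        refine ⟨w, r₁, acc₁, h₁, (List.suffix_cons _ _).trans h₂, h₃, h₄, ?_,
          .head ⟨_, _, hx⟩ h₆, h₇, ?_⟩
        · rw [List.length_cons]; omega
        · rw [List.length_cons] at h₈; omega

theorem walk_spec (hN : N.IsNegotiation) (hS : N.Sound) {B : Labelling N M} {f : Item → Bool}
    (hf : B.Answers f) {p : Γ.Proc} {u : Fin M.nodes} {t : Γ.Word} (ht : Γ.Starts p t) :
    ∃ (w : Fin M.nodes) (r : Γ.Word) (hne : walk (domList Γ) B.input.trans p.val (item u t) ≠ []),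
      (walk (domList Γ) B.input.trans p.val (item u t)).IsChain (Link B f true p) ∧
      (walk (domList Γ) B.input.trans p.val (item u t)).head hne = item u t ∧
      (walk (domList Γ) B.input.trans p.val (item u t)).getLast hne = item w r ∧
      (walk (domList Γ) B.input.trans p.val (item u t)).length ≤ t.length + 1 ∧
      Γ.Starts p r ∧ Stuck p w r ∧ r.length ≤ t.length ∧ M.LReach u w := by
  obtain ⟨w, r, acc, h₁, h₂, h₃, h₄, h₅, h₆, h₇, h₈⟩ := walk_foldl hN hS hf (l := natWord t)
    (v := u) (acc := []) ht (.inr (by simp [natWord])) (List.isChain_singleton _)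
  have hw : walk (domList Γ) B.input.trans p.val (item u t) = (item w r :: acc).reverse :=
    congrArg List.reverse h₁
  rw [hw]
  refine ⟨w, r, by simp, List.isChain_reverse.2 h₇, ?_, by simp, ?_, h₃, h₄, h₅, h₆⟩
  · rw [List.head_reverse]
    obtain ⟨l, hl⟩ := h₂
    simp only [← hl]
    simp
  · simp [natWord] at h₈ ⊢
    exact h₈

theorem mem_lost {B : Labelling N M} {x : ℕ} : x ∈ lost B.input ↔
    ∃ u : Fin M.nodes, x = u.val ∧ ¬ M.LReach u M.final := by
  have hlen : B.input.words.length = M.nodes := by simp [input, RawInput.words]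
  unfold lost
  rw [List.mem_filter, List.mem_range, hlen]
  constructor
  · rintro ⟨hx, h⟩
    refine ⟨⟨x, hx⟩, rfl, fun hr => ?_⟩
    have := known_grow_transList_iff.2 hr
    rw [Bool.not_eq_true'] at h
    exact absurd (this.symm.trans h) (by simp)
  · rintro ⟨u, rfl, h⟩
    refine ⟨u.isLt, ?_⟩
    rw [← known_grow_transList_iff] at h
    exact (by simpa using h :
      (!known M.final.val (grow M.transList M.final.val) u.val) = true)

theorem _root_.Search.shortest_spec {l : List (List ℕ)} (hl : l ≠ []) :
    shortest l ∈ l ∧ ∀ t ∈ l, (shortest l).length ≤ t.length := by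
  have key : ∀ (l : List (List ℕ)) (s : List ℕ),
      let x := l.foldl (fun s t => if decide (t.length ≤ s.length) then t else s) s
      (x = s ∨ x ∈ l) ∧ x.length ≤ s.length ∧ ∀ t ∈ l, x.length ≤ t.length := by
    intro l
    induction l with
    | nil => intro s; simp
    | cons t l ih =>
      intro s
      rw [List.foldl_cons]
      obtain ⟨h₁, h₂, h₃⟩ := ih (if decide (t.length ≤ s.length) then t else s)
      have h₄ : (if decide (t.length ≤ s.length) then t else s).length ≤ s.length ∧
          (if decide (t.length ≤ s.length) then t else s).length ≤ t.length := by
        split_ifs with h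
        · exact ⟨by simpa using h, le_rfl⟩
        · simp at h
          exact ⟨le_rfl, h.le⟩
      refine ⟨?_, h₂.trans h₄.1, ?_⟩
      · rcases h₁ with h₁ | h₁
        · rw [h₁]
          split_ifs
          · exact .inr List.mem_cons_self
          · exact .inl rfl
        · exact .inr (List.mem_cons_of_mem _ h₁)
      · intro x hx
        rcases List.mem_cons.1 hx with rfl | hx
        · exact h₂.trans h₄.2
        · exact h₃ x hx
  obtain ⟨h₁, -, h₃⟩ := key l (l.headD [])
  refine ⟨h₁.elim (fun h => ?_) id, h₃⟩
  rw [shortest, h]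
  cases l with
  | nil => exact absurd rfl hl
  | cons t l => exact List.mem_cons_self

/-- The program is not given `m`; a shortest successful test is at most as long as the one that `m`
bounds. -/
theorem answers_pref {B : Labelling N M} {f : Item → Bool} (hf : B.Answers f) (u : Fin M.nodes)
    {m : ℕ} (hm : ∃ t ∈ B.T, B.Q u ++ t ∈ N.language ∧ t.length ≤ m) :
    ∃ t ∈ B.T, B.Q u ++ t ∈ N.language ∧ t.length ≤ m ∧
      shortest (B.input.tests.filter fun t => f (u.val, t)) = natWord t := by
  obtain ⟨t₀, ht₀, htL, hlen⟩ := hm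
  have hmem : natWord t₀ ∈ B.input.tests.filter fun t => f (u.val, t) :=
    List.mem_filter.2 ⟨List.mem_map_of_mem ht₀, (hf u t₀).2 htL⟩
  obtain ⟨h₁, h₂⟩ := shortest_spec (List.ne_nil_of_mem hmem)
  obtain ⟨h₃, h₄⟩ := List.mem_filter.1 h₁
  obtain ⟨t, ht, he⟩ := List.mem_map.1 h₃
  refine ⟨t, ht, ?_, ?_, he.symm⟩
  · rw [← he] at h₄
    exact (hf u t).1 h₄
  · have := h₂ _ hmem
    rw [← he] at this
    simp only [natWord, List.length_map] at this
    omega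

/-- The outcome of the search is an instance of Absent-trans or of Target. -/
inductive Outcome (B : Labelling N M) (m : ℕ) : DTree → Prop
  | absent {u : Fin M.nodes} {r : Γ.Word} {a : Γ.Act} : B.Q u ++ r ∈ N.language → Γ.IsMin r a →
      a ∉ M.out u → r.length ≤ m → Outcome B m (encFinding (Finding.absent u r))
  | target {u v : Fin M.nodes} {a : Γ.Act} {p : Γ.Proc} {r s : Γ.Word} : M.δ u a p = some v →
      Γ.CoPrime r → B.S u a p = some s →
      ¬ (B.Q u ++ s ++ r ∈ N.language ↔ B.Q v ++ r ∈ N.language) →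
      Outcome B m (encFinding (Finding.target u a p v r))

theorem exists_mem_headD {l : List ℕ} {d : ℕ} (h : l ≠ []) : l.headD d ∈ l := by
  cases l with
  | nil => exact absurd rfl h
  | cons a l => exact List.mem_cons_self

/-- The first answer is positive. If the last one is too, the walk did not end with the empty word,
because then its last node would be final and locally reachable from a lost node. So it ended
because the next action is absent. -/
theorem lostItems_spec (hN : N.IsNegotiation) (hS : N.Sound) {B : Labelling N M}
    {f : Item → Bool} (hf : B.Answers f) (hl : lost B.input ≠ []) {m : ℕ}
    (hm : ∀ u, ∃ t ∈ B.T, B.Q u ++ t ∈ N.language ∧ t.length ≤ m) :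
    Outcome B m (finish f (lostItems f B.input).1 (lostItems f B.input).2) ∧
      (lostItems f B.input).2.length ≤ m + 1 := by
  obtain ⟨u, hu, hlost⟩ := mem_lost.1 (exists_mem_headD (d := 0) hl)
  obtain ⟨t, ht, htL, hlen, hsh⟩ := answers_pref hf u (hm u)
  have hne : t ≠ [] := by
    rintro rfl
    rw [List.append_nil, B.final_iff] at htL
    exact hlost (htL ▸ .refl)
  obtain ⟨b, hb⟩ := B.coPrime_T t ht hne
  obtain ⟨t₁, rfl, -⟩ := isMin_iff.1 hb
  obtain ⟨p, hp, hpe⟩ := Table.exists_of_mem_natSet (exists_mem_headD (d := 0)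
    (l := natSet (Γ.dom b)) (by
      obtain ⟨q, hq⟩ := Γ.dom_nonempty b
      exact List.ne_nil_of_mem (mem_natSet.2 hq)))
  have hitems : lostItems f B.input =
      (p.val, walk (domList Γ) B.input.trans p.val (item u (b :: t₁))) := by
    unfold lostItems
    simp only [hu, hsh]
    have : (B.input.doms.getD ((natWord (b :: t₁)).headD 0) []).headD 0 = p.val := by
      rw [hpe]
      exact congrArg (fun l : List ℕ => l.headD 0) (Table.getD_domList b)
    rw [this]
    rfl
  obtain ⟨w, r, hne₁, hc, hhead, hlast, hlen₁, hst, hstuck, hrlen, hreach⟩ :=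
    walk_spec hN hS hf (u := u) (t := b :: t₁) (p := p) fun _ => ⟨b, hb, hp⟩
  rw [hitems]
  refine ⟨?_, hlen₁.trans (by omega)⟩
  have htrue : f (item u (b :: t₁)) = true := (hf _ _).2 htL
  rcases finish_eq (f := f) (p := p.val) hne₁ (R := Link B f true p) hc with
    ⟨h₁, h₂⟩ | ⟨x, y, hl, hx, hy, h₂⟩
  · rw [hhead, hlast, htrue, eq_comm, hf] at h₁
    rw [h₂, hlast]
    have hr : r ≠ [] := by
      rintro rfl
      rw [List.append_nil, B.final_iff] at h₁
      exact hlost (h₁ ▸ hreach)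
    obtain ⟨a, ha, hpa⟩ := hst hr
    have : enc (0, item w r) = encFinding (Finding.absent w r) := by
      rw [encFinding, encWord_eq]
      rfl
    rw [this]
    -- Residuals are no longer than the test, so the bound `m` carries over.
    refine .absent h₁ ha ?_ (hrlen.trans hlen)
    obtain ⟨r₁, rfl, -⟩ := isMin_iff.1 ha
    intro hout
    obtain ⟨v, hv⟩ := B.isNegotiation.exists_of_mem_out hout (p := p)
      (by rwa [B.isNegotiation.dnode_eq_of_mem_out hout])
    rw [show M.δ w a p = none from hstuck] at hv
    cases hv
  · rw [hhead, htrue] at hx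
    rw [hx] at hy
    obtain ⟨u, a, v, r, s, he, h₃, h₄, h₅, h₆⟩ := hl.coPrime hx hy
    rw [h₂, he]
    exact .target h₃ h₄ h₅ h₆

end Labelling

/-! ### Histories of runs, and deadlocks. -/

namespace Diagram

open DistAlphabet TransList

variable {Γ : DistAlphabet} {M : Diagram Γ}

/-- With this, one action contributes exactly one entry per participating process, and a projected
history is a path. -/
theorem nodup_transList (M : Diagram Γ) : M.transList.Nodup := by
  have hf : ∀ n, (List.finRange n).Nodup := List.nodup_finRange
  unfold transList
  refine List.nodup_flatMap.2 ⟨fun u _ => List.nodup_flatMap.2 ⟨fun a _ => ?_, ?_⟩, ?_⟩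
  · refine (hf _).filterMap fun p q e h₁ h₂ => ?_
    obtain ⟨v, -, rfl⟩ := Option.map_eq_some_iff.1 h₁
    obtain ⟨w, -, h⟩ := Option.map_eq_some_iff.1 h₂
    simp only [Prod.mk.injEq] at h
    exact Fin.ext h.2.2.1.symm
  · refine (hf _).imp fun {a b} hab e h₁ h₂ => hab ?_
    obtain ⟨p, -, h₁⟩ := List.mem_filterMap.1 h₁
    obtain ⟨q, -, h₂⟩ := List.mem_filterMap.1 h₂
    obtain ⟨v, -, rfl⟩ := Option.map_eq_some_iff.1 h₁
    obtain ⟨w, -, h⟩ := Option.map_eq_some_iff.1 h₂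
    simp only [Prod.mk.injEq] at h
    exact Fin.ext h.2.1.symm
  · refine (hf _).imp fun {u u'} hab e h₁ h₂ => hab ?_
    obtain ⟨a, -, h₁⟩ := List.mem_flatMap.1 h₁
    obtain ⟨b, -, h₂⟩ := List.mem_flatMap.1 h₂
    obtain ⟨p, -, h₁⟩ := List.mem_filterMap.1 h₁
    obtain ⟨q, -, h₂⟩ := List.mem_filterMap.1 h₂
    obtain ⟨v, -, rfl⟩ := Option.map_eq_some_iff.1 h₁
    obtain ⟨w, -, h⟩ := Option.map_eq_some_iff.1 h₂
    simp only [Prod.mk.injEq] at h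
    exact Fin.ext h.1.symm

/-- The transitions of `q` in a history. -/
def proj (q : ℕ) (h : List Quad) : List Quad := h.filter fun e => decide (e.2.2.1 = q)

theorem proj_moves_of_some {u v : Fin M.nodes} {a : Γ.Act} {q : Γ.Proc}
    (h : M.δ u a q = some v) (l : List Quad) :
    proj q.val (moves M.transList u.val a.val ++ l) =
      (u.val, a.val, q.val, v.val) :: proj q.val l := by
  unfold proj
  rw [List.filter_append]
  suffices h₁ : (moves M.transList u.val a.val).filter (fun e => decide (e.2.2.1 = q.val)) =
      [(u.val, a.val, q.val, v.val)] by rw [h₁]; rfl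
  refine List.perm_singleton.1 ((List.perm_ext_iff_of_nodup
    (((nodup_transList M).filter _).filter _) (List.nodup_singleton _)).2 fun e => ?_)
  rw [List.mem_filter, List.mem_singleton]
  change e ∈ moves M.transList u.val a.val ∧ _ ↔ _
  rw [mem_moves_transList]
  constructor
  · rintro ⟨⟨p, w, hw, rfl⟩, hp⟩
    obtain rfl : p = q := Fin.ext (by simpa using hp)
    rw [h, Option.some_inj] at hw
    rw [hw]
  · rintro rfl
    exact ⟨⟨q, v, h, rfl⟩, by simp⟩

theorem proj_moves_of_notMem (hM : M.IsNegotiation) {u : Fin M.nodes} {a : Γ.Act} {q : Γ.Proc}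
    (h : q ∉ M.dnode u) (l : List Quad) :
    proj q.val (moves M.transList u.val a.val ++ l) = proj q.val l := by
  unfold proj
  rw [List.filter_append]
  suffices h₁ : (moves M.transList u.val a.val).filter (fun e => decide (e.2.2.1 = q.val)) = [] by
    rw [h₁]; rfl
  rw [List.filter_eq_nil_iff]
  intro e he hq
  obtain ⟨p, w, hw, rfl⟩ := mem_moves_transList.1 he
  obtain rfl : p = q := Fin.ext (by simpa using hq)
  obtain ⟨h₁, h₂, -⟩ := hM.dom_match _ _ _ _ hw
  exact h (h₁ ▸ h₂)

/-- The histories of runs, with the configuration and the number of actions. -/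
inductive Hist (M : Diagram Γ) : List Quad → M.Config → ℕ → Prop
  | nil : Hist M [] M.initConfig 0
  | fire {h : List Quad} {C : M.Config} {j : ℕ} {u : Fin M.nodes} {a : Γ.Act} :
      Hist M h C j → M.Enabled C u → a ∈ M.out u →
      Hist M (moves M.transList u.val a.val ++ h) (M.move C u a) (j + 1)

theorem Hist.rep (hM : M.IsNegotiation) {h : List Quad} {C : M.Config} {j : ℕ}
    (hh : M.Hist h C j) : M.Rep M.init.val h C := by
  induction hh with
  | nil => exact Rep.init
  | fire _ hu ha ih =>
    have := ih.fire_of_enabled hM ha hu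
    rwa [TransList.fire, if_pos ((ih.canFire_iff hM ha).2 hu)] at this

theorem Hist.length_proj_le (hM : M.IsNegotiation) {h : List Quad} {C : M.Config} {j : ℕ}
    (hh : M.Hist h C j) (q : Γ.Proc) : (proj q.val h).length ≤ j := by
  induction hh with
  | nil => exact le_rfl
  | @fire h C j u a _ hu ha ih =>
    by_cases hq : q ∈ M.dnode u
    · obtain ⟨v, hv⟩ := hM.exists_of_mem_out ha hq
      rw [proj_moves_of_some hv]
      exact Nat.succ_le_succ ih
    · rw [proj_moves_of_notMem hM hq]
      omega

theorem SRun.exec (hM : M.IsNegotiation) {σ : Fin M.nodes → Option Γ.Act} {rank}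
    (hσ : M.IsStrategy σ rank) {C C₁ : M.Config}
    {l : List (Fin M.nodes)} (h : M.SRun σ C l C₁) : ∃ w, M.Exec C w C₁ := by
  induction h with
  | nil => exact ⟨[], .nil _⟩
  | cons hu ha _ ih =>
    obtain ⟨w, hw⟩ := ih
    exact ⟨_, (exec_cons_iff hM).2 ⟨_, hu, hσ.mem_out _ _ ha, hw⟩⟩

/-- Nothing can be executed, but the configuration is not final. -/
def Deadlock (M : Diagram Γ) (C : M.Config) : Prop :=
  (∀ u a, a ∈ M.out u → ¬ M.Enabled C u) ∧ C ≠ M.finalConfig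

/-- Take a reachable configuration from which success is impossible and follow the strategy until it
is stuck. The strategy is defined at all nodes but the final one, so nothing at all can be executed
there. -/
theorem exists_deadlock (hM : M.IsNegotiation) (hS : ¬ M.Sound)
    (hr : ∀ u, M.LReach u M.final) : ∃ C, M.Reachable C ∧ M.Deadlock C := by
  unfold Sound at hS
  push Not at hS
  obtain ⟨w, C, hC, hno⟩ := hS
  obtain ⟨l, C₁, h₁, -, h₂⟩ := exists_stuck hM isStrategy_strategy C ∅
  refine ⟨C₁, h₁.reachable hM isStrategy_strategy ⟨w, hC⟩, fun u a ha hu => ?_, ?_⟩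
  · refine h₂ u (Set.notMem_empty u) ((lReach_final_iff.1 (hr u)).resolve_left ?_) hu
    rintro rfl
    exact hM.out_final' ha
  · rintro rfl
    obtain ⟨v, hv⟩ := h₁.exec hM isStrategy_strategy
    exact hno v hv

/-- A shortest execution visits no configuration twice. -/
theorem Reachable.exists_short (hM : M.IsNegotiation) {C : M.Config} (h : M.Reachable C) :
    ∃ w : Γ.Word, M.Exec M.initConfig w C ∧ w.length < M.nodes ^ Γ.procs := by
  classical
  have hex : ∃ k, ∃ w : Γ.Word, M.Exec M.initConfig w C ∧ w.length = k := by
    obtain ⟨w, hw⟩ := h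
    exact ⟨_, w, hw, rfl⟩
  obtain ⟨w, hw, hlen⟩ := Nat.find_spec hex
  have hmin : ∀ v, M.Exec M.initConfig v C → w.length ≤ v.length := fun v hv => by
    rw [hlen]
    exact Nat.find_min' hex ⟨v, hv, rfl⟩
  refine ⟨w, hw, ?_⟩
  have hsplit : ∀ i : Fin (w.length + 1), ∃ D, M.Exec M.initConfig (w.take i) D ∧
      M.Exec D (w.drop i) C := fun i => by
    rw [← exec_append_iff hM, List.take_append_drop]
    exact hw
  choose D hD₁ hD₂ using hsplit
  have hinj : Function.Injective D := by
    -- If the configuration after `i` letters equals the one after `j` letters, the first `j`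
    -- letters can be followed by what remains after `i`; if `j` were smaller than `i`, the
    -- execution would be shorter.
    have key : ∀ i j, D i = D j → i ≤ j := by
      intro i j hij
      have h₁ := hmin _ ((hD₁ j).append (hij ▸ hD₂ i))
      rw [List.length_append, List.length_take, List.length_drop] at h₁
      have := i.isLt
      have := j.isLt
      exact Fin.le_def.2 (by omega)
    exact fun i j hij => le_antisymm (key i j hij) (key j i hij.symm)
  have := Fintype.card_le_of_injective D hinj
  rw [Fintype.card_fin] at this
  have hcard : Fintype.card M.Config = M.nodes ^ Γ.procs := by
    rw [Fintype.card_fun, Fintype.card_fin, Fintype.card_fin]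
  omega

/-- On the way to success, consider the first action in which `p` or `q` takes part. It is executed
at the node of one of them, to which the other belongs as well; so both are there. -/
theorem Sound.eq_of_mem (hM : M.IsNegotiation) (hS : M.Sound) {C : M.Config} (hC : M.Reachable C)
    {p q : Γ.Proc} (hp : p ∈ M.dnode (C q)) (hq : q ∈ M.dnode (C p)) : C p = C q := by
  obtain ⟨w, hw⟩ := hS.exists_exec hC
  clear hC
  induction w generalizing C with
  | nil => rw [exec_nil_iff.1 hw]; rfl
  | cons a w ih =>
    obtain ⟨u, hu, ha, hw⟩ := (exec_cons_iff hM).1 hw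
    by_cases h : p ∈ M.dnode u
    · have hpu := hu p h
      rw [hpu] at hq
      rw [hpu, hu q hq]
    · by_cases h₁ : q ∈ M.dnode u
      · have hqu := hu q h₁
        rw [hqu] at hp
        exact absurd hp h
      · have hp₁ := move_of_notMem hM (C := C) (a := a) h
        have hq₁ := move_of_notMem hM (C := C) (a := a) h₁
        have := @ih (M.move C u a) (by rwa [hq₁]) (by rwa [hp₁]) hw
        rwa [hp₁, hq₁] at this

end Diagram

/-! ### Local paths at a deadlock and how they fit together. -/

namespace Labelling

open DistAlphabet Diagram Search TransList

variable {Γ : DistAlphabet} {N M : Diagram Γ}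

/-- The path of a process along a list of transitions (most recent first), and its word. -/
inductive LPath (B : Labelling N M) (q : Γ.Proc) :
    List Quad → Fin M.nodes → Γ.Word → Prop
  | nil : LPath B q [] M.init []
  | cons {l : List Quad} {u v : Fin M.nodes} {a : Γ.Act} {x s : Γ.Word} : LPath B q l u x →
      M.δ u a q = some v → B.S u a q = some s →
      LPath B q ((u.val, a.val, q.val, v.val) :: l) v (x ++ s)

theorem LPath.cons_inv {B : Labelling N M} {q : Γ.Proc} {l : List Quad} {u v w : Fin M.nodes}
    {a : Γ.Act} {y : Γ.Word} (h : LPath B q ((u.val, a.val, q.val, v.val) :: l) w y) :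
    ∃ x s, LPath B q l u x ∧ M.δ u a q = some v ∧ B.S u a q = some s ∧ y = x ++ s := by
  generalize he : (u.val, a.val, q.val, v.val) :: l = l₁ at h
  cases h with
  | nil => cases he
  | @cons l₂ u' v' a' x s h h₁ h₂ =>
    simp only [List.cons.injEq, Prod.mk.injEq, true_and] at he
    obtain ⟨⟨hu, ha, hv⟩, rfl⟩ := he
    obtain rfl := Fin.ext hu
    obtain rfl := Fin.ext ha
    obtain rfl := Fin.ext hv
    exact ⟨x, s, h, h₁, h₂, rfl⟩

theorem exists_support (B : Labelling N M) {u v : Fin M.nodes} {a : Γ.Act} {q : Γ.Proc}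
    (h : M.δ u a q = some v) : ∃ s, B.S u a q = some s ∧ Γ.IsStep a q s := by
  obtain ⟨s, t, hs, hstep, -⟩ := B.exists_test _ _ _ _ h
  exact ⟨s, hs, hstep⟩

theorem _root_.Diagram.Hist.exists_lPath (B : Labelling N M) {h : List Quad} {C : M.Config}
    {j : ℕ} (hh : M.Hist h C j) (q : Γ.Proc) : ∃ x, LPath B q (proj q.val h) (C q) x := by
  have hM := B.isNegotiation
  induction hh with
  | nil => exact ⟨[], .nil⟩
  | @fire h C j u a _ hu ha ih =>
    obtain ⟨x, hx⟩ := ih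
    by_cases hq : q ∈ M.dnode u
    · obtain ⟨v, hv⟩ := hM.exists_of_mem_out ha hq
      obtain ⟨s, hs, -⟩ := B.exists_support hv
      rw [proj_moves_of_some hv, move_of_some hv]
      rw [hu q hq] at hx
      exact ⟨_, hx.cons hv hs⟩
    · rw [proj_moves_of_notMem hM hq, move_of_notMem hM hq]
      exact ⟨x, hx⟩

/-- If the paths of all processes can be executed, they can be executed together. -/
theorem _root_.Diagram.Hist.exists_reachable (hN : N.IsNegotiation) (hS : N.Sound)
    (B : Labelling N M) {h : List Quad} {C : M.Config} {j : ℕ} (hh : M.Hist h C j)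
    (hexec : ∀ q x, LPath B q (proj q.val h) (C q) x → ∃ E, N.Exec N.initConfig x E) :
    ∃ D, N.Reachable D ∧ ∀ q x E, LPath B q (proj q.val h) (C q) x →
      N.Exec N.initConfig x E → D q = E q := by
  have hM := B.isNegotiation
  induction hh with
  | nil =>
    refine ⟨N.initConfig, .init, fun q x E hx hE => ?_⟩
    generalize he : proj q.val [] = l at hx
    cases hx with
    | nil => rw [exec_nil_iff.1 hE]
    | cons => cases he
  | @fire h C j u a hh hu ha ih =>
    obtain ⟨D, hD, hDE⟩ := ih fun q x hx => by
      by_cases hq : q ∈ M.dnode u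
      · obtain ⟨v, hv⟩ := hM.exists_of_mem_out ha hq
        obtain ⟨s, hs, -⟩ := B.exists_support hv
        rw [hu q hq] at hx
        obtain ⟨E, hE⟩ := hexec q (x ++ s) (by
          rw [proj_moves_of_some hv, move_of_some hv]
          exact hx.cons hv hs)
        obtain ⟨E₁, hE₁, -⟩ := (exec_append_iff hN).1 hE
        exact ⟨E₁, hE₁⟩
      · exact hexec q x (by rwa [proj_moves_of_notMem hM hq, move_of_notMem hM hq])
    -- By induction `D` agrees with the path of `q` up to its last step. The support of that step
    -- executes `a` at the node of `q` and then no longer moves `q`.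
    have hstep : ∀ q ∈ M.dnode u, ∀ y E, LPath B q (proj q.val
        (moves M.transList u.val a.val ++ h)) (M.move C u a q) y → N.Exec N.initConfig y E →
        a ∈ N.out (D q) ∧ N.δ (D q) a q = some (E q) := by
      intro q hq y E hy hE
      obtain ⟨v, hv⟩ := hM.exists_of_mem_out ha hq
      rw [proj_moves_of_some hv] at hy
      obtain ⟨x, s, hx, -, hs, rfl⟩ := hy.cons_inv
      obtain ⟨s₁, hs₁, hst⟩ := B.exists_support hv
      obtain rfl := Option.some_injective _ (hs.symm.trans hs₁)
      obtain ⟨E₁, hE₁, hE₂⟩ := (exec_append_iff hN).1 hE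
      have h₁ := hDE q x E₁ (by rwa [hu q hq]) hE₁
      obtain ⟨-, h₂, h₃⟩ := hE₂.step hN hst
      rw [h₁]
      exact ⟨h₂, h₃⟩
    have hout : ∀ q ∈ M.dnode u, a ∈ N.out (D q) := by
      intro q hq
      obtain ⟨y, hy⟩ := (hh.fire hu ha).exists_lPath B q
      obtain ⟨E, hE⟩ := hexec q y hy
      exact (hstep q hq y E hy hE).1
    obtain ⟨p, hp⟩ := hM.dnode_nonempty u
    have hdom : ∀ q ∈ M.dnode u, N.dnode (D q) = M.dnode u := fun q hq => by
      rw [hN.dnode_eq_of_mem_out (hout q hq), hM.dnode_eq_of_mem_out ha]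
    -- All these processes are ready for `a`, at nodes with the same domain. By soundness of `N`
    -- they are at one node, so that `a` can be executed for all of them at once.
    have heq : ∀ q ∈ M.dnode u, D q = D p := fun q hq =>
      hS.eq_of_mem hN hD (by rwa [hdom p hp]) (by rwa [hdom q hq])
    have hen : N.Enabled D (D p) := fun q hq => heq q (by rwa [hdom p hp] at hq)
    refine ⟨N.move D (D p) a, hD.move hN hen (hout p hp), fun q y E hy hE => ?_⟩
    by_cases hq : q ∈ M.dnode u
    · have := (hstep q hq y E hy hE).2
      rw [heq q hq] at this
      exact move_of_some this
    · rw [move_of_notMem hN (by rwa [hdom p hp])]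
      rw [proj_moves_of_notMem hM hq, move_of_notMem hM hq] at hy
      exact hDE q y E hy hE

theorem mem_dnode_of_reachable {B : Labelling N M} {C : M.Config} (hC : M.Reachable C)
    (q : Γ.Proc) : q ∈ M.dnode (C q) := by
  have hM := B.isNegotiation
  obtain ⟨w, hw⟩ := hC
  have key : ∀ (w : Γ.Word) (C₁ : M.Config), q ∈ M.dnode (C₁ q) → M.Exec C₁ w C →
      q ∈ M.dnode (C q) := by
    intro w
    induction w with
    | nil => intro C₁ h hw; rwa [← exec_nil_iff.1 hw]
    | cons a w ih =>
      intro C₁ h hw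
      obtain ⟨u, hu, ha, hw⟩ := (exec_cons_iff hM).1 hw
      refine ih _ ?_ hw
      by_cases hq : q ∈ M.dnode u
      · obtain ⟨v, hv⟩ := hM.exists_of_mem_out ha hq
        rw [move_of_some hv]
        exact (hM.mem_dnode hv).2
      · rwa [move_of_notMem hM hq]
  refine key w _ ?_ hw
  change q ∈ M.dnode M.init
  rw [hM.dnode_init]
  exact Finset.mem_univ q

theorem _root_.Diagram.Hist.reachable (hM : M.IsNegotiation) {h : List Quad} {C : M.Config}
    {j : ℕ} (hh : M.Hist h C j) : M.Reachable C := by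
  induction hh with
  | nil => exact .init
  | fire _ hu ha ih => exact ih.move hM hu ha

/-- At a deadlock, some test tells the path of a process from its node. -/
theorem exists_differ (hN : N.IsNegotiation) (hS : N.Sound) (B : Labelling N M)
    (hr : ∀ u, M.LReach u M.final) {h : List Quad} {C : M.Config} {j : ℕ} (hh : M.Hist h C j)
    (hC : M.Deadlock C) : ∃ q x, LPath B q (proj q.val h) (C q) x ∧ ∃ t ∈ B.T, Γ.Starts q t ∧
      ¬ (x ++ t ∈ N.language ↔ B.Q (C q) ++ t ∈ N.language) := by
  have hM := B.isNegotiation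
  by_contra hcon
  have hagree : ∀ q x, LPath B q (proj q.val h) (C q) x → ∀ t ∈ B.T, Γ.Starts q t →
      (x ++ t ∈ N.language ↔ B.Q (C q) ++ t ∈ N.language) := by
    intro q x hx t ht hst
    by_contra hne
    exact hcon ⟨q, x, hx, t, ht, hst, hne⟩
  have hCr := hh.reachable hM
  have hst : ∀ q, ∀ t ∈ B.T, B.Q (C q) ++ t ∈ N.language → Γ.Starts q t := fun q t ht htL =>
    B.starts _ t ht htL q (mem_dnode_of_reachable (B := B) hCr q)
  -- A test that succeeds at the node `C q` also succeeds after the path, by agreement. Hence the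
  -- path is executable and leads to a tidy configuration.
  have htidy : ∀ q x, LPath B q (proj q.val h) (C q) x →
      ∃ E, N.Exec N.initConfig x E ∧ N.Tidy q E := by
    intro q x hx
    obtain ⟨t, ht, htL⟩ := B.pref (C q)
    have h₁ := hst q t ht htL
    obtain ⟨E, hE, hEt⟩ := (exec_append_iff hN).1 ((hagree q x hx t ht h₁).2 htL)
    exact ⟨E, hE, hEt.tidy hN h₁⟩
  obtain ⟨D, hD, hDE⟩ := hh.exists_reachable hN hS B fun q x hx => by
    obtain ⟨E, hE, -⟩ := htidy q x hx
    exact ⟨E, hE⟩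
  choose x hx using fun q => hh.exists_lPath B q
  choose E hE hET using fun q => htidy q (x q) (hx q)
  have hDE₁ : ∀ q, D q = E q q := fun q => hDE q _ _ (hx q) (hE q)
  -- Here the empty test is used: a path that ends in the final configuration has its word in the
  -- language.
  have hfin : ∀ q, E q q = N.final → C q = M.final := by
    intro q hq
    rcases hET q with h₁ | ⟨h₁, -⟩
    · rw [← B.final_iff]
      have := (hagree q _ (hx q) [] B.nil_mem_T fun h => absurd rfl h).1 (by
        rw [List.append_nil]
        have h₂ := hE q
        rwa [h₁] at h₂)
      rwa [List.append_nil] at this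
    · exact absurd hq h₁
  obtain ⟨w, hw⟩ := hS.exists_exec hD
  cases w with
  | nil =>
    refine hC.2 (funext fun q => hfin q ?_)
    rw [← hDE₁, exec_nil_iff.1 hw]
    rfl
  | cons a w =>
    obtain ⟨n, hn, ha, -⟩ := (exec_cons_iff hN).1 hw
    have hnf : n ≠ N.final := by
      rintro rfl
      exact hN.out_final' ha
    have hEn : ∀ q ∈ N.dnode n, E q q = n := fun q hq => by rw [← hDE₁, hn q hq]
    have honly : ∀ q ∈ N.dnode n, N.Only (E q) n := by
      intro q hq
      rcases hET q with h₁ | ⟨-, -, h₂⟩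
      · have := hEn q hq
        rw [h₁] at this
        exact absurd this.symm hnf
      · rwa [hEn q hq] at h₂
    -- The paths of different processes of `n` may be different words, but all of them lead to the
    -- unique configuration in which only `n` is active.
    have hEE : ∀ q ∈ N.dnode n, ∀ q₁ ∈ N.dnode n, E q = E q₁ := fun q hq q₁ hq₁ =>
      hS.only_unique hN ⟨_, hE q⟩ ⟨_, hE q₁⟩ hnf (honly q hq) (honly q₁ hq₁)
    have htest : ∀ q ∈ N.dnode n, ∀ t ∈ B.T, B.Q (C q) ++ t ∈ N.language →
        N.Exec (E q) t N.finalConfig ∧ ∃ b, Γ.IsMin t b ∧ Γ.dom b = N.dnode n := by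
      intro q hq t ht htL
      have h₁ := (hagree q _ (hx q) t ht (hst q t ht htL)).2 htL
      obtain ⟨E₁, hE₁, hEt⟩ := (exec_append_iff hN).1 h₁
      obtain rfl := (hE q).unique hN hE₁
      refine ⟨hEt, ?_⟩
      have hne : t ≠ [] := by
        rintro rfl
        have h₂ := hEn q hq
        rw [exec_nil_iff.1 hEt] at h₂
        exact hnf h₂.symm
      obtain ⟨b, hb, -⟩ := hst q t ht htL hne
      obtain ⟨n₁, hn₁, hb₁⟩ := hEt.only_of_isMin hN hb
      obtain rfl := (honly q hq).2 n₁ hn₁.1 ⟨b, hb₁⟩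
      exact ⟨b, hb, (hN.dnode_eq_of_mem_out hb₁).symm⟩
    have htrans : ∀ q ∈ N.dnode n, ∀ q₁ ∈ N.dnode n, ∀ t ∈ B.T,
        B.Q (C q) ++ t ∈ N.language → B.Q (C q₁) ++ t ∈ N.language := by
      intro q hq q₁ hq₁ t ht htL
      obtain ⟨h₁, b, hb, hdb⟩ := htest q hq t ht htL
      rw [hEE q hq q₁ hq₁] at h₁
      exact (hagree q₁ _ (hx q₁) t ht fun _ => ⟨b, hb, hdb ▸ hq₁⟩).1 ((hE q₁).append h₁)
    obtain ⟨p, hp⟩ := hN.dnode_nonempty n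
    -- The words of these nodes pass the same tests, so by Uniqueness the processes are at one node
    -- of the hypothesis.
    have hCC : ∀ q ∈ N.dnode n, C q = C p := fun q hq => B.uniqueness _ _ fun t ht =>
      ⟨htrans q hq p hp t ht, htrans p hp q hq t ht⟩
    have hnotfin : C p ≠ M.final := by
      intro h₁
      rw [← B.final_iff] at h₁
      obtain ⟨-, b, hb, -⟩ := htest p hp [] B.nil_mem_T (by rwa [List.append_nil])
      exact not_isMin_nil hb
    have hen : M.Enabled C (C p) := by
      intro q hq
      refine hCC q ?_
      rcases B.mem_dnode _ _ hq with h₁ | ⟨t, ht, htL, b, hb, hqb⟩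
      · exact absurd ((B.final_iff _).1 h₁) hnotfin
      · obtain ⟨-, c, hc, hdc⟩ := htest p hp t ht htL
        obtain ⟨t₁, rfl, -⟩ := isMin_iff.1 hb
        obtain ⟨rfl, -⟩ := isMin_cons_iff.1 hc
        rwa [← hdc]
    -- This node is enabled and not final. It reaches the final node, so it has an outgoing action,
    -- against the deadlock.
    rcases Relation.ReflTransGen.cases_head (hr (C p)) with h₁ | ⟨v, ⟨b, q, hb⟩, -⟩
    · exact hnotfin h₁
    · exact hC.1 _ b ⟨q, by rw [hb]; rfl⟩ hen

end Labelling

/-! ### The search at a deadlock. -/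

namespace Labelling

open DistAlphabet Diagram Search TransList

variable {Γ : DistAlphabet} {N M : Diagram Γ}

theorem support_eq {B : Labelling N M} {u : Fin M.nodes} {a : Γ.Act} {q : Γ.Proc} {v : ℕ}
    {s : Γ.Word} (hs : B.S u a q = some s) :
    support B.input.supports (u.val, a.val, q.val, v) = natWord s := by
  have hmem : ∀ e, e ∈ (graphList natWord B.S).filter (fun x => decide (x.1 = u.val) &&
      (decide (x.2.1 = a.val) && decide (x.2.2.1 = q.val))) ↔
        e = (u.val, a.val, q.val, natWord s) := by
    intro e
    simp only [List.mem_filter, mem_graphList, Bool.and_eq_true, decide_eq_true_eq]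
    constructor
    · rintro ⟨⟨u', a', q', s', h, rfl⟩, h₁, h₂, h₃⟩
      obtain rfl := Fin.ext h₁
      obtain rfl := Fin.ext h₂
      obtain rfl := Fin.ext h₃
      rw [hs, Option.some_inj] at h
      rw [h]
    · rintro rfl
      exact ⟨⟨u, a, q, s, hs, rfl⟩, rfl, rfl, rfl⟩
  unfold support
  change (((graphList natWord B.S).filter _).headD _).2.2.2 = _
  cases hl : (graphList natWord B.S).filter (fun x => decide (x.1 = u.val) &&
      (decide (x.2.1 = a.val) && decide (x.2.2.1 = q.val))) with
  | nil =>
    have := (hmem _).2 rfl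
    rw [hl] at this
    cases this
  | cons e l =>
    have := (hmem e).1 (by rw [hl]; exact List.mem_cons_self)
    rw [this]
    rfl

theorem starts_append {a : Γ.Act} {q : Γ.Proc} {s r : Γ.Word} (hs : Γ.IsStep a q s)
    (hr : Γ.Starts q r) : Γ.Starts q (s ++ r) := by
  obtain ⟨hq, ⟨b, hb⟩, s₁, rfl, -⟩ := hs
  obtain ⟨rfl, hc⟩ := isMin_cons_iff.1 hb
  refine fun _ => ⟨a, isMin_cons_iff.2 ⟨rfl, hc.append ?_⟩, hq⟩
  cases r with
  | nil => trivial
  | cons c r =>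
    obtain ⟨b, hb, hqb⟩ := hr (by simp)
    obtain ⟨rfl, hr⟩ := isMin_cons_iff.1 hb
    exact ⟨fun hd => Finset.disjoint_left.1 hd hqb hq, hr.mono Finset.subset_union_right⟩

/-- An earlier item is obtained by putting the support in front of the word, so a change of answers
at a transition is literally an instance of Target. In contrast to the walk along a test, this holds
for changes in both directions. -/
theorem path_foldl {B : Labelling N M} {f : Item → Bool} (hf : B.Answers f) {q : Γ.Proc}
    {l : List Quad} {v : Fin M.nodes} {x : Γ.Word} (h : LPath B q l v x) {r : Γ.Word}
    {acc : List Item} (hr : Γ.Starts q r)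
    (hc : ∀ b, (item v r :: acc).IsChain (Link B f b q)) :
    ∃ acc₁, l.foldl (fun acc e => (e.1, support B.input.supports e ++ (acc.headD (0, [])).2) :: acc)
        (item v r :: acc) = item M.init (x ++ r) :: acc₁ ∧
      (item v r :: acc) <:+ (item M.init (x ++ r) :: acc₁) ∧
      (∀ b, (item M.init (x ++ r) :: acc₁).IsChain (Link B f b q)) ∧
      acc₁.length = acc.length + l.length := by
  induction h generalizing r acc with
  | nil => exact ⟨acc, rfl, List.suffix_refl _, hc, rfl⟩
  | @cons l u v a x s h hδ hs ih =>
    obtain ⟨s₁, hs₁, hstep⟩ := B.exists_support hδ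
    obtain rfl := Option.some_injective _ (hs.symm.trans hs₁)
    have hitem : ((u.val, a.val, q.val, v.val).1, support B.input.supports
        (u.val, a.val, q.val, v.val) ++ ((item v r :: acc).headD (0, [])).2) =
          item u (s ++ r) := by
      rw [support_eq hs]
      simp [item, natWord]
    rw [List.foldl_cons, hitem]
    have hlink : ∀ b, Link B f b q (item u (s ++ r)) (item v r) := by
      intro b
      obtain ⟨-, -, s₂, rfl, -⟩ := hstep
      refine ⟨u, a, v, _, s₂ ++ r, r, rfl, rfl, hδ, hs, hr, fun h₁ h₂ hiff => h₂ ?_⟩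
      rw [← h₁, Bool.eq_iff_iff, hf, hf, ← hiff, List.append_assoc]
    obtain ⟨acc₁, h₁, h₂, h₃, h₄⟩ := ih (starts_append hstep hr)
      fun b => List.isChain_cons_cons.2 ⟨hlink b, hc b⟩
    rw [List.append_assoc]
    refine ⟨acc₁, h₁, (List.suffix_cons _ _).trans h₂, h₃, ?_⟩
    rw [List.length_cons] at h₄ ⊢
    omega

theorem pathItems_spec {B : Labelling N M} {f : Item → Bool} (hf : B.Answers f) {h : List Quad}
    {C : M.Config} {j : ℕ} (hh : M.Hist h C j) {q : Γ.Proc} {x t : Γ.Word}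
    (hx : LPath B q (proj q.val h) (C q) x) (ht : Γ.Starts q t) :
    ∃ hne : pathItems B.input h (q.val, natWord t) ≠ [],
      (∀ b, (pathItems B.input h (q.val, natWord t)).IsChain (Link B f b q)) ∧
      (pathItems B.input h (q.val, natWord t)).head hne = item M.init (x ++ t) ∧
      (pathItems B.input h (q.val, natWord t)).getLast hne = item (C q) t ∧
      (pathItems B.input h (q.val, natWord t)).length ≤ j + 1 := by
  obtain ⟨acc, h₁, h₂, h₃, h₄⟩ := path_foldl hf hx (acc := []) ht
    fun b => List.isChain_singleton _
  have hp : pathItems B.input h (q.val, natWord t) = item M.init (x ++ t) :: acc := by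
    rw [← h₁]
    unfold pathItems
    have := hh.rep B.isNegotiation q
    change List.foldl _ [(loc M.init.val h q.val, natWord t)] _ = _
    rw [this]
    rfl
  rw [hp]
  refine ⟨by simp, h₃, rfl, ?_, ?_⟩
  · obtain ⟨l, hl⟩ := h₂
    simp only [← hl]
    simp
  · have := hh.length_proj_le B.isNegotiation q
    rw [List.length_cons]
    simp at h₄
    omega

theorem mem_pairs {B : Labelling N M} {y : ℕ × List ℕ} : y ∈ pairs B.input ↔
    ∃ (q : Γ.Proc) (t : Γ.Word), y = (q.val, natWord t) ∧ t ∈ B.T ∧ Γ.Starts q t := by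
  have key : ∀ (q : Γ.Proc), ∀ t ∈ B.T, ((natWord t).isEmpty ||
      contains (B.input.doms.getD ((natWord t).headD 0) []) q.val) = true ↔ Γ.Starts q t := by
    intro q t ht
    cases t with
    | nil => simp [natWord, Starts]
    | cons a t =>
      have h₁ : B.input.doms.getD ((natWord (a :: t)).headD 0) [] = natSet (Γ.dom a) :=
        Table.getD_domList a
      rw [h₁, Bool.or_eq_true, Table.contains_iff, mem_natSet]
      constructor
      · rintro (h | h)
        · simp [natWord] at h
        · intro hne
          obtain ⟨b, hb⟩ := B.coPrime_T _ ht hne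
          obtain ⟨rfl, -⟩ := isMin_cons_iff.1 hb
          exact ⟨_, hb, h⟩
      · intro h
        obtain ⟨b, hb, hq⟩ := h (by simp)
        obtain ⟨rfl, -⟩ := isMin_cons_iff.1 hb
        exact .inr hq
  unfold pairs
  simp only [List.mem_flatMap, List.mem_range, List.mem_map, List.mem_filter]
  constructor
  · rintro ⟨q, hq, _, ⟨ht, h⟩, rfl⟩
    obtain ⟨t, ht₁, rfl⟩ := List.mem_map.1 ht
    exact ⟨⟨q, hq⟩, t, rfl, ht₁, (key ⟨q, hq⟩ t ht₁).1 h⟩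
  · rintro ⟨q, t, rfl, ht, h⟩
    exact ⟨q.val, q.isLt, natWord t, ⟨List.mem_map_of_mem ht, (key q t ht).2 h⟩, rfl⟩

theorem length_pairs (B : Labelling N M) :
    (pairs B.input).length ≤ Γ.procs * B.T.length := by
  unfold pairs
  rw [List.length_flatMap]
  refine (List.sum_le_card_nsmul _ B.T.length ?_).trans ?_
  · intro n hn
    obtain ⟨q, -, rfl⟩ := List.mem_map.1 hn
    rw [List.length_map]
    refine (List.length_filter_le _ _).trans ?_
    change (B.T.map natWord).length ≤ _
    rw [List.length_map]
  · rw [List.length_map, List.length_range]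
    exact le_rfl

theorem dead_iff {B : Labelling N M} {h : List Quad} {C : M.Config}
    (hC : M.Rep M.init.val h C) : dead B.input h = true ↔ M.Deadlock C := by
  have hM := B.isNegotiation
  unfold dead Deadlock
  rw [Bool.and_eq_true, List.all_eq_true, Bool.not_eq_true', ← Bool.not_eq_true]
  refine and_congr ?_ (not_congr (hC.allAt_iff M.final))
  constructor
  · intro hall u a ha hu
    obtain ⟨p, hp⟩ := hM.dnode_nonempty u
    obtain ⟨v, hv⟩ := hM.exists_of_mem_out ha hp
    have := hall _ (mem_transList.2 ⟨u, a, p, v, hv, rfl⟩)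
    rw [Bool.not_eq_true', ← Bool.not_eq_true] at this
    exact this ((hC.canFire_iff hM ha).2 hu)
  · intro h e he
    obtain ⟨u, a, p, v, hv, rfl⟩ := mem_transList.1 he
    have ha : a ∈ M.out u := ⟨p, by rw [hv]; rfl⟩
    rw [Bool.not_eq_true', ← Bool.not_eq_true]
    exact fun hc => h u a ha ((hC.canFire_iff hM ha).1 hc)

theorem foldl_extend_of_dead {B : Labelling N M} {β : Type} (l : List β) {Hs : List (List Quad)}
    (h : Hs.any (dead B.input) = true) :
    l.foldl (fun Hs _ => extend B.input Hs) Hs = Hs := by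
  induction l with
  | nil => rfl
  | cons b l ih => rw [List.foldl_cons, extend, if_pos h, ih]

theorem foldl_extend_hist {B : Labelling N M} {β : Type} (l : List β) {Hs : List (List Quad)}
    {k : ℕ} (hH : ∀ h ∈ Hs, ∃ C j, M.Hist h C j ∧ j ≤ k) :
    ∀ h ∈ l.foldl (fun Hs _ => extend B.input Hs) Hs, ∃ C j, M.Hist h C j ∧ j ≤ k + l.length := by
  have hM := B.isNegotiation
  induction l generalizing Hs k with
  | nil => exact hH
  | cons b l ih =>
    rw [List.foldl_cons, List.length_cons, Nat.add_comm l.length, ← Nat.add_assoc]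
    refine ih fun h hh => ?_
    unfold extend at hh
    split at hh
    · obtain ⟨C, j, h₁, h₂⟩ := hH h hh
      exact ⟨C, j, h₁, by omega⟩
    · obtain ⟨h₀, hh₀, hh⟩ := List.mem_flatMap.1 hh
      obtain ⟨e, he, rfl⟩ := List.mem_map.1 hh
      obtain ⟨u, a, p, v, hv, rfl⟩ := mem_transList.1 he
      obtain ⟨C, j, h₁, h₂⟩ := hH h₀ hh₀
      have ha : a ∈ M.out u := ⟨p, by rw [hv]; rfl⟩
      change ∃ C j, M.Hist (TransList.fire M.transList M.init.val h₀ u.val a.val) C j ∧ _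
      by_cases hu : M.Enabled C u
      · rw [TransList.fire, if_pos (((h₁.rep hM).canFire_iff hM ha).2 hu)]
        exact ⟨_, _, h₁.fire hu ha, by omega⟩
      · rw [(h₁.rep hM).fire_of_not_enabled hM ha hu]
        exact ⟨C, j, h₁, by omega⟩

/-- As long as no history is dead, one round extends each of them by every enabled action, so it
keeps pace with the given execution. -/
theorem exists_dead_foldl {B : Labelling N M} {β : Type} (l : List β) {Hs : List (List Quad)}
    {h : List Quad} (hh : h ∈ Hs) {C C₁ : M.Config} {j : ℕ} (hC : M.Hist h C j) {w : Γ.Word}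
    (hw : M.Exec C w C₁) (hd : M.Deadlock C₁) (hlen : w.length ≤ l.length) :
    ∃ h₁ ∈ l.foldl (fun Hs _ => extend B.input Hs) Hs, dead B.input h₁ = true := by
  have hM := B.isNegotiation
  induction l generalizing Hs h C j w with
  | nil =>
    obtain rfl := List.length_eq_zero_iff.1 (Nat.le_zero.1 hlen)
    obtain rfl := exec_nil_iff.1 hw
    exact ⟨h, hh, (dead_iff (hC.rep hM)).2 hd⟩
  | cons b l ih =>
    by_cases hany : Hs.any (dead B.input) = true
    · rw [foldl_extend_of_dead _ hany]
      exact List.any_eq_true.1 hany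
    · rw [List.foldl_cons]
      cases w with
      | nil =>
        obtain rfl := exec_nil_iff.1 hw
        exact absurd (List.any_eq_true.2 ⟨h, hh, (dead_iff (hC.rep hM)).2 hd⟩) hany
      | cons a w =>
        obtain ⟨u, hu, ha, hw⟩ := (exec_cons_iff hM).1 hw
        obtain ⟨p, hp⟩ := hM.dnode_nonempty u
        obtain ⟨v, hv⟩ := hM.exists_of_mem_out ha hp
        refine ih ?_ (hC.fire hu ha) hw (by simpa using hlen)
        rw [extend, if_neg hany]
        refine List.mem_flatMap.2 ⟨h, hh, List.mem_map.2
          ⟨_, mem_transList.2 ⟨u, a, p, v, hv, rfl⟩, ?_⟩⟩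
        exact if_pos (((hC.rep hM).canFire_iff hM ha).2 hu)

theorem length_fuel (B : Labelling N M) : (fuel B.input).length = M.nodes ^ Γ.procs := by
  have key : ∀ (l : List ℕ) (s : List (List ℕ)),
      (l.foldl (fun l _ => l.flatMap fun _ => B.input.words) s).length =
        s.length * M.nodes ^ l.length := by
    intro l
    induction l with
    | nil => simp
    | cons a l ih =>
      intro s
      have hlen : B.input.words.length = M.nodes := by simp [input, RawInput.words]
      rw [List.foldl_cons, ih, List.length_flatMap, List.map_const', List.sum_replicate, hlen,
        List.length_cons, pow_succ', smul_eq_mul, mul_assoc]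
  refine (key _ _).trans ?_
  rw [List.length_range]
  simp [input, RawInput.procs, rawDiagram]

/-- There are as many rounds as configurations, enough for a shortest execution to a deadlock. The
same number bounds the length of the history found. -/
theorem deadlock_spec {B : Labelling N M} (hS : ¬ M.Sound) (hr : ∀ u, M.LReach u M.final) :
    ∃ C j, M.Hist (deadlock B.input) C j ∧ M.Deadlock C ∧ j ≤ M.nodes ^ Γ.procs := by
  have hM := B.isNegotiation
  obtain ⟨C, hC, hd⟩ := exists_deadlock hM hS hr
  obtain ⟨w, hw, hlen⟩ := hC.exists_short hM
  obtain ⟨h, hh, hdead⟩ := exists_dead_foldl (B := B) (fuel B.input) (Hs := [[]])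
    List.mem_cons_self .nil hw hd (by rw [length_fuel]; exact hlen.le)
  have hmem : deadlock B.input ∈ ((fuel B.input).foldl (fun Hs _ => extend B.input Hs)
      [[]]).filter (dead B.input) := by
    unfold deadlock
    have := List.mem_filter.2 ⟨hh, hdead⟩
    cases hl : ((fuel B.input).foldl (fun Hs _ => extend B.input Hs) [[]]).filter
        (dead B.input) with
    | nil => rw [hl] at this; cases this
    | cons a l => exact List.mem_cons_self
  obtain ⟨h₁, h₂⟩ := List.mem_filter.1 hmem
  obtain ⟨C₁, j, h₃, h₄⟩ := foldl_extend_hist (B := B) (fuel B.input) (Hs := [[]]) (k := 0)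
    (fun h hh => ⟨M.initConfig, 0, by rw [List.mem_singleton.1 hh]; exact .nil, le_rfl⟩) _ h₁
  rw [length_fuel, Nat.zero_add] at h₄
  exact ⟨C₁, j, h₃, (dead_iff (h₃.rep hM)).1 h₂, h₄⟩

theorem _root_.Search.differ_iff {f : Item → Bool} {items : List Item} (hne : items ≠ []) :
    differ f items = true ↔ f (items.head hne) ≠ f (items.getLast hne) := by
  have h₁ : items.headD (0, []) = items.head hne := by
    cases items with
    | nil => exact absurd rfl hne
    | cons x l => rfl
  have h₂ : items.reverse.headD (0, []) = items.getLast hne := by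
    rw [List.headD_eq_head?_getD, List.head?_reverse, List.getLast?_eq_getLast_of_ne_nil hne]
    rfl
  unfold differ
  rw [h₁, h₂]
  simp

/-- Two queries per pair of process and test reveal a pair with different answers at the two ends of
the path; `exists_differ` says that there is one. The result is then always a Target. -/
theorem deadItems_spec (hN : N.IsNegotiation) (hS : N.Sound) {B : Labelling N M}
    {f : Item → Bool} (hf : B.Answers f) (hM : ¬ M.Sound) (hr : ∀ u, M.LReach u M.final)
    (m : ℕ) : Outcome B m (finish f (deadItems f B.input).1 (deadItems f B.input).2) ∧
      (deadItems f B.input).2.length ≤ M.nodes ^ Γ.procs + 1 := by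
  obtain ⟨C, j, hh, hd, hj⟩ := deadlock_spec (B := B) hM hr
  have hdiff : ∀ (q : Γ.Proc) (t x : Γ.Word), LPath B q (proj q.val (deadlock B.input)) (C q) x →
      Γ.Starts q t → (differ f (pathItems B.input (deadlock B.input) (q.val, natWord t)) = true ↔
        ¬ (x ++ t ∈ N.language ↔ B.Q (C q) ++ t ∈ N.language)) := by
    intro q t x hx ht
    obtain ⟨hne, -, h₁, h₂, -⟩ := pathItems_spec hf hh hx ht
    rw [differ_iff hne, h₁, h₂, ne_eq, Bool.eq_iff_iff, hf, hf, B.init_eq, List.nil_append]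
  obtain ⟨q₀, x₀, hx₀, t₀, ht₀, hst₀, hne₀⟩ := exists_differ hN hS B hr hh hd
  have hmem₀ := List.mem_filter (p := fun x => differ f
    (pathItems B.input (deadlock B.input) x)) |>.2 ⟨mem_pairs.2 ⟨q₀, t₀, rfl, ht₀, hst₀⟩,
    (hdiff q₀ t₀ x₀ hx₀ hst₀).2 hne₀⟩
  have hmem : ((pairs B.input).filter fun x =>
      differ f (pathItems B.input (deadlock B.input) x)).headD (0, []) ∈
        (pairs B.input).filter fun x => differ f (pathItems B.input (deadlock B.input) x) := by
    cases hl : (pairs B.input).filter fun x =>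
        differ f (pathItems B.input (deadlock B.input) x) with
    | nil => rw [hl] at hmem₀; cases hmem₀
    | cons a l => exact List.mem_cons_self
  obtain ⟨h₁, h₂⟩ := List.mem_filter.1 hmem
  obtain ⟨q, t, he, -, hst⟩ := mem_pairs.1 h₁
  have hitems : deadItems f B.input =
      (q.val, pathItems B.input (deadlock B.input) (q.val, natWord t)) := by
    unfold deadItems
    simp only [he]
  rw [he] at h₂
  obtain ⟨x, hx⟩ := hh.exists_lPath B q
  obtain ⟨hne, hc, hhead, hlast, hlen⟩ := pathItems_spec hf hh hx hst
  rw [hitems]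
  refine ⟨?_, hlen.trans (by omega)⟩
  rw [differ_iff hne] at h₂
  rcases finish_eq (f := f) (p := q.val) hne (hc (f ((pathItems B.input (deadlock B.input)
    (q.val, natWord t)).head hne))) with ⟨h₃, -⟩ | ⟨y, z, hl, hy, hz, h₃⟩
  · exact absurd h₃ h₂
  · rw [hy] at hz
    obtain ⟨u, a, v, r, s, he, h₄, h₅, h₆, h₇⟩ := hl.coPrime hy hz
    rw [h₃, he]
    exact .target h₄ h₅ h₆ h₇

end Labelling

/-! ### Bounds on the number of queries. -/

namespace Labelling

open DistAlphabet Diagram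

variable {Γ : DistAlphabet} {N M : Diagram Γ}

/-- By Uniqueness, a node is determined by the set of tests that succeed after its word. -/
theorem nodes_le (B : Labelling N M) : M.nodes ≤ 2 ^ B.T.length := by
  classical
  let F : Fin M.nodes → (Fin B.T.length → Bool) := fun u i =>
    decide (B.Q u ++ B.T.get i ∈ N.language)
  have hF : Function.Injective F := by
    intro u v h
    refine B.uniqueness u v fun t ht => ?_
    obtain ⟨i, rfl⟩ := List.get_of_mem ht
    have := congrFun h i
    simpa [F] using this
  have := Fintype.card_le_of_injective F hF
  simpa using this

/-- If the two coincided in `N`, the empty word would be in the language, and the hypothesis would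
start in its final configuration and be sound. -/
theorem init_ne_final {B : Labelling N M} (hS : ¬ M.Sound) : N.init ≠ N.final := by
  intro h
  refine hS ?_
  have h₁ : M.init = M.final := by
    rw [← B.final_iff, B.init_eq]
    refine exec_nil_iff.2 (funext fun _ => h)
  intro w C hw
  have h₂ : M.initConfig = M.finalConfig := funext fun _ => h₁
  cases w with
  | nil => exact ⟨[], by rw [← exec_nil_iff.1 hw, h₂]; exact .nil _⟩
  | cons a w => exact absurd (h₂ ▸ hw) (not_exec_final B.isNegotiation)

/-- The initial node has an outgoing action, and this action has a transition for each process. -/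
theorem _root_.Diagram.Sound.procs_le (hN : N.IsNegotiation) (hS : N.Sound)
    (h : N.init ≠ N.final) : Γ.procs ≤ N.size := by
  rcases Relation.ReflTransGen.cases_head (hS.lReach_final hN .refl) with h₁ | ⟨v, ⟨a, p, hp⟩, -⟩
  · exact absurd h₁ h
  · have hdom := (hN.dom_match _ _ _ _ hp).1
    rw [hN.dnode_init] at hdom
    let F : Γ.Proc → Fin N.nodes × Γ.Act × Γ.Proc := fun q => (N.init, a, q)
    have hF : Function.Injective F := fun q q' h => by simpa [F] using h
    have h₂ : (Finset.univ.image F).card ≤ (Finset.univ.filter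
        fun x : Fin N.nodes × Γ.Act × Γ.Proc => (N.δ x.1 x.2.1 x.2.2).isSome).card := by
      refine Finset.card_le_card fun x hx => ?_
      obtain ⟨q, -, rfl⟩ := Finset.mem_image.1 hx
      exact Finset.mem_filter.2 ⟨Finset.mem_univ _,
        (hN.dom_match _ _ _ _ hp).2.2.2 q (hdom ▸ Finset.mem_univ q)⟩
    rw [Finset.card_image_of_injective _ hF, Finset.card_univ, Fintype.card_fin] at h₂
    unfold size
    omega

/-- The deadlock case costs 2 s|T| for the pairs, 2 for the ends and s|T| for the bisection; the
lost case costs |T| for the choice of the test, 2 for the ends and log m + 1 for the bisection. As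
s|T| is at least 1, the factor 6 absorbs the constants. -/
theorem find_spec (hN : N.IsNegotiation) (hS : N.Sound) {B : Labelling N M} (hM : ¬ M.Sound)
    {f : Item → Bool} (hf : B.Answers f) {m : ℕ}
    (hm : ∀ u, ∃ t ∈ B.T, B.Q u ++ t ∈ N.language ∧ t.length ≤ m) :
    Outcome B m (Search.find f B.input) ∧
      (if (Search.lost B.input).isEmpty then 2 * (Search.pairs B.input).length
        else B.input.tests.length) +
        (2 + Nat.clog 2 ((Search.itemsOf f B.input).2.length - 1)) ≤
          6 * (N.size * B.T.length + Nat.log 2 m) := by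
  have hk := hS.procs_le hN (B.init_ne_final hM)
  have hT : 1 ≤ B.T.length := List.length_pos_of_mem B.nil_mem_T
  have hs : 1 ≤ N.size := by
    have := N.init.pos
    unfold size
    omega
  have hkT : Γ.procs * B.T.length ≤ N.size * B.T.length := Nat.mul_le_mul_right _ hk
  have hsT : 1 ≤ N.size * B.T.length := Nat.mul_le_mul hs hT
  have hTs : B.T.length ≤ N.size * B.T.length := Nat.le_mul_of_pos_left _ hs
  unfold Search.find
  by_cases hl : Search.lost B.input = []
  · have hr : ∀ u, M.LReach u M.final := fun u => by
      by_contra h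
      have := (mem_lost (B := B)).2 ⟨u, rfl, h⟩
      rw [hl] at this
      cases this
    obtain ⟨h₁, h₂⟩ := deadItems_spec hN hS hf hM hr m
    have hi : Search.itemsOf f B.input = Search.deadItems f B.input :=
      if_pos (List.isEmpty_iff.2 hl)
    rw [hi, if_pos (List.isEmpty_iff.2 hl)]
    refine ⟨h₁, ?_⟩
    -- The path may be exponentially long, but its logarithm is at most |T| times the number of
    -- processes.
    have h₃ : Nat.clog 2 ((Search.deadItems f B.input).2.length - 1) ≤ B.T.length * Γ.procs := by
      refine Nat.clog_le_of_le_pow ?_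
      rw [pow_mul]
      exact (Nat.sub_le_of_le_add h₂).trans (Nat.pow_le_pow_left B.nodes_le _)
    have h₄ := B.length_pairs
    rw [Nat.mul_comm] at h₃
    omega
  · obtain ⟨h₁, h₂⟩ := lostItems_spec hN hS hf hl hm
    have hne : ¬ (Search.lost B.input).isEmpty = true := fun h => hl (List.isEmpty_iff.1 h)
    have hi : Search.itemsOf f B.input = Search.lostItems f B.input := if_neg hne
    rw [hi, if_neg hne]
    refine ⟨h₁, ?_⟩
    have h₃ : Nat.clog 2 ((Search.lostItems f B.input).2.length - 1) ≤ Nat.log 2 m + 1 :=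
      Nat.clog_le_of_le_pow ((Nat.sub_le_of_le_add h₂).trans
        (Nat.lt_pow_succ_log_self one_lt_two m).le)
    have h₄ : B.input.tests.length = B.T.length := List.length_map _
    omega

end Labelling

theorem exists_search_program : ∃ (find : Prog) (K : ℕ),
    ∀ (Γ : DistAlphabet) (N : Diagram Γ), N.IsNegotiation → N.Sound →
    ∀ (H : Table Γ) (hH : H.Invariants N.language) (m : ℕ),
      (∀ u, ∃ t ∈ H.T, H.Q u ++ t ∈ N.language ∧ t.length ≤ m) →
      ¬ (H.hyp N.language hH).Sound →
      ∃ (x : Finding Γ H.numQ) (t q : ℕ),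
        Runs (membership N.language) find
          (.cons (encDiagram (H.hyp N.language hH)) (encTable H)) (encFinding x) t q ∧
        x.Holds H N.language hH ∧
        (∀ u r, x = .absent u r → r.length ≤ m) ∧
        q ≤ K * (N.size * H.T.length + Nat.log 2 m) := by
  obtain ⟨e, he⟩ := QFun.find
  refine ⟨e, 6, fun Γ N hN hS H hH m hm hM => ?_⟩
  obtain ⟨t, q, ht, hq⟩ := he (membership N.language) (H.labelling hN hH).input
  obtain ⟨h₁, h₂⟩ := Labelling.find_spec hN hS hM (H.labelling hN hH).answers_ask hm
  have hin : DTree.cons (encDiagram (H.hyp N.language hH)) (encTable H) =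
      enc (H.labelling hN hH).input := by
    rw [encDiagram_eq, encTable_eq]
    rfl
  rw [hin]
  have hrun : ∀ y, Search.find (Search.ask (fun w => membership N.language (enc w))
      (H.labelling hN hH).input.words) (H.labelling hN hH).input = y →
      Runs (membership N.language) e (enc (H.labelling hN hH).input) y t q := by
    rintro y rfl
    exact ht
  generalize Search.find _ _ = y at h₁ hrun
  cases h₁ with
  | @absent u r a hL ha hout hlen =>
    refine ⟨.absent u r, t, q, hrun _ rfl, ⟨hL, a, ha, hout⟩, ?_, hq.trans h₂⟩
    rintro u₁ r₁ h
    injection h with h₃ h₄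
    rwa [← h₄]
  | @target u v a p r s hδ hr hs hne =>
    refine ⟨.target u a p v r, t, q, hrun _ rfl, ⟨hδ, hr, s, hs, hne⟩, ?_, hq.trans h₂⟩
    rintro u₁ r₁ h
    cases h

theorem mainTheorem6 :
    (∃ (check : Prog) (P : Polynomial ℕ),
      ∀ (Γ : DistAlphabet) (N : Diagram Γ), N.IsNegotiation → N.Sound →
      ∀ (H : Table Γ) (hH : H.Invariants N.language),
        ∃ (y : DTree) (t : ℕ),
          Runs (membership N.language) check (encDiagram (H.hyp N.language hH)) y t 0 ∧
          t ≤ P.eval (encDiagram (H.hyp N.language hH)).size ∧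
          (y ≠ .nil ↔ (H.hyp N.language hH).Sound)) ∧
    (∃ (find : Prog) (K : ℕ),
      ∀ (Γ : DistAlphabet) (N : Diagram Γ), N.IsNegotiation → N.Sound →
      ∀ (H : Table Γ) (hH : H.Invariants N.language) (m : ℕ),
        (∀ u, ∃ t ∈ H.T, H.Q u ++ t ∈ N.language ∧ t.length ≤ m) →
        ¬ (H.hyp N.language hH).Sound →
        ∃ (x : Finding Γ H.numQ) (t q : ℕ),
          Runs (membership N.language) find
            (.cons (encDiagram (H.hyp N.language hH)) (encTable H)) (encFinding x) t q ∧
          x.Holds H N.language hH ∧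
          (∀ u r, x = .absent u r → r.length ≤ m) ∧
          q ≤ K * (N.size * H.T.length + Nat.log 2 m)) :=
  ⟨exists_soundness_program, exists_search_program⟩
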